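/- Let $M=(S,\mathcal B)$ denote a matroid on a finite ground set $S$ with base family $\mathcal B$, and for $p:S\to\mathbb R$ and $X\subseteq S$ put $p(X)=\sum_{s\in X}p(s)$. $M$ is strongly base orderable if for any $B,B'\in\mathcal B$ there is a bijection $f:B\to B'$ (an exchange bijection) such that $(B\setminus X)\cup f(X)\in\mathcal B$ for every $X\subseteq B$. Theorem. Let $M_1=(S,\mathcal B_1)$ and $M_2=(S,\mathcal B_2)$ be strongly base orderable matroids on a common finite ground set, with rank functions $r_1,r_2$. (A) If there are disjoint bases $B_1\in\mathcal B_1$, $B_2\in\mathcal B_2$ with $B_1\cup B_2=S$, then there is a price vector $p:S\to\mathbb R$ such that 1. for every $B_1\in\arg\min_{X\in\mathcal B_1}p(X)$ we have $S\setminus B_1\in\mathcal B_2$; 2. for every $B_2\in\arg\min_{X\in\mathcal B_2}p(X)$ we have $S\setminus B_2\in\mathcal B_1$. (B) There is (without the assumption on disjoint bases) a price vector $p:S\to\mathbb R$ such that 1. for every $B_1\in\arg\max_{X\subseteq S}(r_1(X)-p(X))$ and every $B_2\in\arg\max_{Y\subseteq S\setminus B_1}(r_2(Y)-p(Y))$,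 $$r_1(B_1)+r_2(B_2)=\max\{r_1(X)+r_2(Y)\mid X,Y\subseteq S,\ X\cap Y=\emptyset\};$$ 2. for every $B_2\in\arg\max_{Y\subseteq S}(r_2(Y)-p(Y))$ and every $B_1\in\arg\max_{X\subseteq S\setminus B_2}(r_1(X)-p(X))$, the same equation holds. (C) If exchange bijections can be computed in polynomial time for any pair of bases of $M_1$ and for any pair of bases of $M_2$, then a (rational) price vector as in (A), for instances satisfying its assumption, and a (rational) price vector as in (B), for all instances, can be computed in polynomial time. Here $M_1$ and $M_2$ are accessed through independence oracles and through procedures computing the exchange bijections, and the running time is the number of elementary steps of a random access machine (with addition, subtraction, comparison and memory access) plus the number of independence oracle calls plus the running times of the calls of the exchange procedures. Precisely, for each of (A) and (B) there is one program such that for every polynomial $q$ there is a polynomial $r$ with the following property: on every instance with $|S|=n$ whose exchange procedures take time at most $q(n)$ on every pair of bases, the program halts within time $r(n)$ and outputs a price vector with the required properties. -/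

import Mathlib

namespace MatroidPricing

section Pricing

variable {α : Type*}

/-- A matroid is strongly base orderable if any two bases `B`, `B'` admit a bijection `f : B → B'`
such that `(B \ X) ∪ f(X)` is a base for every `X ⊆ B`. `IsExchangeBijection M B B' f` says that
`f` (only its values on `B` matter) is such a bijection. -/
def IsExchangeBijection (M : Matroid α) (B B' : Set α) (f : α → α) : Prop :=
  Set.BijOn f B B' ∧ ∀ X, X ⊆ B → M.IsBase ((B \ X) ∪ f '' X)

def StronglyBaseOrderable (M : Matroid α) : Prop :=
  ∀ B B' : Set α, M.IsBase B → M.IsBase B' → ∃ f : α → α, IsExchangeBijection M B B' f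

/-- The price `p(X)` of a bundle. -/
def price (p : α → ℝ) (X : Finset α) : ℝ := ∑ s ∈ X, p s

/-- The rank function of a matroid (used for finite matroids, where `eRk` is finite). -/
noncomputable def rank (M : Matroid α) (X : Finset α) : ℕ := (M.eRk (X : Set α)).toNat

/-- `B` is a base of `M` of minimum price. -/
def IsCheapestBase (M : Matroid α) (p : α → ℝ) (B : Finset α) : Prop :=
  M.IsBase (B : Set α) ∧ ∀ B' : Finset α, M.IsBase (B' : Set α) → price p B ≤ price p B'

/-- The ground set is the union of two disjoint sets, a base of `M₁` and a base of `M₂`. -/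
def ComplementaryBases (M₁ M₂ : Matroid α) : Prop :=
  ∃ B₁ B₂ : Set α, M₁.IsBase B₁ ∧ M₂.IsBase B₂ ∧ Disjoint B₁ B₂ ∧ B₁ ∪ B₂ = M₁.E

/-- Whichever buyer comes first and whichever cheapest base she takes, the remaining items form a
base for the other buyer. -/
def IsBasePricing (M₁ M₂ : Matroid α) (p : α → ℝ) : Prop :=
  (∀ B₁, IsCheapestBase M₁ p B₁ → M₂.IsBase (M₁.E \ (B₁ : Set α))) ∧
  (∀ B₂, IsCheapestBase M₂ p B₂ → M₁.IsBase (M₁.E \ (B₂ : Set α)))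

/-- `X` is a utility-maximizing bundle among those contained in `T`, for the valuation given by the
rank function of `M` and the prices `p`. -/
def IsBestBundle (M : Matroid α) (p : α → ℝ) (T : Set α) (X : Finset α) : Prop :=
  (X : Set α) ⊆ T ∧
  ∀ Y : Finset α, (Y : Set α) ⊆ T → (rank M Y : ℝ) - price p Y ≤ (rank M X : ℝ) - price p X

/-- Giving `X₁` to the first buyer and `X₂` to the second one attains the maximum of
`r₁(X) + r₂(Y)` over all disjoint subsets `X`, `Y` of the ground set. -/
def IsWelfareOptimal (M₁ M₂ : Matroid α) (X₁ X₂ : Finset α) : Prop :=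
  IsGreatest {w : ℕ | ∃ X Y : Finset α, (X : Set α) ⊆ M₁.E ∧ (Y : Set α) ⊆ M₁.E ∧
    Disjoint X Y ∧ w = rank M₁ X + rank M₂ Y} (rank M₁ X₁ + rank M₂ X₂)

/-- Whichever buyer comes first, if each buyer in turn takes an arbitrary utility-maximizing bundle
among the remaining items, then the social welfare is maximized. -/
def IsRankPricing (M₁ M₂ : Matroid α) (p : α → ℝ) : Prop :=
  (∀ B₁, IsBestBundle M₁ p M₁.E B₁ → ∀ B₂, IsBestBundle M₂ p (M₁.E \ (B₁ : Set α)) B₂ →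
    IsWelfareOptimal M₁ M₂ B₁ B₂) ∧
  (∀ B₂, IsBestBundle M₂ p M₁.E B₂ → ∀ B₁, IsBestBundle M₁ p (M₁.E \ (B₂ : Set α)) B₁ →
    IsWelfareOptimal M₁ M₂ B₁ B₂)

end Pricing

section Machine

/-! A random access machine, programmed by structured (`while`) programs. Its memory is a
two-dimensional array of natural numbers. The elementary operations are addition, truncated
subtraction, comparison and (indirect) memory access; every one of them takes one time unit. There
is no multiplication, so numbers written within `t` steps have `O(t)` bits. A set of items, a
subset of `Fin n`, is represented by a row of the memory: `s` belongs to it if the `s`-th entry of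
the row is nonzero. -/

abbrev Store : Type := ℕ → ℕ → ℕ

/-- Overwrite the memory cell `(i, j)` by `v`. -/
def Store.set (σ : Store) (i j v : ℕ) : Store :=
  fun a b => if a = i ∧ b = j then v else σ a b

/-- The subset of `Fin n` represented by row `i`. -/
def Store.rowSet (σ : Store) (n i : ℕ) : Finset (Fin n) :=
  Finset.univ.filter fun s => σ i (s : ℕ) ≠ 0

/-- Overwrite the first `n` entries of row `i` by the table of `f`. -/
def Store.setRow (σ : Store) {n : ℕ} (i : ℕ) (f : Fin n → Fin n) : Store :=
  fun a b => if h : b < n then (if a = i then (f ⟨b, h⟩ : ℕ) else σ a b) else σ a b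

inductive Expr : Type
  | const (k : ℕ)
  | get (i j : Expr)
  | add (a b : Expr)
  | sub (a b : Expr)
  | lt (a b : Expr)
  | eq (a b : Expr)

def Expr.eval (σ : Store) : Expr → ℕ
  | .const k => k
  | .get i j => σ (i.eval σ) (j.eval σ)
  | .add a b => a.eval σ + b.eval σ
  | .sub a b => a.eval σ - b.eval σ
  | .lt a b => if a.eval σ < b.eval σ then 1 else 0
  | .eq a b => if a.eval σ = b.eval σ then 1 else 0

/-- The number of elementary operations needed to evaluate an expression. -/
def Expr.cost : Expr → ℕ
  | .const _ => 1
  | .get i j => i.cost + j.cost + 1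
  | .add a b => a.cost + b.cost + 1
  | .sub a b => a.cost + b.cost + 1
  | .lt a b => a.cost + b.cost + 1
  | .eq a b => a.cost + b.cost + 1

/-- Programs. `indep m r i j` asks whether the set in row `r` is independent in the matroid number
`m` and stores the answer (`1` or `0`) in cell `(i, j)`; `exch m r r' o` calls the procedure that
computes exchange bijections of the matroid number `m` on the sets in the rows `r` and `r'`, and
stores the table of the resulting function in row `o`. -/
inductive Prog : Type
  | skip
  | assign (i j e : Expr)
  | seq (c d : Prog)
  | ite (e : Expr) (c d : Prog)
  | while (e : Expr) (c : Prog)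
  | indep (m : Fin 2) (r i j : Expr)
  | exch (m : Fin 2) (r r' o : Expr)

/-- A procedure returning a map for every pair of sets of items, with its running time on each
pair. -/
structure ExchangeProcedure (n : ℕ) where
  map : Finset (Fin n) → Finset (Fin n) → Fin n → Fin n
  time : Finset (Fin n) → Finset (Fin n) → ℕ

/-- The procedure computes, within `T` time units, an exchange bijection of `M` for any pair of
bases. Nothing is required when it is called on sets that are not bases. -/
def ExchangeProcedure.ComputesWithin {n : ℕ} (F : ExchangeProcedure n) (M : Matroid (Fin n))
    (T : ℕ) : Prop :=
  ∀ B B' : Finset (Fin n), M.IsBase (B : Set (Fin n)) → M.IsBase (B' : Set (Fin n)) →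
    IsExchangeBijection M (B : Set (Fin n)) (B' : Set (Fin n)) (F.map B B') ∧ F.time B B' ≤ T

open Classical in
/-- `Exec M F c σ t σ'`: started in memory `σ`, the program `c` halts after `t` time units in
memory `σ'`. Oracle calls to the independence oracles of `M 0`, `M 1` take one time unit, calls of
the procedures `F 0`, `F 1` are charged with their running times. -/
inductive Exec {n : ℕ} (M : Fin 2 → Matroid (Fin n)) (F : Fin 2 → ExchangeProcedure n) :
    Prog → Store → ℕ → Store → Prop
  | skip (σ : Store) : Exec M F .skip σ 1 σ
  | assign (i j e : Expr) (σ : Store) :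
      Exec M F (.assign i j e) σ (i.cost + j.cost + e.cost + 1)
        (σ.set (i.eval σ) (j.eval σ) (e.eval σ))
  | seq {c d : Prog} {σ σ' σ'' : Store} {t t' : ℕ} :
      Exec M F c σ t σ' → Exec M F d σ' t' σ'' → Exec M F (.seq c d) σ (t + t') σ''
  | ite_true {e : Expr} {c d : Prog} {σ σ' : Store} {t : ℕ} :
      e.eval σ ≠ 0 → Exec M F c σ t σ' → Exec M F (.ite e c d) σ (e.cost + 1 + t) σ'
  | ite_false {e : Expr} {c d : Prog} {σ σ' : Store} {t : ℕ} :
      e.eval σ = 0 → Exec M F d σ t σ' → Exec M F (.ite e c d) σ (e.cost + 1 + t) σ'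
  | while_false {e : Expr} {c : Prog} {σ : Store} :
      e.eval σ = 0 → Exec M F (.while e c) σ (e.cost + 1) σ
  | while_true {e : Expr} {c : Prog} {σ σ' σ'' : Store} {t t' : ℕ} :
      e.eval σ ≠ 0 → Exec M F c σ t σ' → Exec M F (.while e c) σ' t' σ'' →
      Exec M F (.while e c) σ (e.cost + 1 + t + t') σ''
  | indep (m : Fin 2) (r i j : Expr) (σ : Store) :
      Exec M F (.indep m r i j) σ (r.cost + i.cost + j.cost + 1)
        (σ.set (i.eval σ) (j.eval σ)
          (if (M m).Indep (σ.rowSet n (r.eval σ) : Set (Fin n)) then 1 else 0))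
  | exch (m : Fin 2) (r r' o : Expr) (σ : Store) :
      Exec M F (.exch m r r' o) σ
        (r.cost + r'.cost + o.cost + 1 +
          (F m).time (σ.rowSet n (r.eval σ)) (σ.rowSet n (r'.eval σ)))
        (σ.setRow (o.eval σ)
          ((F m).map (σ.rowSet n (r.eval σ)) (σ.rowSet n (r'.eval σ))))

/-- The initial memory holds the number `n` of items in cell `(0, 0)` and is zero elsewhere. -/
def Store.init (n : ℕ) : Store := fun a b => if a = 0 ∧ b = 0 then n else 0

/-- The rational price vector read off from the memory: row `1` holds the numerators, row `2` the
denominators. -/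
noncomputable def Store.outputPrice (σ : Store) (n : ℕ) : Fin n → ℝ :=
  fun s => (σ 1 (s : ℕ) : ℝ) / (σ 2 (s : ℕ) : ℝ)

/-- Price vectors satisfying `Good` can be computed in polynomial time for all pairs of strongly
base orderable matroids on `n` items (labelled by `Fin n`) satisfying `Pre`, provided that exchange
bijections can be computed in polynomial time: one program works for all instances, and if
every exchange bijection takes time at most `q(n)`, for a polynomial `q`, then the total running
time is at most `r(n)`, for a polynomial `r` depending only on `q`. -/
def PolyTimePricing (Pre : ∀ n : ℕ, Matroid (Fin n) → Matroid (Fin n) → Prop)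
    (Good : ∀ n : ℕ, Matroid (Fin n) → Matroid (Fin n) → (Fin n → ℝ) → Prop) : Prop :=
  ∃ c : Prog, ∀ q : Polynomial ℕ, ∃ r : Polynomial ℕ,
    ∀ (n : ℕ) (M : Fin 2 → Matroid (Fin n)) (F : Fin 2 → ExchangeProcedure n),
      (∀ m, (M m).E = Set.univ) →
      (∀ m, StronglyBaseOrderable (M m)) →
      (∀ m, (F m).ComputesWithin (M m) (q.eval n)) →
      Pre n (M 0) (M 1) →
      ∃ (t : ℕ) (σ : Store), Exec M F c (Store.init n) t σ ∧ t ≤ r.eval n ∧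
        (∀ s : Fin n, σ 2 (s : ℕ) ≠ 0) ∧ Good n (M 0) (M 1) (σ.outputPrice n)

end Machine

end MatroidPricing

/-! Call an item covered if it lies in one of two chosen bases, one of each matroid. A largest
covered set U has as many items as the maximum welfare. Items outside U get a price above 1 and
items of U prices between 0 and 1, so nobody wants anything outside U. It remains to price U so that
the buyer m who comes first has only one best choice, a base B m, and so that U \ B m is independent
for the other buyer. For the latter, keep four bases in two pairs (B 0, C 1) and (C 0, B 1), each
pair covering every item equally often (`PairState`); then U \ B 0 lies in C 1, and U \ B 1 lies in
C 0.

For uniqueness, consider the digraph with an arc from u to w whenever u can replace w in B 0 or in B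
1. An exchange bijection from B m to another base sends every element it moves to one that can
replace it. So if prices strictly decrease along arcs, B m is the only cheapest base
(`price_lt_of_arc`). An acyclic digraph has such prices: the number of vertices reachable from an
item, divided by n + 1 (`card_reachable_lt`).

If there is a closed walk, the exchanges along a shortest one through some vertex turn B into bases
B' with the same multiplicities (`WalkInv.step`). By parity, B' 0 and C 0 differ in the same set V
as B' 1 and C 1 (`PairState.mem_iff`). The exchange bijections from B' m to C m give two perfect
matchings of V. Their union consists of even cycles, so V has a 2-colouring in which both matchings
join different colours, and strong base orderability makes each colour class, together with the
common elements, a base (`IsExchangeBijection.isBase_colour`). The colours define the new B and C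
(`PairState.recolour`). The set in which they differ has grown (`PairState.card_symmDiff_lt`), so
this happens at most n times, starting from C = B.

The same digraph yields U: a shortest walk from an uncovered item to one covered twice enlarges the
union (`WalkInv.card_union`), and if there is none, the set of items reachable from uncovered ones
bounds the welfare (`rank_add_rank_le_of_closed`).

The procedure is written in a small language of `for` loops of length n, whose effect and running
time are given by structural recursion (`Cmd.den`, `Cmd.exec_compile`). Parts (A) and (B) follow
from its correctness after labelling the ground set by `Fin n`. -/

namespace MatroidPricing

/-! ### A language of bounded loops, its semantics and its running time -/

section Commands

/-- Programs whose only loops are `for` loops of length `n`. `set r j e` writes into the fixed row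
`r`, `mset i j e` into row `100 + i`, and `loop x c` runs `c` with the counter in the memory cell
`(0, x)` taking the values `0, …, n - 1`. -/
inductive Cmd : Type
  | skip
  | set (r : ℕ) (j e : Expr)
  | mset (i j e : Expr)
  | seq (c d : Cmd)
  | ite (e : Expr) (c d : Cmd)
  | loop (x : ℕ) (c : Cmd)
  | indep (m : Fin 2) (r o : ℕ)
  | exch (m : Fin 2) (r r' o : ℕ)

infixr:60 ";;" => Cmd.seq

/-- The counter stored in cell `(0, x)`. -/
def Expr.ctr (x : ℕ) : Expr := .get (.const 0) (.const x)

/-- The entry `j` of the fixed row `r`. -/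
def Expr.cell (r : ℕ) (j : Expr) : Expr := .get (.const r) j

/-- The scalar stored at the beginning of row `r`. -/
def Expr.var (r : ℕ) : Expr := .get (.const r) (.const 0)

/-- The matrix entry `(i, j)`. -/
def Expr.mat (i j : Expr) : Expr := .get (.add (.const 100) i) j

def Expr.not (a : Expr) : Expr := .eq a (.const 0)

def Expr.and (a b : Expr) : Expr := .lt (.const 1) (.add (.lt (.const 0) a) (.lt (.const 0) b))

/-- An expression, regarded as a condition, holds if its value is nonzero. -/
def Expr.Holds (σ : Store) (e : Expr) : Prop := e.eval σ ≠ 0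

section Eval

variable (σ : Store) (a b : Expr)

@[simp] theorem Expr.eval_const (k : ℕ) : (Expr.const k).eval σ = k := rfl
@[simp] theorem Expr.eval_add : (Expr.add a b).eval σ = a.eval σ + b.eval σ := rfl
@[simp] theorem Expr.eval_sub : (Expr.sub a b).eval σ = a.eval σ - b.eval σ := rfl
@[simp] theorem Expr.eval_ctr (x : ℕ) : (Expr.ctr x).eval σ = σ 0 x := rfl
@[simp] theorem Expr.eval_cell (r : ℕ) : (Expr.cell r a).eval σ = σ r (a.eval σ) := rfl
@[simp] theorem Expr.eval_var (r : ℕ) : (Expr.var r).eval σ = σ r 0 := rfl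
@[simp] theorem Expr.eval_mat :
    (Expr.mat a b).eval σ = σ (100 + a.eval σ) (b.eval σ) := rfl

@[simp] theorem Expr.holds_lt : (Expr.lt a b).Holds σ ↔ a.eval σ < b.eval σ := by
  simp [Expr.Holds, Expr.eval]

@[simp] theorem Expr.holds_eq : (Expr.eq a b).Holds σ ↔ a.eval σ = b.eval σ := by
  simp [Expr.Holds, Expr.eval]

@[simp] theorem Expr.holds_not : a.not.Holds σ ↔ ¬ a.Holds σ := by
  by_cases h : a.eval σ = 0 <;> simp [Expr.Holds, Expr.eval, Expr.not, h]

@[simp] theorem Expr.holds_and : (a.and b).Holds σ ↔ a.Holds σ ∧ b.Holds σ := by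
  simp only [Expr.Holds, Expr.eval, Expr.and]
  by_cases ha : a.eval σ = 0 <;> by_cases hb : b.eval σ = 0 <;>
    simp [ha, hb, Nat.pos_iff_ne_zero]

@[simp] theorem Expr.holds_cell (r : ℕ) : (Expr.cell r a).Holds σ ↔ σ r (a.eval σ) ≠ 0 := Iff.rfl
@[simp] theorem Expr.holds_var (r : ℕ) : (Expr.var r).Holds σ ↔ σ r 0 ≠ 0 := Iff.rfl
@[simp] theorem Expr.holds_mat :
    (Expr.mat a b).Holds σ ↔ σ (100 + a.eval σ) (b.eval σ) ≠ 0 := Iff.rfl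

end Eval

theorem Store.set_apply (σ : Store) (i j v a b : ℕ) :
    σ.set i j v a b = if a = i ∧ b = j then v else σ a b := rfl

@[simp] theorem Store.set_row_of_ne (σ : Store) (i j v : ℕ) {a : ℕ} (h : a ≠ i) :
    σ.set i j v a = σ a := by
  funext b; simp [Store.set_apply, h]

theorem Store.set_row (σ : Store) (i j v : ℕ) :
    σ.set i j v i = Function.update (σ i) j v := by
  funext b; simp [Store.set_apply, Function.update_apply]

@[simp] theorem Store.set_zero_succ (σ : Store) (j v a : ℕ) : σ.set 0 j v (a + 1) = σ (a + 1) :=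
  σ.set_row_of_ne _ _ _ (by simp)

namespace Cmd

/-- Rows other than row `0` that the command may change. -/
def writes : Cmd → ℕ → Bool
  | skip, _ => false
  | set r _ _, a => a == r
  | mset _ _ _, a => decide (100 ≤ a)
  | seq c d, a => c.writes a || d.writes a
  | ite _ c d, a => c.writes a || d.writes a
  | loop _ c, a => c.writes a
  | indep _ _ o, a => a == o
  | exch _ _ _ o, a => a == o

/-- Counters that the command may change. -/
def uses : Cmd → ℕ → Bool
  | seq c d, a => c.uses a || d.uses a
  | ite _ c d, a => c.uses a || d.uses a
  | loop x c, a => a == x || c.uses a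
  | _, _ => false

/-- Nested loops have different counters, and the cell containing `n` is no counter. -/
def nested : Cmd → Bool
  | seq c d => c.nested && d.nested
  | ite _ c d => c.nested && d.nested
  | loop x c => x != 0 && !c.uses x && c.nested
  | _ => true

/-- Counters are changed by the loops only. -/
def WellFormed (c : Cmd) : Prop := c.writes 0 = false ∧ c.nested = true

instance (c : Cmd) : Decidable c.WellFormed := inferInstanceAs (Decidable (_ ∧ _))

def compile : Cmd → Prog
  | skip => .skip
  | set r j e => .assign (.const r) j e
  | mset i j e => .assign (.add (.const 100) i) j e
  | seq c d => .seq c.compile d.compile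
  | ite e c d => .ite e c.compile d.compile
  | loop x c => .seq (.assign (.const 0) (.const x) (.const 0))
      (.while (.lt (.ctr x) (.ctr 0))
        (.seq c.compile (.assign (.const 0) (.const x) (.add (.ctr x) (.const 1)))))
  | indep m r o => .indep m (.const r) (.const o) (.const 0)
  | exch m r r' o => .exch m (.const r) (.const r') (.const o)

/-- The memory at the beginning of round `i` of a loop with counter `x` and body `f`. -/
def iter (f : Store → Store) (x : ℕ) (σ : Store) : ℕ → Store
  | 0 => σ.set 0 x 0
  | i + 1 => (f (iter f x σ i)).set 0 x (i + 1)

variable {n : ℕ} (M : Fin 2 → Matroid (Fin n)) (F : Fin 2 → ExchangeProcedure n)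

open Classical in
/-- The memory after running a command. -/
noncomputable def den : Cmd → Store → Store
  | skip, σ => σ
  | set r j e, σ => σ.set r (j.eval σ) (e.eval σ)
  | mset i j e, σ => σ.set (100 + i.eval σ) (j.eval σ) (e.eval σ)
  | seq c d, σ => d.den (c.den σ)
  | ite e c d, σ => if e.Holds σ then c.den σ else d.den σ
  | loop x c, σ => iter c.den x σ (σ 0 0)
  | indep m r o, σ =>
      σ.set o 0 (if (M m).Indep (σ.rowSet n r : Set (Fin n)) then 1 else 0)
  | exch m r r' o, σ => σ.setRow o ((F m).map (σ.rowSet n r) (σ.rowSet n r'))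

/-- The exchange procedures are called on bases only. -/
def Safe : Cmd → Store → Prop
  | seq c d, σ => c.Safe σ ∧ d.Safe (c.den M F σ)
  | ite e c d, σ => (e.Holds σ → c.Safe σ) ∧ (¬ e.Holds σ → d.Safe σ)
  | loop x c, σ => ∀ i < σ 0 0, c.Safe (iter (c.den M F) x σ i)
  | exch m r r' _, σ => (M m).IsBase (σ.rowSet n r : Set (Fin n)) ∧
      (M m).IsBase (σ.rowSet n r' : Set (Fin n))
  | _, _ => True

def noExch : Cmd → Bool
  | seq c d => c.noExch && d.noExch
  | ite _ c d => c.noExch && d.noExch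
  | loop _ c => c.noExch
  | exch _ _ _ _ => false
  | _ => true

theorem safe_of_noExch (c : Cmd) (h : c.noExch = true) (σ : Store) : c.Safe M F σ := by
  induction c generalizing σ with
  | seq c d hc hd =>
    simp only [noExch, Bool.and_eq_true] at h
    exact ⟨hc h.1 _, hd h.2 _⟩
  | ite e c d hc hd =>
    simp only [noExch, Bool.and_eq_true] at h
    exact ⟨fun _ => hc h.1 _, fun _ => hd h.2 _⟩
  | loop x c hc => exact fun i _ => hc h _
  | exch => simp [noExch] at h
  | _ => trivial

variable {M F}

theorem den_row {c : Cmd} {r : ℕ} (hr : r ≠ 0) (h : c.writes r = false) (σ : Store) :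
    c.den M F σ r = σ r := by
  induction c generalizing σ with
  | skip => rfl
  | set r' j e => exact σ.set_row_of_ne _ _ _ (by simpa [writes] using h)
  | mset i j e =>
    refine σ.set_row_of_ne _ _ _ ?_
    have : ¬ 100 ≤ r := by simpa [writes] using h
    omega
  | seq c d hc hd =>
    simp only [writes, Bool.or_eq_false_iff] at h
    simp only [den]
    rw [hd h.2, hc h.1]
  | ite e c d hc hd =>
    simp only [writes, Bool.or_eq_false_iff] at h
    simp only [den]
    split_ifs
    · exact hc h.1 _
    · exact hd h.2 _
  | loop x c hc =>
    simp only [den]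
    generalize σ 0 0 = k
    induction k with
    | zero => exact σ.set_row_of_ne _ _ _ hr
    | succ k ih => rw [iter, Store.set_row_of_ne _ _ _ _ hr, hc h, ih]
  | indep m r' o => exact σ.set_row_of_ne _ _ _ (by simpa [writes] using h)
  | exch m r' r'' o =>
    have : r ≠ o := by simpa [writes] using h
    funext b
    simp [den, Store.setRow, this]

theorem den_counter {c : Cmd} {x : ℕ} (hw : c.writes 0 = false) (h : c.uses x = false)
    (σ : Store) : c.den M F σ 0 x = σ 0 x := by
  induction c generalizing σ with
  | skip => rfl
  | set r' j e =>
    simp only [den]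
    rw [σ.set_row_of_ne _ _ _ (by simpa [writes] using hw)]
  | mset i j e =>
    simp only [den]
    rw [σ.set_row_of_ne _ _ _ (by omega)]
  | seq c d hc hd =>
    simp only [writes, uses, Bool.or_eq_false_iff] at h hw
    simp only [den]
    rw [hd hw.2 h.2, hc hw.1 h.1]
  | ite e c d hc hd =>
    simp only [writes, uses, Bool.or_eq_false_iff] at h hw
    simp only [den]
    split_ifs
    · exact hc hw.1 h.1 _
    · exact hd hw.2 h.2 _
  | loop y c hc =>
    simp only [uses, Bool.or_eq_false_iff, beq_eq_false_iff_ne] at h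
    simp only [den]
    generalize σ 0 0 = k
    induction k with
    | zero => simp [iter, Store.set_apply, h.1]
    | succ k ih => simp [iter, Store.set_apply, h.1, hc hw h.2, ih]
  | indep m r' o =>
    simp only [den]
    rw [σ.set_row_of_ne _ _ _ (by simpa [writes] using hw)]
  | exch m r' r'' o =>
    have : (0 : ℕ) ≠ o := by simpa [writes] using hw
    simp [den, Store.setRow, this]

/-- Cell (0, 0) holds n, the length of every loop, so it has to survive every command. -/
theorem nested_not_uses_zero {c : Cmd} (h : c.nested = true) : c.uses 0 = false := by
  induction c with
  | seq c d hc hd => simp_all [nested, uses]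
  | ite e c d hc hd => simp_all [nested, uses]
  | loop x c hc =>
    simp only [nested, Bool.and_eq_true, bne_iff_ne, ne_eq] at h
    simp only [uses, Bool.or_eq_false_iff, beq_eq_false_iff_ne]
    exact ⟨fun h' => h.1.1 h'.symm, hc h.2⟩
  | _ => rfl

/-- `τ` differs from `σ` only in places where `c` may write. -/
structure Frame (c : Cmd) (σ τ : Store) : Prop where
  row : ∀ r, c.writes (r + 1) = false → τ (r + 1) = σ (r + 1)
  ctr : ∀ x, c.uses x = false → τ 0 x = σ 0 x

/-- The field `row` has the shift `r + 1` built in, so that `rfl` suffices for rows given as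
numerals. The present form serves rows known only through inequalities, such as the matrix rows `100
+ a`. -/
theorem Frame.row_of_ne {c : Cmd} {σ τ : Store} (h : Frame c σ τ) {r : ℕ} (hr : r ≠ 0)
    (hw : c.writes r = false) : τ r = σ r := by
  obtain ⟨r, rfl⟩ := Nat.exists_eq_succ_of_ne_zero hr
  exact h.row r hw

theorem WellFormed.frame {c : Cmd} (h : c.WellFormed) (σ : Store) : Frame c σ (c.den M F σ) :=
  ⟨fun _ hr => den_row (by simp) hr σ, fun _ hx => den_counter h.1 hx σ⟩

theorem WellFormed.of_loop {c : Cmd} {x : ℕ} (h : (loop x c).WellFormed) : c.WellFormed := by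
  obtain ⟨h₁, h₂⟩ := h
  simp only [nested, Bool.and_eq_true] at h₂
  exact ⟨h₁, h₂.2⟩

theorem WellFormed.seq_left {c d : Cmd} (h : (c.seq d).WellFormed) : c.WellFormed := by
  simpa [WellFormed, writes, nested] using
    And.intro (Bool.or_eq_false_iff.1 h.1).1 (Bool.and_eq_true_iff.1 h.2).1

theorem WellFormed.seq_right {c d : Cmd} (h : (c.seq d).WellFormed) : d.WellFormed := by
  simpa [WellFormed, writes, nested] using
    And.intro (Bool.or_eq_false_iff.1 h.1).2 (Bool.and_eq_true_iff.1 h.2).2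

theorem frame_iter {c : Cmd} {x : ℕ} (h : (loop x c).WellFormed) (σ : Store) (i : ℕ) :
    Frame (loop x c) σ (iter (c.den M F) x σ i) ∧ iter (c.den M F) x σ i 0 x = i := by
  have hc := h.of_loop
  induction i with
  | zero =>
    refine ⟨⟨fun r _ => by simp [iter], fun y hy => ?_⟩, by simp [iter, Store.set_apply]⟩
    simp only [uses, Bool.or_eq_false_iff, beq_eq_false_iff_ne] at hy
    simp [iter, Store.set_apply, hy.1]
  | succ i ih =>
    refine ⟨⟨fun r hr => ?_, fun y hy => ?_⟩, by simp [iter, Store.set_apply]⟩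
    · rw [iter, Store.set_zero_succ, hc.frame _ |>.row r hr, ih.1.row r hr]
    · have hy' := hy
      simp only [uses, Bool.or_eq_false_iff, beq_eq_false_iff_ne] at hy'
      rw [iter, Store.set_apply, if_neg (by simp [hy'.1]), hc.frame _ |>.ctr y hy'.2,
        ih.1.ctr y hy]

/-- Induction along the rounds of a loop. -/
theorem loop_induction {c : Cmd} {x : ℕ} (h : (loop x c).WellFormed) {σ : Store}
    (P : ℕ → Store → Prop) (zero : P 0 (σ.set 0 x 0))
    (succ : ∀ i < σ 0 0, ∀ τ, Frame (loop x c) σ τ → τ 0 x = i → P i τ →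
      P (i + 1) ((c.den M F τ).set 0 x (i + 1))) :
    P (σ 0 0) ((loop x c).den M F σ) := by
  suffices H : ∀ i ≤ σ 0 0, P i (iter (c.den M F) x σ i) from H _ le_rfl
  intro i hi
  induction i with
  | zero => exact zero
  | succ i ih =>
    obtain ⟨h₁, h₂⟩ := frame_iter (M := M) (F := F) h σ i
    exact succ i (by omega) _ h₁ h₂ (ih (by omega))

/-- Induction along the rounds of a loop, showing at the same time that the loop is safe. -/
theorem loop_induction_safe {c : Cmd} {x : ℕ} (h : (loop x c).WellFormed) {σ : Store}
    (P : ℕ → Store → Prop) (zero : P 0 (σ.set 0 x 0))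
    (succ : ∀ i < σ 0 0, ∀ τ, Frame (loop x c) σ τ → τ 0 x = i → P i τ →
      c.Safe M F τ ∧ P (i + 1) ((c.den M F τ).set 0 x (i + 1))) :
    (loop x c).Safe M F σ ∧ P (σ 0 0) ((loop x c).den M F σ) := by
  have H : ∀ i ≤ σ 0 0, P i (iter (c.den M F) x σ i) := by
    intro i hi
    induction i with
    | zero => exact zero
    | succ i ih =>
      obtain ⟨h₁, h₂⟩ := frame_iter (M := M) (F := F) h σ i
      exact (succ i (by omega) _ h₁ h₂ (ih (by omega))).2
  refine ⟨fun i hi => ?_, H _ le_rfl⟩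
  obtain ⟨h₁, h₂⟩ := frame_iter (M := M) (F := F) h σ i
  exact (succ i hi _ h₁ h₂ (H i hi.le)).1

open Polynomial in
/-- A bound for the running time, if the exchange procedures take time at most `q`. -/
noncomputable def timeBound (q : ℕ[X]) : Cmd → ℕ[X]
  | skip => 1
  | set _ j e => C (j.cost + e.cost + 2)
  | mset i j e => C (i.cost + j.cost + e.cost + 3)
  | seq c d => c.timeBound q + d.timeBound q
  | ite e c d => C (e.cost + 1) + c.timeBound q + d.timeBound q
  | loop _ c => C 12 + X * (c.timeBound q + C 16)
  | indep _ _ _ => C 4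
  | exch _ _ _ _ => C 4 + q

/-- The semantics `den` fixes the number of rounds when a loop is entered, whereas the compiled
`while` reads the counter and n again before each round. The two agree because the body of a
well-formed loop changes neither. -/
theorem exec_compile {c : Cmd} (hc : c.WellFormed) {q : Polynomial ℕ}
    (hF : ∀ m, (F m).ComputesWithin (M m) (q.eval n)) {σ : Store} (hn : σ 0 0 = n)
    (hs : c.Safe M F σ) :
    ∃ t, Exec M F c.compile σ t (c.den M F σ) ∧ t ≤ (c.timeBound q).eval n := by
  induction c generalizing σ with
  | skip => exact ⟨1, .skip σ, by simp [timeBound]⟩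
  | set r j e => exact ⟨_, .assign _ _ _ σ, by simp [timeBound, Expr.cost]; omega⟩
  | mset i j e => exact ⟨_, .assign _ _ _ σ, by simp [timeBound, Expr.cost]; omega⟩
  | seq c d ihc ihd =>
    obtain ⟨t, h, ht⟩ := ihc hc.seq_left hn hs.1
    obtain ⟨t', h', ht'⟩ := ihd hc.seq_right
      (((hc.seq_left.frame σ).ctr 0 (nested_not_uses_zero hc.seq_left.2)).trans hn) hs.2
    exact ⟨t + t', .seq h h', by simp only [timeBound, Polynomial.eval_add]; omega⟩
  | ite e c d ihc ihd =>
    have hc' : c.WellFormed := WellFormed.seq_left (d := d) hc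
    have hd' : d.WellFormed := WellFormed.seq_right (c := c) hc
    by_cases he : e.Holds σ
    · obtain ⟨t, h, ht⟩ := ihc hc' hn (hs.1 he)
      refine ⟨e.cost + 1 + t, ?_, ?_⟩
      · simp only [den, if_pos he]
        exact .ite_true he h
      · simp only [timeBound, Polynomial.eval_add, Polynomial.eval_C]; omega
    · obtain ⟨t, h, ht⟩ := ihd hd' hn (hs.2 he)
      refine ⟨e.cost + 1 + t, ?_, ?_⟩
      · simp only [den, if_neg he]
        exact .ite_false (not_not.1 he) h
      · simp only [timeBound, Polynomial.eval_add, Polynomial.eval_C]; omega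
  | loop x c ih =>
    have hc' := hc.of_loop
    have hx : c.uses x = false := by
      have := hc.2
      simp only [nested, Bool.and_eq_true, Bool.not_eq_true'] at this
      exact this.1.2
    have hu0 := nested_not_uses_zero hc.2
    set T := (c.timeBound q).eval n with hT
    -- Induction on the number k of rounds still to come. The final failing test costs 8; each round
    -- adds 8 for its test and 8 for increasing the counter. Initialising the counter costs 4,
    -- whence the constants 12 and 16 in `timeBound`.
    have key : ∀ k ≤ n, ∃ t, Exec M F
        (.while (.lt (.ctr x) (.ctr 0))
          (.seq c.compile (.assign (.const 0) (.const x) (.add (.ctr x) (.const 1)))))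
        (iter (c.den M F) x σ (n - k)) t (iter (c.den M F) x σ n) ∧ t ≤ k * (T + 16) + 8 := by
      intro k hk
      induction k with
      | zero =>
        obtain ⟨h₁, h₂⟩ := frame_iter (M := M) (F := F) hc σ n
        refine ⟨_, .while_false ?_, by simp [Expr.cost, Expr.ctr]⟩
        simp [Expr.eval, Expr.ctr, h₂, h₁.ctr 0 hu0, hn]
      | succ k ihk =>
        obtain ⟨t', h', ht'⟩ := ihk (by omega)
        obtain ⟨h₁, h₂⟩ := frame_iter (M := M) (F := F) hc σ (n - (k + 1))
        have h0 : iter (c.den M F) x σ (n - (k + 1)) 0 0 = n := (h₁.ctr 0 hu0).trans hn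
        obtain ⟨t, h, ht⟩ := ih hc' h0 (hs _ (by omega))
        have h'' := Exec.assign (M := M) (F := F) (.const 0) (.const x) (.add (.ctr x) (.const 1))
          (c.den M F (iter (c.den M F) x σ (n - (k + 1))))
        have hset : (c.den M F (iter (c.den M F) x σ (n - (k + 1)))).set 0 x
            ((c.den M F (iter (c.den M F) x σ (n - (k + 1)))) 0 x + 1)
            = iter (c.den M F) x σ (n - k) := by
          rw [den_counter hc'.1 hx, h₂, show n - k = n - (k + 1) + 1 by omega, iter]
        simp only [Expr.eval_const, Expr.eval_add, Expr.eval_ctr] at h''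
        rw [hset] at h''
        refine ⟨_, .while_true ?_ (.seq h h'') h', ?_⟩
        · have : n - (k + 1) < n := by omega
          simp [Expr.eval, Expr.ctr, h₂, h0, this]
        · simp only [Expr.cost, Expr.ctr]
          have : (k + 1) * (T + 16) = k * (T + 16) + (T + 16) := by ring
          omega
    obtain ⟨t, h, ht⟩ := key n le_rfl
    have hden : (loop x c).den M F σ = iter (c.den M F) x σ n := by simp only [den, hn]
    rw [Nat.sub_self] at h
    rw [hden]
    refine ⟨_, .seq (.assign _ _ _ _) h, ?_⟩
    simp only [timeBound, Polynomial.eval_add, Polynomial.eval_mul, Polynomial.eval_C,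
      Polynomial.eval_X, Expr.cost, ← hT]
    omega
  | indep m r o => exact ⟨_, .indep _ _ _ _ σ, by simp [timeBound, Expr.cost]⟩
  | exch m r r' o =>
    refine ⟨_, .exch _ _ _ _ σ, ?_⟩
    have := (hF m _ _ hs.1 hs.2).2
    simp only [timeBound, Expr.cost, Polynomial.eval_add, Polynomial.eval_C, Expr.eval_const]
    omega

end Cmd

end Commands

/-! ### Single exchanges and exchange bijections -/

section Exchange

variable {α : Type*}

/-- `u` can replace `w` in the base `B`. -/
def Arc (M : Matroid α) (B : Set α) (u w : α) : Prop :=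
  u ∉ B ∧ w ∈ B ∧ M.Indep (insert u B \ {w})

theorem Arc.isBase {M : Matroid α} {B : Set α} {u w : α} (h : Arc M B u w) (hB : M.IsBase B) :
    M.IsBase (insert u B \ {w}) :=
  hB.exchange_isBase_of_indep' h.2.1 h.1 h.2.2

/-- All exchanges of u are encoded in a single circuit, so they persist as long as that circuit
remains fundamental. -/
theorem arc_iff_mem_fundCircuit {M : Matroid α} (hE : M.E = Set.univ) {B : Set α}
    (hB : M.IsBase B) {u w : α} (hu : u ∉ B) :
    Arc M B u w ↔ w ∈ B ∧ w ∈ M.fundCircuit u B := by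
  have hcl : u ∈ M.closure B := by rw [hB.closure_eq, hE]; trivial
  rw [hB.indep.mem_fundCircuit_iff hcl hu]
  simp [Arc, hu]

/-- Exchanging `x` for `y` does not change the exchanges of an element that cannot replace `x`. -/
theorem arc_exchange_iff {M : Matroid α} (hE : M.E = Set.univ) {B : Set α} (hB : M.IsBase B)
    {x y z w : α} (hyx : Arc M B y x) (hz : z ∉ B) (hzy : z ≠ y) (hzx : ¬ Arc M B z x) :
    Arc M (insert y B \ {x}) z w ↔ Arc M B z w := by
  have hB' := hyx.isBase hB
  have hz' : z ∉ insert y B \ {x} := by simp [hz, hzy]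
  have hCx : x ∉ M.fundCircuit z B := fun h =>
    hzx ((arc_iff_mem_fundCircuit hE hB hz).2 ⟨hyx.2.1, h⟩)
  have hC : M.IsCircuit (M.fundCircuit z B) := hB.fundCircuit_isCircuit (by simp [hE]) hz
  have hsub := M.fundCircuit_subset_insert z B
  -- The fundamental circuit of z avoids x, so it is still contained in the new base plus z; being
  -- the only circuit there, it is the fundamental circuit with respect to the new base too.
  have hsub' : M.fundCircuit z B ⊆ insert z (insert y B \ {x}) := by
    intro s hs
    rcases hsub hs with rfl | h
    · exact Or.inl rfl
    · exact Or.inr ⟨Or.inr h, fun h' => hCx (h' ▸ hs)⟩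
  have heq := hC.eq_fundCircuit_of_subset hB'.indep hsub'
  rw [arc_iff_mem_fundCircuit hE hB' hz', arc_iff_mem_fundCircuit hE hB hz, ← heq]
  constructor
  · rintro ⟨h₁, h₂⟩
    refine ⟨?_, h₂⟩
    rcases hsub h₂ with rfl | h
    · exact absurd h₁ hz'
    · exact h
  · rintro ⟨h₁, h₂⟩
    exact ⟨⟨Or.inr h₁, fun h => hCx (h ▸ h₂)⟩, h₂⟩

section ExchangeBijection

variable {M : Matroid α} {B B' : Set α} {f : α → α}

/-- If some y other than s were mapped to s, exchanging y alone would delete y from B and insert an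
element already there, leaving a base properly contained in B. -/
theorem IsExchangeBijection.apply_eq_self (hf : IsExchangeBijection M B B' f) {s : α}
    (hs : s ∈ B) (hs' : s ∈ B') : f s = s := by
  obtain ⟨y, hy, rfl⟩ := hf.1.surjOn hs'
  by_cases hne : y = f y
  · rw [← hne, ← hne]
  have h₀ := hf.2 ∅ (by simp)
  have h₁ := hf.2 {y} (by simpa using hy)
  simp only [Set.sdiff_empty, Set.image_empty, Set.union_empty] at h₀
  have hsub : B \ {y} ∪ f '' {y} ⊆ B := by
    rintro z (hz | hz)
    · exact hz.1
    · simp only [Set.image_singleton, Set.mem_singleton_iff] at hz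
      exact hz ▸ hs
  have := h₁.eq_of_subset_isBase h₀ hsub
  rw [← this] at hy
  rcases hy with hy | hy
  · exact absurd rfl hy.2
  · simp only [Set.image_singleton, Set.mem_singleton_iff] at hy
    exact absurd hy hne

/-- An image in B would be a common element, hence fixed by f, against injectivity. -/
theorem IsExchangeBijection.apply_notMem (hf : IsExchangeBijection M B B' f) {s : α}
    (hs : s ∈ B) (hs' : s ∉ B') : f s ∉ B := by
  intro h
  have h' := hf.1.mapsTo hs
  have := hf.1.injOn h hs (hf.apply_eq_self h h')
  exact hs' (this ▸ h')

theorem IsExchangeBijection.arc (hf : IsExchangeBijection M B B' f) {s : α}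
    (hs : s ∈ B) (hs' : s ∉ B') : Arc M B (f s) s := by
  have h := hf.apply_notMem hs hs'
  refine ⟨h, hs, ?_⟩
  have := (hf.2 {s} (by simpa using hs)).indep
  refine this.subset ?_
  rintro z ⟨rfl | hz, hz'⟩
  · exact Or.inr ⟨s, rfl, rfl⟩
  · exact Or.inl ⟨hz, hz'⟩

/-- If an exchange bijection changes the colour of all elements it moves, then the elements of
one colour form a base together with the common elements. -/
theorem IsExchangeBijection.isBase_colour (hf : IsExchangeBijection M B B' f) {c : α → Prop}
    (hc : ∀ s ∈ B, s ∉ B' → (c (f s) ↔ ¬ c s)) :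
    M.IsBase {s | (s ∈ B ∧ s ∈ B') ∨ (¬ (s ∈ B ↔ s ∈ B') ∧ c s)} := by
  -- Exchange exactly the moved elements of the wrong colour: their images have the right one, and
  -- the images that are not taken have the wrong one.
  convert hf.2 {s | s ∈ B ∧ s ∉ B' ∧ ¬ c s} (fun s hs => hs.1) using 1
  ext s
  simp only [Set.mem_ofPred_eq, Set.mem_union, Set.mem_sdiff, Set.mem_image]
  constructor
  · rintro (⟨h, h'⟩ | ⟨h, h'⟩)
    · exact Or.inl ⟨h, by simp [h']⟩
    · by_cases hs : s ∈ B
      · exact Or.inl ⟨hs, by simp [h']⟩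
      · obtain ⟨y, hy, rfl⟩ := hf.1.surjOn (by tauto : s ∈ B')
        have hyB' : y ∉ B' := fun h'' => hs ((hf.apply_eq_self hy h'').symm ▸ hy)
        exact Or.inr ⟨y, ⟨hy, hyB', (hc y hy hyB').1 h'⟩, rfl⟩
  · rintro (⟨h, h'⟩ | ⟨y, ⟨hy, hy', hcy⟩, rfl⟩)
    · by_cases hs : s ∈ B'
      · exact Or.inl ⟨h, hs⟩
      · exact Or.inr ⟨by tauto, by tauto⟩
    · have h₁ := hf.apply_notMem hy hy'
      have h₂ := hf.1.mapsTo hy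
      exact Or.inr ⟨by tauto, (hc y hy hy').2 hcy⟩

end ExchangeBijection

end Exchange

/-! ### Rank bounds, best bundles and cheapest bases -/

section Pricing

variable {n : ℕ}

theorem coe_rank (M : Matroid (Fin n)) (X : Finset (Fin n)) :
    (rank M X : ℕ∞) = M.eRk (X : Set (Fin n)) := by
  refine ENat.natCast_toNat (ne_top_of_le_ne_top ?_ (M.eRk_le_encard _))
  simp [Set.encard_coe_eq_coe_finsetCard]

theorem rank_eq_card {M : Matroid (Fin n)} {X : Finset (Fin n)}
    (h : M.Indep (X : Set (Fin n))) : rank M X = X.card := by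
  rw [← Nat.cast_inj (R := ℕ∞), coe_rank, h.eRk_eq_encard, Set.encard_coe_eq_coe_finsetCard]

theorem rank_le_card (M : Matroid (Fin n)) (X : Finset (Fin n)) : rank M X ≤ X.card := by
  have := M.eRk_le_encard (X : Set (Fin n))
  rw [← coe_rank, Set.encard_coe_eq_coe_finsetCard] at this
  exact_mod_cast this

theorem rank_mono (M : Matroid (Fin n)) {X Y : Finset (Fin n)} (h : X ⊆ Y) :
    rank M X ≤ rank M Y := by
  have := M.eRk_mono (show (X : Set (Fin n)) ⊆ Y by exact_mod_cast h)
  rw [← coe_rank, ← coe_rank] at this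
  exact_mod_cast this

theorem rank_le_rank_inter_add (M : Matroid (Fin n)) (X Z : Finset (Fin n)) :
    rank M X ≤ rank M (X ∩ Z) + (X \ Z).card := by
  have := M.eRk_union_le_eRk_add_encard ((X ∩ Z : Finset (Fin n)) : Set (Fin n))
    ((X \ Z : Finset (Fin n)) : Set (Fin n))
  rw [← Finset.coe_union, show X ∩ Z ∪ X \ Z = X by ext; simp; tauto, ← coe_rank, ← coe_rank,
    Set.encard_coe_eq_coe_finsetCard] at this
  exact_mod_cast this

/-- Apart from z itself, the fundamental circuit of an element z of Z outside B consists of elements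
that z can replace. These lie in B ∩ Z, which therefore spans Z. -/
theorem rank_le_card_inter {M : Matroid (Fin n)} (hE : M.E = Set.univ) {B Z : Finset (Fin n)}
    (hB : M.IsBase (B : Set (Fin n))) (hZ : ∀ u w, Arc M B u w → u ∈ Z → w ∈ Z) :
    rank M Z ≤ (B ∩ Z).card := by
  have hsub : (Z : Set (Fin n)) ⊆ M.closure ((B ∩ Z : Finset (Fin n)) : Set (Fin n)) := by
    intro z hz
    by_cases hzB : z ∈ B
    · exact M.subset_closure _ (by simp [hE]) (by simpa using ⟨hzB, hz⟩)
    · have hzB' : z ∉ (B : Set (Fin n)) := by simpa using hzB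
      have hC : M.IsCircuit (M.fundCircuit z B) := hB.fundCircuit_isCircuit (by simp [hE]) hzB'
      refine M.closure_subset_closure ?_ (hC.mem_closure_sdiff_singleton_of_mem
        (M.mem_fundCircuit z B))
      rintro w ⟨hw, hwz⟩
      have hwB : w ∈ B := by
        rcases M.fundCircuit_subset_insert z B hw with h | h
        · exact absurd h hwz
        · exact h
      simpa using ⟨hwB, hZ z w ((arc_iff_mem_fundCircuit hE hB hzB').2 ⟨hwB, hw⟩) hz⟩
  have := (M.eRk_mono hsub).trans ((M.eRk_closure_eq _).trans_le (M.eRk_le_encard _))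
  rw [← coe_rank, Set.encard_coe_eq_coe_finsetCard] at this
  exact_mod_cast this

/-- A bound for the welfare certified by a set that is closed under exchanges. -/
theorem rank_add_rank_le_of_closed {M : Fin 2 → Matroid (Fin n)} (hE : ∀ m, (M m).E = Set.univ)
    {B : Fin 2 → Finset (Fin n)} (hB : ∀ m, (M m).IsBase (B m : Set (Fin n)))
    {Z : Finset (Fin n)} (hZ : ∀ m u w, Arc (M m) (B m) u w → u ∈ Z → w ∈ Z)
    (hD : ∀ s, s ∉ B 0 → s ∉ B 1 → s ∈ Z) (hO : ∀ s ∈ Z, s ∈ B 0 → s ∉ B 1)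
    {X Y : Finset (Fin n)} (hXY : Disjoint X Y) :
    rank (M 0) X + rank (M 1) Y ≤ (B 0 ∪ B 1).card := by
  have h₀ := rank_le_card_inter (hE 0) (hB 0) (hZ 0)
  have h₁ := rank_le_card_inter (hE 1) (hB 1) (hZ 1)
  have hX := (rank_le_rank_inter_add (M 0) X Z).trans
    (Nat.add_le_add_right (rank_mono (M 0) Finset.inter_subset_right) _)
  have hY := (rank_le_rank_inter_add (M 1) Y Z).trans
    (Nat.add_le_add_right (rank_mono (M 1) Finset.inter_subset_right) _)
  -- Inside Z no element is covered twice, so the two rank bounds add up to the number of covered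
  -- elements of Z.
  have e₁ : (B 0 ∩ Z).card + (B 1 ∩ Z).card = ((B 0 ∪ B 1) ∩ Z).card := by
    rw [Finset.union_inter_distrib_right, Finset.card_union_of_disjoint]
    rw [Finset.disjoint_left]
    intro s hs hs'
    simp only [Finset.mem_inter] at hs hs'
    exact hO s hs.2 hs.1 hs'.1
  -- Outside Z every element is covered.
  have e₂ : (X \ Z).card + (Y \ Z).card ≤ ((B 0 ∪ B 1) \ Z).card := by
    rw [← Finset.card_union_of_disjoint
      (hXY.mono Finset.sdiff_subset Finset.sdiff_subset)]
    refine Finset.card_le_card fun s hs => ?_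
    have hsZ : s ∉ Z := by simp only [Finset.mem_union, Finset.mem_sdiff] at hs; tauto
    simp only [Finset.mem_union, Finset.mem_sdiff]
    refine ⟨?_, hsZ⟩
    by_contra h
    rw [not_or] at h
    exact hsZ (hD s h.1 h.2)
  have e₃ := Finset.card_inter_add_card_sdiff (B 0 ∪ B 1) Z
  omega

theorem rank_insert_of_indep {M : Matroid (Fin n)} {X : Finset (Fin n)} {s : Fin n} (hs : s ∉ X)
    (h : M.Indep (insert s X : Finset (Fin n))) : rank M (insert s X) = rank M X + 1 := by
  rw [rank_eq_card h, rank_eq_card (h.subset (by simp)), Finset.card_insert_of_notMem hs]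

theorem price_insert (p : Fin n → ℝ) {X : Finset (Fin n)} {s : Fin n} (hs : s ∉ X) :
    price p (insert s X) = p s + price p X := Finset.sum_insert hs

/-- A best bundle contains no item of price greater than one. -/
theorem IsBestBundle.notMem_of_one_lt {M : Matroid (Fin n)} {p : Fin n → ℝ} {T : Set (Fin n)}
    {X : Finset (Fin n)} (h : IsBestBundle M p T X) {s : Fin n} (hs : 1 < p s) : s ∉ X := by
  intro hsX
  have h₁ := h.2 (X.erase s) (fun t ht => h.1 (Finset.mem_of_mem_erase ht))
  have h₂ := rank_le_rank_inter_add M X (X.erase s)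
  rw [Finset.inter_eq_right.2 (Finset.erase_subset _ _), Finset.sdiff_erase hsX,
    Finset.sdiff_self, insert_empty_eq,
    Finset.card_singleton] at h₂
  have h₃ : price p X = p s + price p (X.erase s) := (Finset.add_sum_erase _ _ hsX).symm
  have h₄ : (rank M X : ℝ) ≤ rank M (X.erase s) + 1 := by exact_mod_cast h₂
  linarith

/-- A best bundle cannot be extended by a cheap item. -/
theorem IsBestBundle.not_indep_insert {M : Matroid (Fin n)} {p : Fin n → ℝ} {T : Set (Fin n)}
    {X : Finset (Fin n)} (h : IsBestBundle M p T X) {s : Fin n} (hs : p s < 1) (hsT : s ∈ T)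
    (hsX : s ∉ X) : ¬ M.Indep (insert s X : Finset (Fin n)) := by
  intro hI
  have h₁ := h.2 (insert s X) (by
    intro t ht
    rcases Finset.mem_insert.1 ht with rfl | ht
    · exact hsT
    · exact h.1 ht)
  rw [rank_insert_of_indep hsX hI, price_insert p hsX] at h₁
  push_cast at h₁
  linarith

/-- If all items of the bundle have positive prices, a best bundle is independent. -/
theorem IsBestBundle.indep {M : Matroid (Fin n)} {p : Fin n → ℝ} {T : Set (Fin n)}
    {X : Finset (Fin n)} (h : IsBestBundle M p T X) (hp : ∀ s ∈ X, 0 < p s) :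
    M.Indep (X : Set (Fin n)) := by
  obtain ⟨I, hI⟩ := M.exists_isBasis' (X : Set (Fin n))
  lift I to Finset (Fin n) using Set.toFinite I
  have hIX : I ⊆ X := by exact_mod_cast hI.subset
  have hr : rank M I = rank M X := by
    rw [← Nat.cast_inj (R := ℕ∞), coe_rank, coe_rank, hI.eRk_eq_eRk]
  have h₁ := h.2 I (hI.subset.trans h.1)
  rw [hr] at h₁
  have h₂ : price p X ≤ price p I := by linarith
  have h₃ : I = X := by
    by_contra hne
    obtain ⟨s, hs, hs'⟩ := Finset.exists_of_ssubset (hIX.ssubset_of_ne hne)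
    have : price p I < price p X :=
      Finset.sum_lt_sum_of_subset hIX hs hs' (hp s hs) (fun t ht _ => (hp t ht).le)
    linarith
  exact h₃ ▸ hI.indep

/-- If exchanges make a base more expensive, it is the unique cheapest base. -/
theorem price_lt_of_arc {M : Matroid (Fin n)} (hM : StronglyBaseOrderable M) {p : Fin n → ℝ}
    {B X : Finset (Fin n)} (hB : M.IsBase (B : Set (Fin n))) (hX : M.IsBase (X : Set (Fin n)))
    (hp : ∀ u ∈ X, ∀ w, Arc M B u w → p w < p u) (hne : X ≠ B) : price p B < price p X := by
  obtain ⟨f, hf⟩ := hM B X hB hX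
  have hsum : price p X = ∑ s ∈ B, p (f s) := by
    refine (Finset.sum_bij (fun s _ => f s) ?_ ?_ ?_ ?_).symm
    · intro s hs; simpa using hf.1.mapsTo (by simpa using hs)
    · intro s hs t ht h; exact hf.1.injOn (by simpa using hs) (by simpa using ht) h
    · intro t ht
      obtain ⟨s, hs, h⟩ := hf.1.surjOn (show t ∈ (X : Set (Fin n)) by simpa using ht)
      exact ⟨s, by simpa using hs, h⟩
    · intros; rfl
  -- Prices are compared term by term along f: fixed elements contribute equally, and each moved
  -- element s can be replaced by f s.
  have hlt : ∀ s ∈ B, s ∉ X → p s < p (f s) := fun s hs hs' =>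
    hp _ (by simpa using hf.1.mapsTo (by simpa using hs)) _
      (hf.arc (by simpa using hs) (by simpa using hs'))
  have hex : ∃ s ∈ B, s ∉ X := by
    by_contra h
    push Not at h
    exact hne (by exact_mod_cast (hB.eq_of_subset_isBase hX (by exact_mod_cast h)).symm)
  rw [hsum]
  refine Finset.sum_lt_sum (fun s hs => ?_) ?_
  · by_cases hs' : s ∈ X
    · rw [hf.apply_eq_self (by simpa using hs) (by simpa using hs')]
    · exact (hlt s hs hs').le
  · obtain ⟨s, hs, hs'⟩ := hex
    exact ⟨s, hs, hlt s hs hs'⟩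

/-- The price range confines a best bundle to U, makes it independent, and lets it grow to a base.
All bases have equal rank, so only the price counts, and there B wins strictly. Since T is merely
equal to the whole type, the lemma applies to a ground set. -/
theorem IsBestBundle.eq_base {M : Matroid (Fin n)} (hM : StronglyBaseOrderable M)
    {p : Fin n → ℝ} {B U X : Finset (Fin n)} (hB : M.IsBase (B : Set (Fin n))) (hBU : B ⊆ U)
    (h₀ : ∀ s ∈ U, 0 < p s) (h₁ : ∀ s ∈ U, p s < 1) (h₂ : ∀ s ∉ U, 1 < p s)
    (hp : ∀ u ∈ U, ∀ w, Arc M B u w → p w < p u) {T : Set (Fin n)} (hT : T = Set.univ)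
    (h : IsBestBundle M p T X) : X = B := by
  subst hT
  have hXU : X ⊆ U := fun s hs => by
    by_contra hsU
    exact h.notMem_of_one_lt (h₂ s hsU) hs
  have hXI := h.indep (fun s hs => h₀ s (hXU hs))
  have hXB : M.IsBase (X : Set (Fin n)) := by
    by_contra hX
    obtain ⟨e, he, hI⟩ := hXI.exists_insert_of_not_isBase hX hB
    exact h.not_indep_insert (h₁ e (hBU he.1)) trivial he.2 (by simpa using hI)
  by_contra hne
  have h₃ := price_lt_of_arc hM hB hXB (fun u hu => hp u (hXU hu)) hne
  have h₄ := h.2 B (Set.subset_univ _)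
  have h₅ : rank M B = rank M X := by
    rw [← Nat.cast_inj (R := ℕ∞), coe_rank, coe_rank, hB.eRk_eq_eRank, hXB.eRk_eq_eRank]
  rw [h₅] at h₄
  linarith

/-- The choice of the second buyer: every other available item costs more than its possible gain of
1, while each item of the independent set J gains 1 at a smaller price. -/
theorem IsBestBundle.eq_indep {M : Matroid (Fin n)} {p : Fin n → ℝ} {J Y : Finset (Fin n)}
    {T : Set (Fin n)} (hJT : (J : Set (Fin n)) ⊆ T) (hJ : M.Indep (J : Set (Fin n)))
    (h₁ : ∀ s ∈ J, p s < 1) (h₂ : ∀ s ∈ T, s ∉ J → 1 < p s) (h : IsBestBundle M p T Y) :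
    Y = J := by
  have hYJ : Y ⊆ J := fun s hs => by
    by_contra hsJ
    exact h.notMem_of_one_lt (h₂ s (h.1 hs) hsJ) hs
  refine hYJ.antisymm fun s hs => ?_
  by_contra hsY
  refine h.not_indep_insert (h₁ s hs) (hJT hs) hsY (hJ.subset ?_)
  exact_mod_cast Finset.insert_subset hs hYJ

end Pricing

/-! ### Distances in a digraph and potentials -/

section Distance

variable {n : ℕ}

/-- `d` is the distance from the set `src` in a digraph; unreachable vertices have distance
greater than `n`. -/
structure IsDist (adj : Fin n → Fin n → Prop) (src : Finset (Fin n)) (d : Fin n → ℕ) : Prop where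
  zero : ∀ s, d s = 0 ↔ s ∈ src
  pred : ∀ w k, d w = k + 1 → k < n → ∃ y, d y = k ∧ adj y w
  step : ∀ y w, adj y w → d y < n → d w ≤ d y + 1

variable {adj : Fin n → Fin n → Prop} {src : Finset (Fin n)} {d : Fin n → ℕ}

/-- Below a vertex at distance n, all distances 0, …, n would occur, which are n + 1 values on n
vertices. So distances jump from below n to above n, and "at most n" means "reachable". -/
theorem IsDist.lt (h : IsDist adj src d) {w : Fin n} (hw : d w ≤ n) : d w < n := by
  refine lt_of_le_of_ne hw fun hn => ?_
  have key : ∀ k ≤ n, ∃ y, d y = n - k := by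
    intro k hk
    induction k with
    | zero => exact ⟨w, hn⟩
    | succ k ih =>
      obtain ⟨y, hy⟩ := ih (by omega)
      obtain ⟨z, hz, -⟩ := h.pred y (n - (k + 1)) (by omega) (by omega)
      exact ⟨z, hz⟩
  have hsub : Finset.range (n + 1) ⊆ Finset.univ.image d := by
    intro k hk
    obtain ⟨y, hy⟩ := key (n - k) (by omega)
    simp only [Finset.mem_range] at hk
    exact Finset.mem_image.2 ⟨y, Finset.mem_univ y, by omega⟩
  have := (Finset.card_le_card hsub).trans Finset.card_image_le
  simp at this

theorem IsDist.induction (h : IsDist adj src d) {P : Fin n → Prop} (src_mem : ∀ s ∈ src, P s)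
    (step : ∀ y w, adj y w → d y ≤ n → P y → P w) {w : Fin n} (hw : d w ≤ n) : P w := by
  have key : ∀ k ≤ n, ∀ w, d w = k → P w := by
    intro k hk
    induction k with
    | zero => exact fun w hw => src_mem w ((h.zero w).1 hw)
    | succ k ih =>
      intro w hw
      obtain ⟨y, hy, hyw⟩ := h.pred w k hw hk
      exact step y w hyw (by omega) (ih (by omega) y hy)
  exact key _ hw w rfl

theorem IsDist.step_le (h : IsDist adj src d) {y w : Fin n} (hyw : adj y w) (hy : d y ≤ n) :
    d w ≤ n := by
  have := h.step y w hyw (h.lt hy)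
  have := h.lt hy
  omega

/-- If no vertex lies on a closed walk, the number of reachable vertices decreases along arcs. -/
theorem card_reachable_lt {d : Fin n → Fin n → ℕ} (hd : ∀ v, IsDist adj {v} (d v))
    (hcyc : ∀ v y, adj y v → n < d v y) {u w : Fin n} (huw : adj u w) :
    (Finset.univ.filter fun x => d w x ≤ n).card <
      (Finset.univ.filter fun x => d u x ≤ n).card := by
  have self : ∀ v, d v v ≤ n := fun v => by rw [(hd v).zero v |>.2 (by simp)]; omega
  have hsub : ∀ x, d w x ≤ n → d u x ≤ n := fun x hx => by
    refine (hd w).induction (P := fun x => d u x ≤ n) ?_ ?_ hx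
    · intro s hs
      rw [Finset.mem_singleton.1 hs]
      exact (hd u).step_le huw (self u)
    · exact fun y z hyz _ hy => (hd u).step_le hyz hy
  refine Finset.card_lt_card (Finset.ssubset_iff_of_subset ?_ |>.2 ⟨u, ?_, ?_⟩)
  · intro x hx
    simp only [Finset.mem_filter, Finset.mem_univ, true_and] at hx ⊢
    exact hsub x hx
  · simpa using self u
  · simp only [Finset.mem_filter, Finset.mem_univ, true_and]
    -- The vertex u is reachable from itself but not from w. Otherwise either u = w carries a loop,
    -- or the predecessor of u on a path from w is reachable from u, which closes a walk through u.
    intro h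
    have hlt := (hd w).lt h
    rcases Nat.eq_zero_or_pos (d w u) with h0 | h0
    · have : u = w := by simpa using ((hd w).zero u).1 h0
      subst this
      have := hcyc u u huw
      omega
    · obtain ⟨y, hy, hyu⟩ := (hd w).pred u (d w u - 1) (by omega) (by omega)
      have := hcyc u y hyu
      have := hsub y (by omega)
      omega

/-- Converse to `card_reachable_lt`: c never rises along a walk starting in v, but an arc from the
reached vertex y back to v would require c v < c y. -/
theorem lt_dist_of_potential {v : Fin n} (hd : IsDist adj {v} d) {c : Fin n → ℕ}
    (hc : ∀ u w, adj u w → c w < c u) {y : Fin n} (hyv : adj y v) : n < d y := by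
  by_contra h
  have : c y ≤ c v := by
    refine hd.induction (P := fun x => c x ≤ c v) ?_ ?_ (not_lt.1 h)
    · intro s hs; rw [Finset.mem_singleton.1 hs]
    · exact fun y z hyz _ hy => (hc y z hyz).le.trans hy
  have := hc y v hyv
  omega

end Distance

/-! ### Exchanging along a shortest walk -/

section Walk

variable {n : ℕ}

/-- The number of the two sets that contain `s`. -/
def mult (B : Fin 2 → Finset (Fin n)) (s : Fin n) : ℕ :=
  (if s ∈ B 0 then 1 else 0) + if s ∈ B 1 then 1 else 0

/-- The exchange graph of a pair of bases. -/
def Adj (M : Fin 2 → Matroid (Fin n)) (B : Fin 2 → Finset (Fin n)) (u w : Fin n) : Prop :=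
  ∃ m, Arc (M m) (B m) u w

/-- The situation when a shortest walk from `src` to `x₀` has been followed backwards from `x₀`
to `cur`, which is at distance `rem` from `src`, and the exchanges along it have been made. -/
structure WalkInv (M : Fin 2 → Matroid (Fin n)) (B₀ : Fin 2 → Finset (Fin n)) (d : Fin n → ℕ)
    (x₀ : Fin n) (L : ℕ) (B : Fin 2 → Finset (Fin n)) (cur : Fin n) (rem : ℕ) : Prop where
  isBase : ∀ m, (M m).IsBase (B m : Set (Fin n))
  notMem : ∀ m y, y ∉ B₀ m → d y < rem → y ∉ B m
  arc_iff : ∀ m y, y ∉ B₀ m → d y < rem → ∀ w, Arc (M m) (B m) y w ↔ Arc (M m) (B₀ m) y w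
  le_dist : ∀ y, Adj M B₀ y cur → rem ≤ d y + 1
  mult_eq : ∀ s, mult B s + (if s = x₀ then 1 else 0) = mult B₀ s + if s = cur then 1 else 0
  moved : (rem = L ∧ cur = x₀) ∨ ∃ m, x₀ ∈ B₀ m ∧ x₀ ∉ B m

theorem WalkInv.init {M : Fin 2 → Matroid (Fin n)} {B₀ : Fin 2 → Finset (Fin n)} {d : Fin n → ℕ}
    {x₀ : Fin n} {L : ℕ} (hB : ∀ m, (M m).IsBase (B₀ m : Set (Fin n)))
    (hL : ∀ y, Adj M B₀ y x₀ → L ≤ d y + 1) : WalkInv M B₀ d x₀ L B₀ x₀ L :=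
  ⟨hB, fun _ _ h _ => h, fun _ _ _ _ _ => Iff.rfl, hL, fun _ => rfl, Or.inl ⟨rfl, rfl⟩⟩

/-- The exchanges are made from the end of the walk backwards. Vertices nearer to the source than y
have no arc to `cur`, as the walk is shortest, so by `arc_exchange_iff` their exchanges are
unaffected and the rest of the walk stays valid. In the multiplicities, the surplus passes from
`cur` to y. -/
theorem WalkInv.step {M : Fin 2 → Matroid (Fin n)} (hE : ∀ m, (M m).E = Set.univ)
    {B₀ : Fin 2 → Finset (Fin n)} {d : Fin n → ℕ} {x₀ : Fin n} {L : ℕ}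
    {B : Fin 2 → Finset (Fin n)} {cur : Fin n} {k : ℕ}
    (h : WalkInv M B₀ d x₀ L B cur (k + 1)) {y : Fin n} (hy : d y = k) {m : Fin 2}
    (harc : Arc (M m) (B₀ m) y cur) (hdist : ∀ z, Adj M B₀ z y → k ≤ d z + 1) :
    WalkInv M B₀ d x₀ L (Function.update B m ((insert y (B m)).erase cur)) y k := by
  have hyB₀ : y ∉ B₀ m := harc.1
  have harc' := (h.arc_iff m y hyB₀ (by omega) cur).2 harc
  have hyB : y ∉ B m := harc'.1
  have hcB : cur ∈ B m := harc'.2.1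
  have hne : y ≠ cur := fun h => hyB (h ▸ hcB)
  have hcoe : (((insert y (B m)).erase cur : Finset (Fin n)) : Set (Fin n))
      = insert y (B m : Set (Fin n)) \ {cur} := by simp
  constructor
  · intro m'
    by_cases hm : m' = m
    · subst hm
      rw [Function.update_self, hcoe]
      exact harc'.isBase (h.isBase m')
    · rw [Function.update_of_ne hm]; exact h.isBase m'
  · intro m' z hz hdz
    have := h.notMem m' z hz (by omega)
    by_cases hm : m' = m
    · subst hm
      have hzy : z ≠ y := by rintro rfl; omega
      simp [Function.update_self, this, hzy]
    · rwa [Function.update_of_ne hm]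
  · intro m' z hz hdz w
    have h₁ := h.notMem m' z hz (by omega)
    have h₂ := h.arc_iff m' z hz (by omega)
    by_cases hm : m' = m
    · subst hm
      have hzy : z ≠ y := by rintro rfl; omega
      have hzc : ¬ Arc (M m') (B m') z cur := fun h' => by
        have := h.le_dist z ⟨m', (h₂ cur).1 h'⟩
        omega
      rw [Function.update_self, hcoe, arc_exchange_iff (hE m') (h.isBase m') harc' h₁ hzy hzc, h₂]
    · rw [Function.update_of_ne hm, h₂]
  · exact hdist
  · intro s
    have hs := h.mult_eq s
    have hup : mult (Function.update B m ((insert y (B m)).erase cur)) s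
        + (if s = cur then 1 else 0) = mult B s + if s = y then 1 else 0 := by
      have : (if s ∈ (insert y (B m)).erase cur then 1 else 0) + (if s = cur then 1 else 0)
          = (if s ∈ B m then 1 else 0) + if s = y then 1 else 0 := by
        by_cases h₁ : s = cur
        · subst h₁; simp [hcB, hne.symm]
        · by_cases h₂ : s = y
          · subst h₂; simp [hyB, h₁]
          · simp [h₁, h₂]
      fin_cases m
      · simp only [mult, Fin.zero_eta, Function.update_self, ne_eq, one_ne_zero, not_false_eq_true,
          Function.update_of_ne] at this ⊢
        omega
      · simp only [mult, Fin.mk_one, Function.update_self, ne_eq, zero_ne_one, not_false_eq_true,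
          Function.update_of_ne] at this ⊢
        omega
    omega
  · right
    rcases h.moved with ⟨-, rfl⟩ | ⟨m', h₁, h₂⟩
    · exact ⟨m, harc.2.1, by simp⟩
    · refine ⟨m', h₁, ?_⟩
      by_cases hm : m' = m
      · subst hm
        -- Only elements outside the original base are inserted, so x₀ does not return.
        have : x₀ ≠ y := fun h => hyB₀ (h ▸ h₁)
        simp [h₂, this]
      · rwa [Function.update_of_ne hm]

theorem mult_ne_zero {B : Fin 2 → Finset (Fin n)} {s : Fin n} :
    mult B s ≠ 0 ↔ s ∈ B 0 ∪ B 1 := by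
  unfold mult
  by_cases h₀ : s ∈ B 0 <;> by_cases h₁ : s ∈ B 1 <;> simp [h₀, h₁]

/-- A walk from an uncovered element to an element covered twice increases the union. -/
theorem WalkInv.card_union {M : Fin 2 → Matroid (Fin n)} {B₀ B : Fin 2 → Finset (Fin n)}
    {d : Fin n → ℕ} {x₀ cur : Fin n} {L : ℕ} (h : WalkInv M B₀ d x₀ L B cur 0)
    (h₀ : x₀ ∈ B₀ 0) (h₁ : x₀ ∈ B₀ 1) (hcur : cur ∉ B₀ 0 ∪ B₀ 1) :
    (B 0 ∪ B 1).card = (B₀ 0 ∪ B₀ 1).card + 1 := by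
  rw [← Finset.card_insert_of_notMem hcur]
  congr 1
  ext s
  have hs := h.mult_eq s
  rw [Finset.mem_insert, ← mult_ne_zero, ← mult_ne_zero]
  -- Having been covered twice, x₀ stays covered after losing one unit of multiplicity; hence `cur`
  -- is the only change in the union.
  have hx : mult B₀ x₀ = 2 := by simp [mult, h₀, h₁]
  by_cases h₂ : s = x₀
  · subst h₂
    simp only [if_true] at hs
    split_ifs at hs <;> simp_all
  · rw [if_neg h₂] at hs
    split_ifs at hs <;> simp_all

end Walk

/-! ### Two pairs of bases with equal multiplicities -/

section Improve

variable {n : ℕ}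

/-- Two pairs of bases `(B 0, C 1)` and `(C 0, B 1)` covering every element equally often. -/
structure PairState (M : Fin 2 → Matroid (Fin n)) (μ : Fin n → ℕ)
    (B C : Fin 2 → Finset (Fin n)) : Prop where
  isBase : ∀ m, (M m).IsBase (B m : Set (Fin n))
  isBase' : ∀ m, (M m).IsBase (C m : Set (Fin n))
  eq₀ : ∀ s, ((if s ∈ B 0 then 1 else 0) + if s ∈ C 1 then 1 else 0) = μ s
  eq₁ : ∀ s, ((if s ∈ C 0 then 1 else 0) + if s ∈ B 1 then 1 else 0) = μ s

/-- A parity argument: s occurs 2 μ(s) times in B' 0, B' 1, C 0, C 1 together, because B' has the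
multiplicities of B. So it distinguishes both of the pairs (B' m, C m) or neither. -/
theorem PairState.mem_iff {M : Fin 2 → Matroid (Fin n)} {μ : Fin n → ℕ}
    {B C B' : Fin 2 → Finset (Fin n)} (h : PairState M μ B C)
    (hB' : ∀ s, mult B' s = mult B s) (s : Fin n) :
    (s ∈ B' 0 ↔ s ∈ C 0) ↔ (s ∈ B' 1 ↔ s ∈ C 1) := by
  have h₀ := h.eq₀ s
  have h₁ := h.eq₁ s
  have h₂ := hB' s
  unfold mult at h₂
  by_cases a : s ∈ B 0 <;> by_cases b : s ∈ B 1 <;> by_cases c : s ∈ C 0 <;>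
    by_cases d : s ∈ C 1 <;> by_cases e : s ∈ B' 0 <;> by_cases f : s ∈ B' 1 <;>
    simp [a, b, c, d, e, f] at h₀ h₁ h₂ ⊢ <;> omega

/-- Recombining two pairs of bases along a colouring of the elements in which they differ. -/
theorem PairState.recolour {M : Fin 2 → Matroid (Fin n)} {μ : Fin n → ℕ}
    {B C B' : Fin 2 → Finset (Fin n)} (h : PairState M μ B C)
    (hm : ∀ s, mult B' s = mult B s) {f : Fin 2 → Fin n → Fin n}
    (hf : ∀ m, IsExchangeBijection (M m) (B' m : Set (Fin n)) (C m : Set (Fin n)) (f m))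
    {c : Fin n → ℕ} (hc : ∀ s, ¬ (s ∈ B' 0 ↔ s ∈ C 0) → c s = 1 ∨ c s = 2)
    (hcf : ∀ m, ∀ s ∈ B' m, s ∉ C m → c (f m s) ≠ c s)
    {B₁ C₁ : Fin 2 → Finset (Fin n)}
    (hB₁ : ∀ m s, s ∈ B₁ m ↔ if s ∈ B' 0 ↔ s ∈ C 0 then s ∈ B' m else c s = 1)
    (hC₁ : ∀ m s, s ∈ C₁ m ↔ if s ∈ B' 0 ↔ s ∈ C 0 then s ∈ C m else c s = 2) :
    PairState M μ B₁ C₁ := by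
  have hV : ∀ m s, (s ∈ B' m ↔ s ∈ C m) ↔ (s ∈ B' 0 ↔ s ∈ C 0) := by
    intro m s
    fin_cases m
    · exact Iff.rfl
    · exact (h.mem_iff hm s).symm
  have hc' : ∀ m s, ¬ (s ∈ B' m ↔ s ∈ C m) → c s = 1 ∨ c s = 2 := fun m s hs =>
    hc s (fun h' => hs ((hV m s).2 h'))
  -- With only two colours on the difference, having distinct colours means having opposite ones.
  have hcol : ∀ m, ∀ s ∈ B' m, s ∉ C m → (c (f m s) = 1 ↔ c s = 2) ∧ (c (f m s) = 2 ↔ c s = 1) := by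
    intro m s hs hs'
    have h₁ := hcf m s hs hs'
    have h₂ := hc' m s (by tauto)
    have h₃ : f m s ∈ C m := (hf m).1.mapsTo hs
    have h₄ : f m s ∉ B' m := (hf m).apply_notMem (by simpa using hs) (by simpa using hs')
    have h₅ := hc' m (f m s) (by tauto)
    omega
  constructor
  · intro m
    convert (hf m).isBase_colour (c := fun s => c s = 1) ?_ using 1
    · ext s
      rw [Finset.mem_coe, hB₁]
      have := hV m s
      simp only [Finset.mem_coe, Set.mem_ofPred_eq]
      split_ifs with h' <;> tauto
    · intro s hs hs'
      have h₁ := hcol m s hs hs'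
      have h₂ := hc' m s (by simp only [Finset.mem_coe] at hs hs'; tauto)
      omega
  · intro m
    convert (hf m).isBase_colour (c := fun s => c s = 2) ?_ using 1
    · ext s
      rw [Finset.mem_coe, hC₁]
      have := hV m s
      simp only [Finset.mem_coe, Set.mem_ofPred_eq]
      split_ifs with h' <;> tauto
    · intro s hs hs'
      have h₁ := hcol m s hs hs'
      have h₂ := hc' m s (by simp only [Finset.mem_coe] at hs hs'; tauto)
      omega
  -- Where B' and C differ, μ is 1, and each pair receives the element through exactly one of the
  -- two colours; elsewhere B' and C agree and nothing changes.
  all_goals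
    intro s
    have h₀ := h.eq₀ s
    have h₁ := h.eq₁ s
    have h₂ := hm s
    have h₃ := h.mem_iff hm s
    have h₄ := hc s
    unfold mult at h₂
    simp only [hB₁, hC₁]
    by_cases a : s ∈ B 0 <;> by_cases b : s ∈ B 1 <;> by_cases x : s ∈ C 0 <;>
      by_cases y : s ∈ C 1 <;> by_cases e : s ∈ B' 0 <;> by_cases f : s ∈ B' 1 <;>
      simp [a, b, x, y, e, f] at h₀ h₁ h₂ h₃ h₄ ⊢ <;> (try omega) <;>
      rcases h₄ with h₄ | h₄ <;> simp [h₄] <;> omega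

/-- An element distinguishing B 0 from C 0 lies in both or in none of B 0, B 1. Its multiplicity 2
or 0 then forces B' to agree with B there, so it remains a difference. The moved element x has
multiplicity 1; it was no difference before and becomes one. -/
theorem PairState.card_symmDiff_lt {M : Fin 2 → Matroid (Fin n)} {μ : Fin n → ℕ}
    {B C B' : Fin 2 → Finset (Fin n)} (h : PairState M μ B C) (hm : ∀ s, mult B' s = mult B s)
    {x : Fin n} {i : Fin 2} (hx : x ∈ B i) (hx' : x ∉ B' i) :
    (Finset.univ.filter fun s => ¬ (s ∈ B 0 ↔ s ∈ C 0)).card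
      < (Finset.univ.filter fun s => ¬ (s ∈ B' 0 ↔ s ∈ C 0)).card := by
  have key : ∀ s, ¬ (s ∈ B 0 ↔ s ∈ C 0) → (s ∈ B 0 ↔ s ∈ B 1) := by
    intro s
    have h₀ := h.eq₀ s
    have h₁ := h.eq₁ s
    by_cases a : s ∈ B 0 <;> by_cases b : s ∈ B 1 <;> by_cases x : s ∈ C 0 <;>
      by_cases y : s ∈ C 1 <;> simp [a, b, x, y] at h₀ h₁ ⊢ <;> omega
  have key' : ∀ s, (s ∈ B 0 ↔ s ∈ B 1) → (s ∈ B' 0 ↔ s ∈ B 0) ∧ (s ∈ B' 1 ↔ s ∈ B 1) := by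
    intro s
    have h₂ := hm s
    unfold mult at h₂
    by_cases a : s ∈ B 0 <;> by_cases b : s ∈ B 1 <;> by_cases e : s ∈ B' 0 <;>
      by_cases f : s ∈ B' 1 <;> simp [a, b, e, f] at h₂ ⊢
  have hx₁ : ¬ (x ∈ B 0 ↔ x ∈ B 1) := by
    intro h'
    have := key' x h'
    fin_cases i <;> simp_all
  have hx₂ : ¬ (x ∈ B' 0 ↔ x ∈ B 0) := by
    have h₂ := hm x
    unfold mult at h₂
    fin_cases i
    · simp_all
    · simp only [Fin.mk_one] at hx hx'
      have : x ∉ B 0 := by tauto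
      simp only [hx, hx', this, if_true, if_false] at h₂
      by_cases e : x ∈ B' 0
      · tauto
      · simp [e] at h₂
  refine Finset.card_lt_card (Finset.ssubset_iff_of_subset ?_ |>.2 ⟨x, ?_, ?_⟩)
  · intro s hs
    simp only [Finset.mem_filter, Finset.mem_univ, true_and] at hs ⊢
    rw [(key' s (key s hs)).1]
    exact hs
  · have := key x
    simp only [Finset.mem_filter, Finset.mem_univ, true_and]
    tauto
  · have := key x
    simp only [Finset.mem_filter, Finset.mem_univ, true_and]
    tauto

end Improve

/-! ### From certificates to prices with the required properties -/

section Certificate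

variable {n : ℕ}

/-- A combinatorial certificate that `p` is a good price vector. -/
structure Certificate (M : Fin 2 → Matroid (Fin n)) (U : Finset (Fin n)) (p : Fin n → ℝ) where
  B : Fin 2 → Finset (Fin n)
  C : Fin 2 → Finset (Fin n)
  isBase : ∀ m, (M m).IsBase (B m : Set (Fin n))
  isBase' : ∀ m, (M m).IsBase (C m : Set (Fin n))
  mem_iff₀ : ∀ s, s ∈ U ↔ s ∈ B 0 ∨ s ∈ C 1
  mem_iff₁ : ∀ s, s ∈ U ↔ s ∈ C 0 ∨ s ∈ B 1
  le_card : ∀ X Y : Finset (Fin n), Disjoint X Y → rank (M 0) X + rank (M 1) Y ≤ U.card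
  pos : ∀ s ∈ U, 0 < p s
  lt_one : ∀ s ∈ U, p s < 1
  one_lt : ∀ s ∉ U, 1 < p s
  lt_of_arc : ∀ m, ∀ u ∈ U, ∀ w, Arc (M m) (B m) u w → p w < p u

variable {M : Fin 2 → Matroid (Fin n)} {U : Finset (Fin n)} {p : Fin n → ℝ}

/-- The first buyer is forced to take B m. The rest of U lies in the other base of the same pair,
hence is independent and is taken entirely. All of U is sold for its full rank, which meets the
bound `le_card`. -/
theorem Certificate.isRankPricing (h : Certificate M U p) (hE : ∀ m, (M m).E = Set.univ)
    (hM : ∀ m, StronglyBaseOrderable (M m)) : IsRankPricing (M 0) (M 1) p := by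
  have hB : ∀ m, h.B m ⊆ U := by
    intro m s hs
    fin_cases m
    · exact (h.mem_iff₀ s).2 (Or.inl hs)
    · exact (h.mem_iff₁ s).2 (Or.inr hs)
  have hI₀ : (M 1).Indep ((U \ h.B 0 : Finset (Fin n)) : Set (Fin n)) := by
    refine (h.isBase' 1).indep.subset fun s hs => ?_
    simp only [Finset.coe_sdiff, Set.mem_sdiff, Finset.mem_coe] at hs ⊢
    have := h.mem_iff₀ s
    tauto
  have hI₁ : (M 0).Indep ((U \ h.B 1 : Finset (Fin n)) : Set (Fin n)) := by
    refine (h.isBase' 0).indep.subset fun s hs => ?_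
    simp only [Finset.coe_sdiff, Set.mem_sdiff, Finset.mem_coe] at hs ⊢
    have := h.mem_iff₁ s
    tauto
  have hopt : ∀ X Y : Finset (Fin n), Disjoint X Y → X ∪ Y = U →
      (M 0).Indep (X : Set (Fin n)) → (M 1).Indep (Y : Set (Fin n)) →
      IsWelfareOptimal (M 0) (M 1) X Y := by
    intro X Y hXY hU hX hY
    refine ⟨⟨X, Y, by simp [hE], by simp [hE], hXY, rfl⟩, ?_⟩
    rintro w ⟨X', Y', -, -, hXY', rfl⟩
    rw [rank_eq_card hX, rank_eq_card hY, ← Finset.card_union_of_disjoint hXY, hU]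
    exact h.le_card X' Y' hXY'
  have hrest : ∀ m m', (M m').Indep ((U \ h.B m : Finset (Fin n)) : Set (Fin n)) → ∀ Y,
      IsBestBundle (M m') p ((M 0).E \ (h.B m : Set (Fin n))) Y → Y = U \ h.B m := by
    intro m m' hI Y hY
    refine hY.eq_indep ?_ hI (fun s hs => h.lt_one s (Finset.mem_sdiff.1 hs).1) ?_
    · rw [hE]; intro s hs; simp at hs; simpa using hs.2
    · intro s hs hs'
      refine h.one_lt s fun hsU => hs' ?_
      have := hs.2
      simp only [Finset.mem_coe] at this
      exact Finset.mem_sdiff.2 ⟨hsU, this⟩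
  constructor
  · intro B₁ hB₁ B₂ hB₂
    obtain rfl := hB₁.eq_base (hM 0) (h.isBase 0) (hB 0) h.pos h.lt_one h.one_lt
      (h.lt_of_arc 0) (hE 0)
    obtain rfl := hrest 0 1 hI₀ B₂ hB₂
    exact hopt _ _ Finset.disjoint_sdiff (by simpa using hB 0) (h.isBase 0).indep hI₀
  · intro B₂ hB₂ B₁ hB₁
    obtain rfl := hB₂.eq_base (hM 1) (h.isBase 1) (hB 1) h.pos h.lt_one h.one_lt
      (h.lt_of_arc 1) (hE 0)
    obtain rfl := hrest 1 0 hI₁ B₁ hB₁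
    exact hopt _ _ Finset.sdiff_disjoint (by simpa using hB 1) hI₁ (h.isBase 1).indep

/-- Complementary bases attain welfare n, which forces U to be everything. The sizes of the two
bases in a pair then sum to n while they cover all items, so each is the complement of the other. -/
theorem Certificate.isBasePricing (h : Certificate M U p) (hE : ∀ m, (M m).E = Set.univ)
    (hM : ∀ m, StronglyBaseOrderable (M m)) (hc : ComplementaryBases (M 0) (M 1)) :
    IsBasePricing (M 0) (M 1) p := by
  obtain ⟨A₀, A₁, h₀, h₁, hd, hu⟩ := hc
  lift A₀ to Finset (Fin n) using Set.toFinite _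
  lift A₁ to Finset (Fin n) using Set.toFinite _
  have hu' : A₀ ∪ A₁ = Finset.univ := by
    rw [hE] at hu
    exact_mod_cast hu
  have hd' : Disjoint A₀ A₁ := by exact_mod_cast hd
  have hU : U = Finset.univ := by
    refine Finset.eq_univ_of_card _ (le_antisymm (Finset.card_le_univ _) ?_)
    have := h.le_card A₀ A₁ hd'
    rwa [rank_eq_card h₀.indep, rank_eq_card h₁.indep, ← Finset.card_union_of_disjoint hd', hu',
      Finset.card_univ] at this
  have heq : ∀ m X, IsCheapestBase (M m) p X → X = h.B m := by
    intro m X hX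
    by_contra hne
    have := price_lt_of_arc (hM m) (h.isBase m) hX.1
      (fun u _ => h.lt_of_arc m u (by simp [hU])) hne
    exact absurd (hX.2 _ (h.isBase m)) (not_le.2 this)
  have hcard : ∀ m (X Y : Finset (Fin n)), (M m).IsBase (X : Set (Fin n)) →
      (M m).IsBase (Y : Set (Fin n)) → X.card = Y.card := by
    intro m X Y hX hY
    have := hX.encard_eq_encard_of_isBase hY
    rw [Set.encard_coe_eq_coe_finsetCard, Set.encard_coe_eq_coe_finsetCard] at this
    exact_mod_cast this
  have htotal : A₀.card + A₁.card = n := by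
    rw [← Finset.card_union_of_disjoint hd', hu', Finset.card_univ, Fintype.card_fin]
  have key : ∀ m m', (h.B m).card + (h.C m').card = n → (∀ s, s ∈ h.B m ∨ s ∈ h.C m') →
      (M m').IsBase ((M 0).E \ (h.B m : Set (Fin n))) := by
    intro m m' hn hs
    have : (M 0).E \ (h.B m : Set (Fin n)) = (h.C m' : Set (Fin n)) := by
      have hsub : (h.B m)ᶜ ⊆ h.C m' := fun s hs' => (hs s).resolve_left (Finset.mem_compl.1 hs')
      have := Finset.eq_of_subset_of_card_le hsub (by
        rw [Finset.card_compl, Fintype.card_fin]; omega)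
      rw [← this, hE]
      simp [Set.compl_eq_univ_sdiff]
    rw [this]
    exact h.isBase' m'
  have c₀ := hcard 0 _ _ (h.isBase 0) h₀
  have c₁ := hcard 1 _ _ (h.isBase 1) h₁
  have c₂ := hcard 0 _ _ (h.isBase' 0) h₀
  have c₃ := hcard 1 _ _ (h.isBase' 1) h₁
  constructor
  · intro X hX
    obtain rfl := heq 0 X hX
    exact key 0 1 (by omega) (fun s => (h.mem_iff₀ s).1 (by simp [hU]))
  · intro X hX
    obtain rfl := heq 1 X hX
    exact key 1 0 (by omega) (fun s => ((h.mem_iff₁ s).1 (by simp [hU])).symm)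

end Certificate

/-! Names of the rows of the memory. -/

notation "rB₀" => (10 : ℕ)
notation "rB₁" => (11 : ℕ)
notation "rC₀" => (12 : ℕ)
notation "rC₁" => (13 : ℕ)
notation "rSrc" => (14 : ℕ)
notation "rTgt" => (15 : ℕ)
notation "rDist" => (16 : ℕ)
notation "rCount" => (17 : ℕ)
notation "rScratch" => (18 : ℕ)
notation "rUncov" => (19 : ℕ)
notation "rMap₀" => (20 : ℕ)
notation "rMap₁" => (21 : ℕ)
notation "rMate₀" => (22 : ℕ)
notation "rMate₁" => (23 : ℕ)
notation "rColour" => (24 : ℕ)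
notation "rAns" => (30 : ℕ)
notation "rFound" => (31 : ℕ)
notation "rCur" => (32 : ℕ)
notation "rRem" => (33 : ℕ)
notation "rPtr" => (34 : ℕ)

/-! ### Loop invariants, greedy bases and the exchange graph -/

section Loops

open scoped Classical

variable {n : ℕ} {M : Fin 2 → Matroid (Fin n)} {F : Fin 2 → ExchangeProcedure n}

/-- The set represented by a row of the memory. -/
def supp (n : ℕ) (ρ : ℕ → ℕ) : Finset (Fin n) := Finset.univ.filter fun s => ρ s ≠ 0

@[simp] theorem mem_supp {ρ : ℕ → ℕ} {s : Fin n} : s ∈ supp n ρ ↔ ρ s ≠ 0 := by simp [supp]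

@[simp] theorem rowSet_eq_supp (σ : Store) (r : ℕ) : σ.rowSet n r = supp n (σ r) := rfl

theorem supp_congr {ρ ρ' : ℕ → ℕ} (h : ∀ j < n, ρ j = ρ' j) : supp n ρ = supp n ρ' := by
  ext s; simp [h s s.2]

@[simp] theorem Store.ite_apply (p : Prop) [Decidable p] (σ τ : Store) (r : ℕ) :
    (if p then σ else τ) r = if p then σ r else τ r := by split_ifs <;> rfl

namespace Cmd

section Den

variable (σ : Store)

@[simp] theorem den_skip : skip.den M F σ = σ := rfl
@[simp] theorem den_set (r : ℕ) (j e : Expr) :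
    (set r j e).den M F σ = σ.set r (j.eval σ) (e.eval σ) := rfl
@[simp] theorem den_mset (i j e : Expr) :
    (mset i j e).den M F σ = σ.set (100 + i.eval σ) (j.eval σ) (e.eval σ) := rfl
@[simp] theorem den_seq (c d : Cmd) : (c ;; d).den M F σ = d.den M F (c.den M F σ) := rfl
@[simp] theorem den_ite (e : Expr) (c d : Cmd) :
    (ite e c d).den M F σ = if e.Holds σ then c.den M F σ else d.den M F σ := rfl
@[simp] theorem den_indep (m : Fin 2) (r o : ℕ) : (indep m r o).den M F σ
    = σ.set o 0 (if (M m).Indep (supp n (σ r) : Set (Fin n)) then 1 else 0) := rfl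

end Den

/-- A loop whose round `i` only changes the entries in column `i` of the rows in `R`. -/
theorem loop_pointwise {c : Cmd} {x : ℕ} (h : (loop x c).WellFormed) {σ : Store} (R : ℕ → Prop)
    (hR : ∀ r, R r → r ≠ 0) (v : ℕ → ℕ → ℕ)
    (hc : ∀ i < σ 0 0, ∀ τ, Frame (loop x c) σ τ → τ 0 x = i →
      (∀ r, R r → ∀ j, i ≤ j → τ r j = σ r j) →
      ∀ r, R r → c.den M F τ r = Function.update (τ r) i (v r i)) :
    ∀ r, R r → ∀ j, (loop x c).den M F σ r j = if j < σ 0 0 then v r j else σ r j := by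
  refine loop_induction h (fun i τ => ∀ r, R r → ∀ j, τ r j = if j < i then v r j else σ r j) ?_ ?_
  · intro r hr j
    rw [Store.set_row_of_ne _ _ _ _ (hR r hr)]
    simp
  · intro i hi τ hf hx ih r hr j
    have := hc i hi τ hf hx (fun r hr j hj => by rw [ih r hr j, if_neg (by omega)]) r hr
    rw [Store.set_row_of_ne _ _ _ _ (hR r hr), this, Function.update_apply]
    by_cases hj : j = i
    · subst hj; simp
    · rw [if_neg hj, ih r hr j]
      by_cases hji : j < i
      · rw [if_pos hji, if_pos (by omega)]
      · rw [if_neg hji, if_neg (by omega)]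

/-- `loop_pointwise` for a single row. -/
theorem loop_fill {c : Cmd} {x : ℕ} (h : (loop x c).WellFormed) {σ : Store} {r : ℕ}
    (hr : r ≠ 0) (v : ℕ → ℕ)
    (hc : ∀ i < σ 0 0, ∀ τ, Frame (loop x c) σ τ → τ 0 x = i →
      (∀ j, i ≤ j → τ r j = σ r j) → c.den M F τ r = Function.update (τ r) i (v i)) (j : ℕ)
    (hj : j < σ 0 0) : (loop x c).den M F σ r j = v j := by
  have := loop_pointwise (M := M) (F := F) h (σ := σ) (fun r' => r' = r) (by simpa using hr)
    (fun _ => v) (fun i hi τ hf hx hτ r' hr' => by subst hr'; exact hc i hi τ hf hx (hτ _ rfl))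
    r rfl j
  rw [this, if_pos hj]

/-- Extend the set in row `r` greedily to a base. -/
def greedy (m : Fin 2) (r : ℕ) : Cmd :=
  loop 1 (set r (.ctr 1) (.const 1) ;; indep m r rAns ;;
    ite (.not (.var rAns)) (set r (.ctr 1) (.const 0)) skip)

theorem supp_update_ne_zero (ρ : ℕ → ℕ) (s : Fin n) {v : ℕ} (hv : v ≠ 0) :
    supp n (Function.update ρ s v) = insert s (supp n ρ) := by
  ext t
  simp only [mem_supp, Function.update_apply, Finset.mem_insert, Fin.val_inj]
  split_ifs with h <;> simp [h, hv]

theorem supp_update_zero (ρ : ℕ → ℕ) (s : Fin n) :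
    supp n (Function.update ρ s 0) = (supp n ρ).erase s := by
  ext t
  simp only [mem_supp, Function.update_apply, Finset.mem_erase, Fin.val_inj]
  split_ifs with h <;> simp [h]

/-- An item rejected once stays rejected, since the set only grows. The final independent set thus
has no independent extension by a single item. -/
theorem isBase_greedy {m : Fin 2} {r : ℕ} (hr : r ≠ 0)
    (hr' : r ≠ rAns) {σ : Store} (hn : σ 0 0 = n) (h0 : ∀ j, σ r j = 0) :
    (M m).IsBase (supp n ((greedy m r).den M F σ r) : Set (Fin n)) := by
  have hwf : (greedy m r).WellFormed := by
    simp [WellFormed, writes, nested, uses, greedy, hr.symm]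
  have key := loop_induction (M := M) (F := F) hwf (σ := σ) (fun i τ => (∀ j, i ≤ j → τ r j = 0) ∧
    (M m).Indep (supp n (τ r) : Set (Fin n)) ∧
    ∀ s : Fin n, (s : ℕ) < i → s ∉ supp n (τ r) →
      ¬ (M m).Indep (insert s (supp n (τ r)) : Finset (Fin n))) ?_ ?_
  · rw [hn] at key
    obtain ⟨-, h₁, h₂⟩ := key
    by_contra hB
    obtain ⟨B, hB'⟩ := (M m).exists_isBase
    obtain ⟨e, he, hI⟩ := h₁.exists_insert_of_not_isBase hB hB'
    exact h₂ e e.2 he.2 (by simpa using hI)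
  · rw [Store.set_row_of_ne _ _ _ _ hr]
    refine ⟨fun j _ => h0 j, ?_, by simp⟩
    have : supp n (σ r) = ∅ := by ext; simp [h0]
    simp [this]
  · intro i hi τ hf hx ⟨h₁, h₂, h₃⟩
    rw [Store.set_row_of_ne _ _ _ _ hr]
    set s : Fin n := ⟨i, hn ▸ hi⟩
    have hnot : s ∉ supp n (τ r) := by simp [s, h₁ i le_rfl]
    have hdel : Function.update (Function.update (τ r) i 1) i 0 = τ r := by
      rw [Function.update_idem, ← h₁ i le_rfl, Function.update_eq_self]
    have hins : supp n (Function.update (τ r) i 1) = insert s (supp n (τ r)) :=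
      supp_update_ne_zero (τ r) s one_ne_zero
    simp only [den_seq, den_set, den_indep, den_ite, den_skip, Expr.eval_ctr, Expr.eval_const,
      Store.ite_apply, Expr.holds_not, Expr.holds_var, Store.set_row,
      Store.set_row_of_ne _ _ _ _ hr', hx, hins,
      Store.set_row_of_ne _ _ _ _ hr.symm, Store.set_row_of_ne _ _ _ _ (show 0 ≠ rAns by simp),
      hdel, Function.update_self]
    by_cases hI : (M m).Indep (insert s (supp n (τ r)) : Finset (Fin n))
    · simp only [hI, if_true, ne_eq, one_ne_zero, not_false_eq_true, not_true_eq_false, if_false,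
        hins]
      refine ⟨fun j hj => ?_, trivial, fun t ht ht' hI' => ?_⟩
      · rw [Function.update_of_ne (by omega), h₁ j (by omega)]
      · have hts : t ≠ s := fun h => ht' (by simp [h])
        have hti : (t : ℕ) ≠ i := fun h => hts (Fin.ext h)
        refine h₃ t (by omega) (fun h => ht' (by simp [h])) (hI'.subset ?_)
        exact_mod_cast Finset.insert_subset_insert _ (Finset.subset_insert _ _)
    · simp only [hI, if_false, ne_eq, not_true_eq_false, not_false_eq_true, if_true]
      refine ⟨fun j hj => h₁ j (by omega), h₂, fun t ht ht' => ?_⟩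
      by_cases hts : t = s
      · rwa [hts]
      · have hti : (t : ℕ) ≠ i := fun h => hts (Fin.ext h)
        exact h₃ t (by omega) ht'

/-- Copy row `r` into row `r'`. -/
def copyRow (x r' r : ℕ) : Cmd := loop x (set r' (.ctr x) (.cell r (.ctr x)))

/-- Test whether, in the base of the matroid `m`, the element in counter `2` can be replaced by
the element in counter `1`. -/
def testExchange (m : Fin 2) (r : ℕ) : Cmd :=
  copyRow 3 rScratch r ;; set rScratch (.ctr 1) (.const 1) ;; set rScratch (.ctr 2) (.const 0) ;;
    indep m rScratch rAns

theorem testExchange_ans (m : Fin 2) {r : ℕ} (hr : r = rB₀ ∨ r = rB₁) {σ : Store}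
    (hn : σ 0 0 = n) {u w : Fin n} (hu : σ 0 1 = u) (hw : σ 0 2 = w) :
    ((testExchange m r).den M F σ rAns 0 ≠ 0) ↔
      (M m).Indep (insert u (supp n (σ r) : Set (Fin n)) \ {w}) := by
  have hwf : (copyRow 3 rScratch r).WellFormed := by
    simp [WellFormed, writes, nested, uses, copyRow]
  have h₁ := loop_fill (M := M) (F := F) hwf (σ := σ) (r := rScratch) (by simp) (σ r) (by
    intro i hi τ hf hx _
    have hr' : τ r = σ r := by
      rcases hr with rfl | rfl <;> exact hf.row _ (by simp [writes])
    simp [Store.set_row, hx, hr'])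
  have h₂ : supp n ((copyRow 3 rScratch r).den M F σ rScratch) = supp n (σ r) :=
    supp_congr (fun j hj => h₁ j (hn ▸ hj))
  have h₃ := (hwf.frame (M := M) (F := F) σ).ctr 1 (by simp [uses, copyRow])
  have h₄ := (hwf.frame (M := M) (F := F) σ).ctr 2 (by simp [uses, copyRow])
  simp only [testExchange, den_seq, den_set, den_indep, Expr.eval_ctr, Expr.eval_const,
    Store.set_row, Store.set_row_of_ne _ _ _ _ (show 0 ≠ rScratch by simp), h₃, h₄, hu, hw,
    supp_update_zero,
    supp_update_ne_zero _ _ one_ne_zero, h₂, Function.update_self]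
  simp

/-- Compute the exchange graph: `1` and `2` denote exchanges in the first and in the second
base. -/
def exchangeGraph : Cmd :=
  loop 1 (loop 2 (testExchange 0 rB₀ ;;
    ite (.and (.not (.cell rB₀ (.ctr 1))) (.and (.cell rB₀ (.ctr 2)) (.var rAns)))
      (mset (.ctr 1) (.ctr 2) (.const 1))
      (testExchange 1 rB₁ ;;
        ite (.and (.not (.cell rB₁ (.ctr 1))) (.and (.cell rB₁ (.ctr 2)) (.var rAns)))
          (mset (.ctr 1) (.ctr 2) (.const 2)) (mset (.ctr 1) (.ctr 2) (.const 0)))))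

/-- The entry of the exchange graph. -/
noncomputable def label (M : Fin 2 → Matroid (Fin n)) (B : Fin 2 → Finset (Fin n))
    (u w : Fin n) : ℕ :=
  if Arc (M 0) (B 0) u w then 1 else if Arc (M 1) (B 1) u w then 2 else 0

/-- The pair of sets represented by two rows. -/
def pair (n : ℕ) (ρ₀ ρ₁ : ℕ → ℕ) : Fin 2 → Finset (Fin n) := ![supp n ρ₀, supp n ρ₁]

@[simp] theorem pair_zero (ρ₀ ρ₁ : ℕ → ℕ) : pair n ρ₀ ρ₁ 0 = supp n ρ₀ := rfl
@[simp] theorem pair_one (ρ₀ ρ₁ : ℕ → ℕ) : pair n ρ₀ ρ₁ 1 = supp n ρ₁ := rfl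

theorem testExchange_wf (m : Fin 2) {r : ℕ} : (testExchange m r).WellFormed := by
  simp [WellFormed, writes, nested, uses, copyRow, testExchange]

theorem exchangeGraph_wf : exchangeGraph.WellFormed := by decide

/-- Invariants of the nested loops: the matrix rows before i are complete, and in row i the entries
before k. -/
theorem exchangeGraph_spec {σ : Store} (hn : σ 0 0 = n) (u w : Fin n) :
    exchangeGraph.den M F σ (100 + u) w = label M (pair n (σ rB₀) (σ rB₁)) u w := by
  have key := loop_induction (M := M) (F := F) exchangeGraph_wf (σ := σ)
    (fun i τ => ∀ u w : Fin n, (u : ℕ) < i → τ (100 + u) w = label M (pair n (σ rB₀) (σ rB₁)) u w)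
    (by simp) ?_
  · exact key u w (by rw [hn]; exact u.2)
  · intro i hi τ hf hx ih
    have hwf := exchangeGraph_wf.of_loop
    have hnτ : τ 0 0 = n := by rw [hf.ctr 0 rfl, hn]
    rw [hn] at hi
    have key' := loop_induction (M := M) (F := F) hwf (σ := τ)
      (fun k ρ => (∀ u w : Fin n, (u : ℕ) < i →
          ρ (100 + u) w = label M (pair n (σ rB₀) (σ rB₁)) u w) ∧
        ∀ w : Fin n, (w : ℕ) < k →
          ρ (100 + i) w = label M (pair n (σ rB₀) (σ rB₁)) ⟨i, hi⟩ w) ?_ ?_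
    · intro u w hu
      rw [Store.set_row_of_ne _ _ _ _ (by omega)]
      rcases Nat.lt_succ_iff_lt_or_eq.1 hu with hu | hu
      · exact key'.1 u w hu
      · have := key'.2 w (by rw [hnτ]; exact w.2)
        subst hu
        exact this
    · refine ⟨fun u w hu => ?_, by simp⟩
      rw [Store.set_row_of_ne _ _ _ _ (by omega)]
      exact ih u w hu
    · intro k hk ρ hg hy ⟨ih₁, ih₂⟩
      rw [hnτ] at hk
      set u₀ : Fin n := ⟨i, hi⟩
      set w₀ : Fin n := ⟨k, hk⟩
      have hnρ : ρ 0 0 = n := by rw [hg.ctr 0 rfl, hnτ]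
      have hu₀ : ρ 0 1 = u₀ := by rw [hg.ctr 1 rfl, hx]
      have hw₀ : ρ 0 2 = w₀ := hy
      -- Because of the shift in `Frame.row`, row 10 is addressed as `row 9`; the same holds for all
      -- numerals below.
      have hB₀ : ρ rB₀ = σ rB₀ := by rw [hg.row 9 rfl, hf.row 9 rfl]
      have hB₁ : ρ rB₁ = σ rB₁ := by rw [hg.row 10 rfl, hf.row 10 rfl]
      set ρ' := (testExchange 0 rB₀).den M F ρ with hρ'
      have hfr : Frame _ ρ ρ' := (testExchange_wf 0 (r := rB₀)).frame ρ
      have t₀ := testExchange_ans (M := M) (F := F) 0 (r := rB₀) (by simp) hnρ hu₀ hw₀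
      have t₁ := testExchange_ans (M := M) (F := F) 1 (r := rB₁) (by simp) (σ := ρ')
        (by rw [hfr.ctr 0 rfl, hnρ]) (by rw [hfr.ctr 1 rfl, hu₀]) (by rw [hfr.ctr 2 rfl, hw₀])
      set ρ'' := (testExchange 1 rB₁).den M F ρ' with hρ''
      have hfr' : Frame _ ρ' ρ'' := (testExchange_wf 1 (r := rB₁)).frame ρ'
      have hB₀' : ρ' rB₀ = σ rB₀ := by rw [hfr.row 9 rfl, hB₀]
      have hB₁' : ρ' rB₁ = σ rB₁ := by rw [hfr.row 10 rfl, hB₁]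
      have hB₁'' : ρ'' rB₁ = σ rB₁ := by rw [hfr'.row 10 rfl, hB₁']
      have hu' : ρ' 0 1 = i := by rw [hfr.ctr 1 rfl, hu₀]
      have hw' : ρ' 0 2 = k := by rw [hfr.ctr 2 rfl, hw₀]
      have hu'' : ρ'' 0 1 = i := by rw [hfr'.ctr 1 rfl, hu']
      have hw'' : ρ'' 0 2 = k := by rw [hfr'.ctr 2 rfl, hw']
      have hmat : ∀ a, ρ'' (100 + a) = ρ (100 + a) ∧ ρ' (100 + a) = ρ (100 + a) := by
        intro a
        have e₂ : ρ' (100 + a) = ρ (100 + a) :=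
          den_row (by omega) (by simp [testExchange, writes, copyRow]; omega) _
        refine ⟨?_, e₂⟩
        rw [← e₂]
        exact den_row (by omega) (by simp [testExchange, writes, copyRow]; omega) _
      rw [hB₀] at t₀
      rw [hB₁'] at t₁
      have hden : ∀ a b, den M F (testExchange 0 rB₀ ;;
          ite (.and (.not (.cell rB₀ (.ctr 1))) (.and (.cell rB₀ (.ctr 2)) (.var rAns)))
            (mset (.ctr 1) (.ctr 2) (.const 1))
            (testExchange 1 rB₁ ;;
              ite (.and (.not (.cell rB₁ (.ctr 1))) (.and (.cell rB₁ (.ctr 2)) (.var rAns)))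
                (mset (.ctr 1) (.ctr 2) (.const 2)) (mset (.ctr 1) (.ctr 2) (.const 0)))) ρ
            (100 + a) b = if a = i ∧ b = k then label M (pair n (σ rB₀) (σ rB₁)) u₀ w₀
              else ρ (100 + a) b := by
        intro a b
        have a₀ : Arc (M 0) (pair n (σ rB₀) (σ rB₁) 0) u₀ w₀ ↔
            (σ rB₀ i = 0 ∧ σ rB₀ k ≠ 0 ∧ ρ' rAns 0 ≠ 0) := by
          rw [t₀]; simp [Arc, u₀, w₀]
        have a₁ : Arc (M 1) (pair n (σ rB₀) (σ rB₁) 1) u₀ w₀ ↔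
            (σ rB₁ i = 0 ∧ σ rB₁ k ≠ 0 ∧ ρ'' rAns 0 ≠ 0) := by
          rw [t₁]; simp [Arc, u₀, w₀]
        simp only [den_seq, den_ite, den_mset, ← hρ', ← hρ'', ite_apply, Expr.holds_and,
          Expr.holds_not, Expr.holds_cell,
          Expr.holds_var, Expr.eval_ctr, Expr.eval_const, hu', hw', hu'', hw'', hB₀', hB₁'',
          Store.set_apply, hmat, label, a₀, a₁, not_not, Nat.add_left_cancel_iff]
        split_ifs <;> rfl
      refine ⟨fun u w hu => ?_, fun w hw => ?_⟩
      · rw [Store.set_row_of_ne _ _ _ _ (by omega), hden, if_neg (by omega)]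
        exact ih₁ u w hu
      · rw [Store.set_row_of_ne _ _ _ _ (by omega), hden]
        by_cases hwk : (w : ℕ) = k
        · have : w = w₀ := Fin.ext hwk
          rw [if_pos ⟨rfl, hwk⟩, this]
        · rw [if_neg (by simp [hwk])]
          exact ih₂ w (by omega)

end Cmd

end Loops

/-! ### Breadth-first search -/

section Distances

open scoped Classical

variable {n : ℕ} {M : Fin 2 → Matroid (Fin n)} {F : Fin 2 → ExchangeProcedure n}

namespace Cmd

/-- Vertex `ctr 2`, if it has an in-neighbour at distance `ctr 1`, gets distance `ctr 1 + 1`. -/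
def relaxVertex : Cmd :=
  loop 3 (ite (.and (.eq (.cell rDist (.ctr 3)) (.ctr 1)) (.mat (.ctr 3) (.ctr 2)))
    (set rDist (.ctr 2) (.add (.ctr 1) (.const 1))) skip)

/-- Find all vertices at distance `ctr 1 + 1`. -/
def relaxLevel : Cmd :=
  loop 2 (ite (.eq (.cell rDist (.ctr 2)) (.add (.ctr 0) (.const 1))) relaxVertex skip)

/-- Compute the distances from the set in row `rSrc` in the exchange graph. -/
def distances : Cmd :=
  loop 1 (ite (.cell rSrc (.ctr 1)) (set rDist (.ctr 1) (.const 0))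
    (set rDist (.ctr 1) (.add (.ctr 0) (.const 1)))) ;;
  loop 1 relaxLevel

theorem relaxVertex_wf : relaxVertex.WellFormed := by decide
theorem relaxLevel_wf : relaxLevel.WellFormed := by decide
theorem distances_wf : distances.WellFormed := by decide

/-- The loop reads the row that it changes. This is harmless because the entry of w differs from l
both before the change, by `hd`, and after it, being l + 1. -/
theorem relaxVertex_spec {σ : Store} {l w : ℕ} (hl : σ 0 1 = l) (hw : σ 0 2 = w)
    (hd : σ rDist w ≠ l)
    (hmat : ∀ τ : Store, Frame relaxVertex σ τ → ∀ a, τ (100 + a) = σ (100 + a)) :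
    relaxVertex.den M F σ rDist = if ∃ y < σ 0 0, σ rDist y = l ∧ σ (100 + y) w ≠ 0
      then Function.update (σ rDist) w (l + 1) else σ rDist := by
  refine loop_induction (M := M) (F := F) relaxVertex_wf (σ := σ)
    (fun i τ => τ rDist = if ∃ y < i, σ rDist y = l ∧ σ (100 + y) w ≠ 0
      then Function.update (σ rDist) w (l + 1) else σ rDist) (by simp) ?_
  intro i hi τ hf hx ih
  have hl' : τ 0 1 = l := by rw [hf.ctr 1 rfl, hl]
  have hw' : τ 0 2 = w := by rw [hf.ctr 2 rfl, hw]
  have hi' : τ rDist i = l ↔ σ rDist i = l := by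
    rw [ih]
    split_ifs
    · rw [Function.update_apply]
      split_ifs with h
      · subst h
        simp [hd]
      · rfl
    · rfl
  have hex : (∃ y < i + 1, σ rDist y = l ∧ σ (100 + y) w ≠ 0) ↔
      (∃ y < i, σ rDist y = l ∧ σ (100 + y) w ≠ 0) ∨ (σ rDist i = l ∧ σ (100 + i) w ≠ 0) := by
    constructor
    · rintro ⟨y, hy, h⟩
      rcases Nat.lt_succ_iff_lt_or_eq.1 hy with hy | rfl
      · exact Or.inl ⟨y, hy, h⟩
      · exact Or.inr h
    · rintro (⟨y, hy, h⟩ | h)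
      · exact ⟨y, by omega, h⟩
      · exact ⟨i, by omega, h⟩
  rw [Store.set_row_of_ne _ _ _ _ (by simp)]
  simp only [den_ite, den_set, den_skip, Store.ite_apply, Expr.holds_and, Expr.holds_eq,
    Expr.holds_mat, Expr.eval_cell, Expr.eval_ctr, Expr.eval_add, Expr.eval_const, hx, hl', hw',
    hi', hmat τ hf, Store.set_row, hex]
  by_cases h₁ : σ rDist i = l ∧ σ (100 + i) w ≠ 0
  · rw [if_pos h₁, if_pos (Or.inr h₁), ih]
    split_ifs <;> simp
  · simp only [h₁, or_false, if_false]
    exact ih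

/-- The value n + 1 marks vertices not reached so far. As l < n, neither this mark nor the new label
l + 1 equals l, so labels written in this round do not interfere with the search for neighbours at
level l. -/
theorem relaxLevel_spec {σ : Store} {l : ℕ} (hl : σ 0 1 = l) (hln : l < σ 0 0) (j : ℕ)
    (hj : j < σ 0 0) : relaxLevel.den M F σ rDist j =
      if σ rDist j = σ 0 0 + 1 ∧ ∃ y < σ 0 0, σ rDist y = l ∧ σ (100 + y) j ≠ 0
      then l + 1 else σ rDist j := by
  have hmat : ∀ a, relaxLevel.writes (100 + a) = false := by
    intro a
    simp [relaxLevel, relaxVertex, writes]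
    omega
  have hmat' : ∀ a, relaxVertex.writes (100 + a) = false := by
    intro a
    simp [relaxVertex, writes]
    omega
  have key := loop_induction (M := M) (F := F) relaxLevel_wf (σ := σ)
    (fun i τ => ∀ j, τ rDist j = if j < i ∧ σ rDist j = σ 0 0 + 1 ∧
        ∃ y < σ 0 0, σ rDist y = l ∧ σ (100 + y) j ≠ 0 then l + 1 else σ rDist j) (by simp) ?_
  · rw [relaxLevel, key j]
    simp [hj]
  intro i hi τ hf hx ih j
  have hn' : τ 0 0 = σ 0 0 := hf.ctr 0 rfl
  have hl' : τ 0 1 = l := by rw [hf.ctr 1 rfl, hl]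
  have hm : ∀ a, τ (100 + a) = σ (100 + a) := fun a =>
    hf.row_of_ne (by omega) (hmat a)
  have hi₀ : τ rDist i = σ rDist i := by rw [ih i, if_neg (by omega)]
  have hl₀ : ∀ y, τ rDist y = l ↔ σ rDist y = l := by
    intro y
    rw [ih y]
    split_ifs with h
    · omega
    · rfl
  rw [Store.set_row_of_ne _ _ _ _ (by simp)]
  simp only [den_ite, den_skip, Store.ite_apply, Expr.holds_eq, Expr.eval_cell, Expr.eval_ctr,
    Expr.eval_add, Expr.eval_const, hx, hn', hi₀]
  by_cases h₁ : σ rDist i = σ 0 0 + 1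
  · rw [if_pos h₁, relaxVertex_spec hl' hx (by omega) (fun ρ hρ a =>
      hρ.row_of_ne (by omega) (hmat' a))]
    simp only [hn', hl₀, hm]
    by_cases hji : j = i
    · subst hji
      by_cases h₂ : ∃ y < σ 0 0, σ rDist y = l ∧ σ (100 + y) j ≠ 0
      · rw [if_pos h₂, if_pos ⟨by omega, h₁, h₂⟩, Function.update_self]
      · rw [if_neg h₂, if_neg (fun h => h₂ h.2.2), hi₀]
    · have e : (if ∃ y < σ 0 0, σ rDist y = l ∧ σ (100 + y) i ≠ 0
          then Function.update (τ rDist) i (l + 1) else τ rDist) j = τ rDist j := by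
        split_ifs
        · rw [Function.update_of_ne hji]
        · rfl
      rw [e, ih j]
      have : j < i + 1 ↔ j < i := by omega
      simp only [this]
  · rw [if_neg h₁, ih j]
    by_cases hji : j = i
    · subst hji
      rw [if_neg (by omega), if_neg (fun h => h₁ h.2.1)]
    · have : j < i + 1 ↔ j < i := by omega
      simp only [this]

theorem distances_writes (a : ℕ) : distances.writes (100 + a) = false := by
  simp [distances, relaxLevel, relaxVertex, writes]
  omega

theorem distances_spec {σ : Store} (hn : σ 0 0 = n) :
    IsDist (fun u w : Fin n => σ (100 + u) w ≠ 0) (supp n (σ rSrc))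
      (fun s => distances.den M F σ rDist s) := by
  set c₁ : Cmd := loop 1 (ite (.cell rSrc (.ctr 1)) (set rDist (.ctr 1) (.const 0))
    (set rDist (.ctr 1) (.add (.ctr 0) (.const 1)))) with hc₁
  have hwf₁ : c₁.WellFormed := by rw [hc₁]; decide
  have hwf₂ : (loop 1 relaxLevel).WellFormed := by decide
  have h₁ : ∀ j < n, c₁.den M F σ rDist j = if σ rSrc j ≠ 0 then 0 else n + 1 := by
    intro j hj
    refine loop_fill (M := M) (F := F) hwf₁ (by simp)
      (fun j => if σ rSrc j ≠ 0 then 0 else n + 1) ?_ j (by rwa [hn])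
    intro i hi τ hf hx _
    have e₁ : τ rSrc = σ rSrc := hf.row 13 rfl
    have e₂ : τ 0 0 = n := by rw [hf.ctr 0 rfl, hn]
    simp only [den_ite, den_set, Store.ite_apply, Expr.holds_cell, Expr.eval_ctr, Expr.eval_const,
      Expr.eval_add, hx, e₁, e₂, Store.set_row]
    split_ifs <;> rfl
  set τ₀ := c₁.den M F σ with hτ₀
  have hfr : Frame c₁ σ τ₀ := hwf₁.frame σ
  have hn₀ : τ₀ 0 0 = n := by rw [hfr.ctr 0 rfl, hn]
  have hm₀ : ∀ a, τ₀ (100 + a) = σ (100 + a) := fun a =>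
    den_row (by omega) (by simp [hc₁, writes]; omega) _
  -- After l rounds all labels up to l are in place, the other vertices carry n + 1, and the arc
  -- inequality is known for tails at levels below l.
  have key := loop_induction (M := M) (F := F) hwf₂ (σ := τ₀)
    (fun l τ => (∀ s < n, τ rDist s = 0 ↔ σ rSrc s ≠ 0) ∧
      (∀ s < n, τ rDist s ≤ l ∨ τ rDist s = n + 1) ∧
      (∀ w < n, ∀ k < n, τ rDist w = k + 1 → ∃ y < n, τ rDist y = k ∧ σ (100 + y) w ≠ 0) ∧
      (∀ y < n, ∀ w < n, σ (100 + y) w ≠ 0 → τ rDist y < l → τ rDist w ≤ τ rDist y + 1)) ?_ ?_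
  · have hden : distances.den M F σ = (loop 1 relaxLevel).den M F τ₀ := rfl
    rw [hn₀, ← hden] at key
    obtain ⟨k₁, k₂, k₃, k₄⟩ := key
    refine ⟨fun s => by simpa using k₁ s s.2, fun w k hw hk => ?_, fun y w hyw hy => ?_⟩
    · obtain ⟨y, hy, h, h'⟩ := k₃ w w.2 k hk hw
      exact ⟨⟨y, hy⟩, h, h'⟩
    · exact k₄ y y.2 w w.2 hyw hy
  · rw [Store.set_row_of_ne _ _ _ _ (by simp)]
    refine ⟨fun s hs => ?_, fun s hs => ?_, fun w hw k hk h => ?_, by simp⟩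
    · rw [h₁ s hs]; split_ifs with h <;> simp [h]
    · rw [h₁ s hs]; split_ifs <;> simp
    · rw [h₁ w hw] at h; split_ifs at h; omega
  · intro l hl τ hf hx ⟨k₁, k₂, k₃, k₄⟩
    have hn' : τ 0 0 = n := by rw [hf.ctr 0 rfl, hn₀]
    rw [hn₀] at hl
    have hm : ∀ a, τ (100 + a) = σ (100 + a) := fun a => by
      rw [← hm₀]
      exact hf.row_of_ne (by omega) (by simp [relaxLevel, relaxVertex, writes]; omega)
    rw [Store.set_row_of_ne _ _ _ _ (by simp)]
    have hsp := relaxLevel_spec (M := M) (F := F) hx (by rwa [hn'])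
    simp only [hn', hm] at hsp
    generalize relaxLevel.den M F τ rDist = D' at hsp ⊢
    generalize τ rDist = D at k₁ k₂ k₃ k₄ hsp
    refine ⟨fun s hs => ?_, fun s hs => ?_, fun w hw k hk h => ?_, fun y hy w hw hyw h => ?_⟩
    · rw [hsp s hs, ← k₁ s hs]
      by_cases h : D s = n + 1 ∧ ∃ y < n, D y = l ∧ σ (100 + y) s ≠ 0
      · rw [if_pos h, h.1]
        simp
      · rw [if_neg h]
    · have := k₂ s hs
      rw [hsp s hs]
      split_ifs with h <;> clear h <;> omega
    · rw [hsp w hw] at h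
      split_ifs at h with h'
      · obtain ⟨-, y, hy, h₂, h₃⟩ := h'
        refine ⟨y, hy, ?_, h₃⟩
        rw [hsp y hy, if_neg (by omega)]
        omega
      · obtain ⟨y, hy, h₂, h₃⟩ := k₃ w hw k hk h
        refine ⟨y, hy, ?_, h₃⟩
        rw [hsp y hy, if_neg (by omega)]
        exact h₂
    · have hy' : D' y = D y := by
        rw [hsp y hy] at h ⊢
        split_ifs at h ⊢
        · omega
        · rfl
      rw [hy'] at h ⊢
      rw [hsp w hw]
      by_cases hlt : D y < l
      · have := k₄ y hy w hw hyw hlt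
        rw [if_neg (by omega)]
        exact this
      · have hyl : D y = l := by omega
        split_ifs with h'
        · omega
        · have hw' : ¬ D w = n + 1 := fun h₂ => h' ⟨h₂, y, hy, hyl, hyw⟩
          have := k₂ w hw
          omega

end Cmd

end Distances

/-! ### Finding a shortest walk and exchanging along it -/

section Augment

open scoped Classical

variable {n : ℕ} {M : Fin 2 → Matroid (Fin n)} {F : Fin 2 → ExchangeProcedure n}

theorem Cmd.label_ne_zero {B : Fin 2 → Finset (Fin n)} {u w : Fin n} :
    Cmd.label M B u w ≠ 0 ↔ Adj M B u w := by
  unfold Cmd.label Adj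
  rw [Fin.exists_fin_two]
  split_ifs <;> simp_all

namespace Cmd

/-- Find an element of row `rTgt` with an in-neighbour at the smallest possible distance. -/
def findTarget : Cmd :=
  loop 1 (ite (.not (.var rFound)) (loop 2 (loop 3
    (ite (.and (.cell rTgt (.ctr 2))
        (.and (.mat (.ctr 3) (.ctr 2)) (.eq (.cell rDist (.ctr 3)) (.ctr 1))))
      (set rFound (.const 0) (.const 1) ;; set rCur (.const 0) (.ctr 2) ;;
        set rRem (.const 0) (.add (.ctr 1) (.const 1))) skip))) skip)

/-- The arc from `y` to `x` enters a target, from a vertex at distance `l`. -/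
def Hit (σ : Store) (l x y : ℕ) : Prop := σ rTgt x ≠ 0 ∧ σ (100 + y) x ≠ 0 ∧ σ rDist y = l

theorem findTarget_wf : findTarget.WellFormed := by decide

/-- The outermost loop runs through the distances, so the first success gives the shortest walk. The
inner loops are not left on success and may replace a hit by another at the same distance, so their
invariant only asserts that some hit is stored. -/
theorem findTarget_spec {σ : Store} (hfound : σ rFound 0 = 0) :
    (findTarget.den M F σ rFound 0 = 0 ∧ findTarget.den M F σ rRem 0 = σ rRem 0 ∧
      ∀ l < σ 0 0, ∀ x < σ 0 0, ∀ y < σ 0 0, ¬ Hit σ l x y) ∨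
    (findTarget.den M F σ rFound 0 = 1 ∧ ∃ l < σ 0 0, ∃ x < σ 0 0, ∃ y < σ 0 0,
      findTarget.den M F σ rRem 0 = l + 1 ∧ findTarget.den M F σ rCur 0 = x ∧ Hit σ l x y ∧
      ∀ l' < l, ∀ x < σ 0 0, ∀ y < σ 0 0, ¬ Hit σ l' x y) := by
  set N := σ 0 0 with hN
  have hw : ∀ a, findTarget.writes (100 + a) = false := by
    intro a
    simp [findTarget, writes]
    omega
  refine loop_induction (M := M) (F := F) findTarget_wf (σ := σ) (fun i τ =>
    (τ rFound 0 = 0 ∧ τ rRem 0 = σ rRem 0 ∧ ∀ l < i, ∀ x < N, ∀ y < N, ¬ Hit σ l x y) ∨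
    (τ rFound 0 = 1 ∧ ∃ l < N, ∃ x < N, ∃ y < N, τ rRem 0 = l + 1 ∧ τ rCur 0 = x ∧ Hit σ l x y ∧
      ∀ l' < l, ∀ x < N, ∀ y < N, ¬ Hit σ l' x y)) ?_ ?_
  · left
    simp [hfound]
  intro l hl τ hf hx ih
  simp only [Store.set_row_of_ne _ _ _ _ (show rFound ≠ 0 by simp),
    Store.set_row_of_ne _ _ _ _ (show rRem ≠ 0 by simp),
    Store.set_row_of_ne _ _ _ _ (show rCur ≠ 0 by simp)]
  rcases ih with ⟨ih₁, ih₂, ih₃⟩ | ih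
  swap
  · right
    have : ¬ Expr.Holds τ (.not (.var rFound)) := by simp [ih.1]
    rw [den_ite, if_neg this, den_skip]
    exact ih
  have : Expr.Holds τ (.not (.var rFound)) := by simp [ih₁]
  rw [den_ite, if_pos this]
  have hNτ : τ 0 0 = N := hf.ctr 0 rfl
  have key := loop_induction (M := M) (F := F) findTarget_wf.of_loop.seq_left (σ := τ)
    (fun i ρ => ((ρ rFound 0 = 0 ∧ ρ rRem 0 = σ rRem 0) ∨
      (ρ rFound 0 = 1 ∧ ρ rRem 0 = l + 1 ∧ ∃ x < N, ∃ y < N, ρ rCur 0 = x ∧ Hit σ l x y)) ∧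
      (ρ rFound 0 = 0 → ∀ x < i, ∀ y < N, ¬ Hit σ l x y)) ?_ ?_
  · rw [hNτ] at key
    obtain ⟨h₁ | ⟨h₁, h₂, x, hx, y, hy, h₃, h₄⟩, h₅⟩ := key
    · refine Or.inl ⟨h₁.1, h₁.2, fun l' hl' => ?_⟩
      rcases Nat.lt_succ_iff_lt_or_eq.1 hl' with h | rfl
      · exact ih₃ l' h
      · exact h₅ h₁.1
    · exact Or.inr ⟨h₁, l, hl, x, hx, y, hy, h₂, h₃, h₄, ih₃⟩
  · refine ⟨Or.inl ?_, by simp⟩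
    simp [ih₁, ih₂]
  intro x hxN ρ hg hy ⟨ih₄, ih₅⟩
  rw [hNτ] at hxN
  have hNρ : ρ 0 0 = N := by rw [hg.ctr 0 rfl, hNτ]
  have key := loop_induction (M := M) (F := F) findTarget_wf.of_loop.seq_left.of_loop (σ := ρ)
    (fun i ρ => ((ρ rFound 0 = 0 ∧ ρ rRem 0 = σ rRem 0) ∨
      (ρ rFound 0 = 1 ∧ ρ rRem 0 = l + 1 ∧ ∃ x < N, ∃ y < N, ρ rCur 0 = x ∧ Hit σ l x y)) ∧
      (ρ rFound 0 = 0 → (∀ x' < x, ∀ y < N, ¬ Hit σ l x' y) ∧ ∀ y < i, ¬ Hit σ l x y)) ?_ ?_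
  · simp only [Store.set_row_of_ne _ _ _ _ (show rFound ≠ 0 by simp),
      Store.set_row_of_ne _ _ _ _ (show rRem ≠ 0 by simp),
      Store.set_row_of_ne _ _ _ _ (show rCur ≠ 0 by simp)]
    rw [hNρ] at key
    refine ⟨key.1, fun h x' hx' => ?_⟩
    rcases Nat.lt_succ_iff_lt_or_eq.1 hx' with h' | rfl
    · exact (key.2 h).1 x' h'
    · exact (key.2 h).2
  · simp only [Store.set_row_of_ne _ _ _ _ (show rFound ≠ 0 by simp),
      Store.set_row_of_ne _ _ _ _ (show rRem ≠ 0 by simp),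
      Store.set_row_of_ne _ _ _ _ (show rCur ≠ 0 by simp)]
    exact ⟨ih₄, fun h => ⟨ih₅ h, by simp⟩⟩
  intro y hyN θ hh hz ⟨ih₆, ih₇⟩
  rw [hNρ] at hyN
  have e₁ : θ rTgt = σ rTgt := by rw [hh.row 14 rfl, hg.row 14 rfl, hf.row 14 rfl]
  have e₂ : θ rDist = σ rDist := by rw [hh.row 15 rfl, hg.row 15 rfl, hf.row 15 rfl]
  have e₃ : θ (100 + y) = σ (100 + y) := by
    rw [hh.row_of_ne (by omega) (by simp [writes]; omega),
      hg.row_of_ne (by omega) (by simp [writes]; omega), hf.row_of_ne (by omega) (hw y)]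
  have e₄ : θ 0 1 = l := by rw [hh.ctr 1 rfl, hg.ctr 1 rfl, hx]
  have e₅ : θ 0 2 = x := by rw [hh.ctr 2 rfl, hy]
  have hcond : Expr.Holds θ (.and (.cell rTgt (.ctr 2))
      (.and (.mat (.ctr 3) (.ctr 2)) (.eq (.cell rDist (.ctr 3)) (.ctr 1)))) ↔ Hit σ l x y := by
    simp only [Expr.holds_and, Expr.holds_cell, Expr.holds_mat, Expr.holds_eq, Expr.eval_ctr,
      Expr.eval_cell, hz, e₁, e₂, e₃, e₄, e₅, Hit]
  simp only [Store.set_row_of_ne _ _ _ _ (show rFound ≠ 0 by simp),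
    Store.set_row_of_ne _ _ _ _ (show rRem ≠ 0 by simp),
    Store.set_row_of_ne _ _ _ _ (show rCur ≠ 0 by simp)]
  by_cases hhit : Hit σ l x y
  · rw [den_ite, if_pos (hcond.2 hhit)]
    simp only [den_seq, den_set, Expr.eval_const, Expr.eval_ctr, Expr.eval_add, Store.set_apply]
    simp [e₄, e₅]
    exact ⟨hxN, y, hyN, hhit⟩
  · rw [den_ite, if_neg (fun h => hhit (hcond.1 h)), den_skip]
    refine ⟨ih₆, fun h => ⟨(ih₇ h).1, fun y' hy' => ?_⟩⟩
    rcases Nat.lt_succ_iff_lt_or_eq.1 hy' with h' | rfl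
    · exact (ih₇ h).2 y' h'
    · exact hhit

/-- Find a predecessor of the current vertex on a shortest path. -/
def findPred : Cmd :=
  loop 2 (ite (.and (.eq (.add (.cell rDist (.ctr 2)) (.const 1)) (.var rRem))
    (.mat (.ctr 2) (.var rCur))) (set rPtr (.const 0) (.ctr 2)) skip)

/-- Make the exchange belonging to the arc from `rPtr` to `rCur`. -/
def exchangeArc : Cmd :=
  ite (.eq (.mat (.var rPtr) (.var rCur)) (.const 1))
    (set rB₀ (.var rPtr) (.const 1) ;; set rB₀ (.var rCur) (.const 0))
    (set rB₁ (.var rPtr) (.const 1) ;; set rB₁ (.var rCur) (.const 0))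

/-- Follow a shortest path backwards, making the exchanges along it. -/
def walk : Cmd :=
  loop 1 (ite (.lt (.const 0) (.var rRem)) (findPred ;; exchangeArc ;;
    set rCur (.const 0) (.var rPtr) ;; set rRem (.const 0) (.sub (.var rRem) (.const 1))) skip)

theorem findPred_wf : findPred.WellFormed := by decide
theorem exchangeArc_wf : exchangeArc.WellFormed := by decide
theorem walk_wf : walk.WellFormed := by decide

theorem findPred_spec {σ : Store}
    (h : ∃ y < σ 0 0, σ rDist y + 1 = σ rRem 0 ∧ σ (100 + y) (σ rCur 0) ≠ 0) :
    ∃ y < σ 0 0, findPred.den M F σ rPtr 0 = y ∧ σ rDist y + 1 = σ rRem 0 ∧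
      σ (100 + y) (σ rCur 0) ≠ 0 := by
  have key := loop_induction (M := M) (F := F) findPred_wf (σ := σ) (fun i τ =>
    (∃ y < i, σ rDist y + 1 = σ rRem 0 ∧ σ (100 + y) (σ rCur 0) ≠ 0) →
    ∃ y < σ 0 0, τ rPtr 0 = y ∧ σ rDist y + 1 = σ rRem 0 ∧ σ (100 + y) (σ rCur 0) ≠ 0)
    (by simp) ?_
  · exact key h
  intro i hi τ hf hx ih hex
  have e₁ : τ rDist = σ rDist := hf.row 15 rfl
  have e₂ : τ rRem = σ rRem := hf.row 32 rfl
  have e₃ : τ rCur = σ rCur := hf.row 31 rfl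
  have e₄ : τ (100 + i) = σ (100 + i) :=
    hf.row_of_ne (by omega) (by simp [writes]; omega)
  rw [Store.set_row_of_ne _ _ _ _ (by simp)]
  have hcond : Expr.Holds τ (.and (.eq (.add (.cell rDist (.ctr 2)) (.const 1)) (.var rRem))
      (.mat (.ctr 2) (.var rCur))) ↔ σ rDist i + 1 = σ rRem 0 ∧ σ (100 + i) (σ rCur 0) ≠ 0 := by
    simp only [Expr.holds_and, Expr.holds_mat, Expr.holds_eq, Expr.eval_ctr, Expr.eval_add,
      Expr.eval_const, Expr.eval_var, Expr.eval_cell, hx, e₁, e₂, e₃, e₄]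
  by_cases hc : σ rDist i + 1 = σ rRem 0 ∧ σ (100 + i) (σ rCur 0) ≠ 0
  · rw [den_ite, if_pos (hcond.2 hc)]
    refine ⟨i, hi, ?_, hc⟩
    simp [Store.set_apply, hx]
  · rw [den_ite, if_neg (fun h => hc (hcond.1 h)), den_skip]
    obtain ⟨y, hy, h⟩ := hex
    rcases Nat.lt_succ_iff_lt_or_eq.1 hy with hy | rfl
    · exact ih ⟨y, hy, h⟩
    · exact absurd h hc

theorem pair_update_zero (ρ₀ ρ₁ ρ : ℕ → ℕ) :
    pair n ρ ρ₁ = Function.update (pair n ρ₀ ρ₁) 0 (supp n ρ) := by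
  funext m
  fin_cases m <;> simp [pair]

theorem pair_update_one (ρ₀ ρ₁ ρ : ℕ → ℕ) :
    pair n ρ₀ ρ = Function.update (pair n ρ₀ ρ₁) 1 (supp n ρ) := by
  funext m
  fin_cases m <;> simp [pair]

/-- After i rounds the current vertex is at distance L - i from the sources. The subtraction is
truncated: since L ≤ n, the n rounds suffice, and those after the arrival at a source do nothing. -/
theorem walk_spec (hE : ∀ m, (M m).E = Set.univ) {σ : Store} (hn : σ 0 0 = n)
    {B₀ : Fin 2 → Finset (Fin n)} (hmat : ∀ u w : Fin n, σ (100 + u) w = label M B₀ u w)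
    {src : Finset (Fin n)} {d : Fin n → ℕ} (hd : IsDist (Adj M B₀) src d)
    (hd' : ∀ s : Fin n, σ rDist s = d s) {x₀ : Fin n} {L : ℕ} (hLn : L ≤ n) (hL0 : L ≠ 0)
    (hx₀ : σ rCur 0 = x₀) (hrem : σ rRem 0 = L)
    (hinv : WalkInv M B₀ d x₀ L (pair n (σ rB₀) (σ rB₁)) x₀ L)
    (hpred : ∃ y, d y + 1 = L ∧ Adj M B₀ y x₀) :
    ∃ cur ∈ src, WalkInv M B₀ d x₀ L
      (pair n (walk.den M F σ rB₀) (walk.den M F σ rB₁)) cur 0 := by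
  have key := loop_induction (M := M) (F := F) walk_wf (σ := σ) (fun i τ =>
    ∃ cur : Fin n, τ rCur 0 = cur ∧ τ rRem 0 = L - i ∧
      WalkInv M B₀ d x₀ L (pair n (τ rB₀) (τ rB₁)) cur (L - i) ∧
      (L - i = 0 → d cur = 0) ∧ (L - i ≠ 0 → ∃ y, d y + 1 = L - i ∧ Adj M B₀ y cur)) ?_ ?_
  · obtain ⟨cur, -, -, h₁, h₂, -⟩ := key
    rw [hn, show L - n = 0 by omega] at h₁
    exact ⟨cur, (hd.zero cur).1 (h₂ (by omega)), h₁⟩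
  · refine ⟨x₀, ?_⟩
    simp only [Store.set_row_of_ne _ _ _ _ (show rB₀ ≠ 0 by simp),
      Store.set_row_of_ne _ _ _ _ (show rB₁ ≠ 0 by simp),
      Store.set_row_of_ne _ _ _ _ (show rRem ≠ 0 by simp),
      Store.set_row_of_ne _ _ _ _ (show rCur ≠ 0 by simp), Nat.sub_zero]
    exact ⟨hx₀, hrem, hinv, fun h => absurd h hL0, fun _ => hpred⟩
  intro i hi τ hf hx ⟨cur, h₁, h₂, h₃, h₄, h₅⟩
  simp only [Store.set_row_of_ne _ _ _ _ (show rB₀ ≠ 0 by simp),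
    Store.set_row_of_ne _ _ _ _ (show rB₁ ≠ 0 by simp),
    Store.set_row_of_ne _ _ _ _ (show rRem ≠ 0 by simp),
    Store.set_row_of_ne _ _ _ _ (show rCur ≠ 0 by simp)]
  by_cases h0 : L - i = 0
  · have : ¬ Expr.Holds τ (.lt (.const 0) (.var rRem)) := by simp [h₂, h0]
    rw [den_ite, if_neg this, den_skip]
    rw [show L - (i + 1) = L - i by omega]
    exact ⟨cur, h₁, h₂, h₃, h₄, h₅⟩
  have : Expr.Holds τ (.lt (.const 0) (.var rRem)) := by simp [h₂]; omega
  rw [den_ite, if_pos this]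
  have hN : τ 0 0 = n := by rw [hf.ctr 0 rfl, hn]
  have hdτ : ∀ s : Fin n, τ rDist s = d s := fun s => by rw [hf.row 15 rfl, hd']
  have hmτ : ∀ u w : Fin n, τ (100 + u) w = label M B₀ u w := fun u w => by
    rw [hf.row_of_ne (by omega) (by simp [findPred, exchangeArc, writes]; omega), hmat]
  obtain ⟨y, hyn, hy₁, hy₂, hy₃⟩ := findPred_spec (M := M) (F := F) (σ := τ) (by
    obtain ⟨y, hy, hy'⟩ := h₅ h0
    refine ⟨y, by rw [hN]; exact y.2, by rw [hdτ, h₂, hy], ?_⟩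
    rw [h₁, hmτ]
    exact label_ne_zero.2 hy')
  rw [hN] at hyn
  lift y to Fin n using hyn
  rw [hdτ, h₂] at hy₂
  rw [h₁, hmτ] at hy₃
  set ρ := findPred.den M F τ with hρ
  have hfr : Frame _ τ ρ := findPred_wf.frame τ
  have eB₀ : ρ rB₀ = τ rB₀ := hfr.row 9 rfl
  have eB₁ : ρ rB₁ = τ rB₁ := hfr.row 10 rfl
  have eC : ρ rCur 0 = cur := by rw [hfr.row 31 rfl, h₁]
  have eR : ρ rRem 0 = L - i := by rw [hfr.row 32 rfl, h₂]
  have eM : ρ (100 + y) cur = label M B₀ y cur := by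
    rw [hfr.row_of_ne (by omega) (by simp [findPred, writes]; omega), hmτ]
  set θ := exchangeArc.den M F ρ with hθ
  have hfr' : Frame _ ρ θ := exchangeArc_wf.frame ρ
  have hPθ : θ rPtr 0 = y := by rw [hfr'.row 33 rfl, hy₁]
  have hRθ : θ rRem 0 = L - i := by rw [hfr'.row 32 rfl, eR]
  have hfinal : den M F (findPred ;; exchangeArc ;; set rCur (.const 0) (.var rPtr) ;;
      set rRem (.const 0) (.sub (.var rRem) (.const 1))) τ
      = (θ.set rCur 0 y).set rRem 0 (L - (i + 1)) := by
    simp only [den_seq, den_set, Expr.eval_const, Expr.eval_var, Expr.eval_sub, ← hρ, ← hθ, hPθ]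
    rw [Store.set_row_of_ne _ _ _ _ (show rRem ≠ rCur by simp), hRθ, Nat.sub_sub]
  rw [hfinal]
  simp only [Store.set_row_of_ne _ _ _ _ (show rB₀ ≠ rRem by simp),
    Store.set_row_of_ne _ _ _ _ (show rB₁ ≠ rRem by simp),
    Store.set_row_of_ne _ _ _ _ (show rCur ≠ rRem by simp),
    Store.set_row_of_ne _ _ _ _ (show rB₀ ≠ rCur by simp),
    Store.set_row_of_ne _ _ _ _ (show rB₁ ≠ rCur by simp), Store.set_row, Function.update_self]
  obtain ⟨k, hk⟩ := Nat.exists_eq_succ_of_ne_zero h0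
  have hk' : L - (i + 1) = k := by
    clear h₅ h₄ hpred
    omega
  have hdy : d y = k := by
    clear h₅ h₄ hpred
    omega
  rw [hk] at h₃
  rw [hk']
  -- The arc inequality is available only for tails at distance below n; for the others the claim is
  -- trivial since k < n.
  have hdist : ∀ z, Adj M B₀ z y → k ≤ d z + 1 := fun z hz => by
    by_cases hzn : d z < n
    · have := hd.step z y hz hzn
      omega
    · omega
  refine ⟨y, rfl, trivial, ?_, fun h => by omega, fun h => ?_⟩
  · by_cases hl : label M B₀ y cur = 1
    · have harc : Arc (M 0) (B₀ 0) y cur := by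
        unfold label at hl
        split_ifs at hl <;> simp_all
      have e₀ : θ rB₀ = Function.update (Function.update (τ rB₀) y 1) cur 0 := by
        simp only [hθ, exchangeArc, den_ite]
        rw [if_pos (by simp [hy₁, eC, eM, hl])]
        simp [Store.set_row, hy₁, eC, eB₀]
      have e₁ : θ rB₁ = τ rB₁ := by
        simp only [hθ, exchangeArc, den_ite]
        rw [if_pos (by simp [hy₁, eC, eM, hl])]
        simp [eB₁]
      rw [e₁, pair_update_zero (τ rB₀), e₀, supp_update_zero, supp_update_ne_zero _ _ one_ne_zero]
      exact h₃.step hE hdy harc hdist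
    · have harc : Arc (M 1) (B₀ 1) y cur := by
        unfold label at hl hy₃
        split_ifs at hl hy₃ <;> simp_all
      have e₁ : θ rB₁ = Function.update (Function.update (τ rB₁) y 1) cur 0 := by
        simp only [hθ, exchangeArc, den_ite]
        rw [if_neg (by simp [hy₁, eC, eM, hl])]
        simp [Store.set_row, hy₁, eC, eB₁]
      have e₀ : θ rB₀ = τ rB₀ := by
        simp only [hθ, exchangeArc, den_ite]
        rw [if_neg (by simp [hy₁, eC, eM, hl])]
        simp [eB₀]
      rw [e₀, pair_update_one _ (τ rB₁), e₁, supp_update_zero, supp_update_ne_zero _ _ one_ne_zero]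
      exact h₃.step hE hdy harc hdist
  · obtain ⟨z, hz, hz'⟩ := hd.pred y (k - 1) (by omega) (by omega)
    exact ⟨z, by omega, hz'⟩

/-- Search for a shortest path from `rSrc` to `rTgt` and make the exchanges along it. -/
def augment : Cmd :=
  set rFound (.const 0) (.const 0) ;; set rRem (.const 0) (.const 0) ;; findTarget ;; walk

theorem augment_wf : augment.WellFormed := by decide

/-- Covers an unsuccessful search: the remaining length was set to 0 beforehand, so the bases stay
as they are. -/
theorem walk_of_rem_eq_zero {σ : Store} (h : σ rRem 0 = 0) :
    walk.den M F σ rB₀ = σ rB₀ ∧ walk.den M F σ rB₁ = σ rB₁ := by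
  have key := loop_induction (M := M) (F := F) walk_wf (σ := σ) (fun i τ =>
    τ rRem 0 = 0 ∧ τ rB₀ = σ rB₀ ∧ τ rB₁ = σ rB₁) (by simp [h]) ?_
  · exact key.2
  intro i hi τ hf hx ih
  have : ¬ Expr.Holds τ (.lt (.const 0) (.var rRem)) := by simp [ih.1]
  rw [den_ite, if_neg this, den_skip]
  simpa using ih

theorem augment_spec (hE : ∀ m, (M m).E = Set.univ) {σ : Store} (hn : σ 0 0 = n)
    {B₀ : Fin 2 → Finset (Fin n)} (hB₀ : pair n (σ rB₀) (σ rB₁) = B₀)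
    (hB : ∀ m, (M m).IsBase (B₀ m : Set (Fin n)))
    (hmat : ∀ u w : Fin n, σ (100 + u) w = label M B₀ u w)
    {src : Finset (Fin n)} {d : Fin n → ℕ} (hd : IsDist (Adj M B₀) src d)
    (hd' : ∀ s : Fin n, σ rDist s = d s) :
    (augment.den M F σ rFound 0 = 0 ∧ augment.den M F σ rB₀ = σ rB₀ ∧
      augment.den M F σ rB₁ = σ rB₁ ∧
      ∀ x ∈ supp n (σ rTgt), ∀ y, Adj M B₀ y x → n ≤ d y) ∨
    (augment.den M F σ rFound 0 = 1 ∧ ∃ x₀ ∈ supp n (σ rTgt), ∃ y, Adj M B₀ y x₀ ∧ d y < n ∧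
      ∃ L ≠ 0, ∃ cur ∈ src, WalkInv M B₀ d x₀ L
        (pair n (augment.den M F σ rB₀) (augment.den M F σ rB₁)) cur 0) := by
  set σ₁ := (σ.set rFound 0 0).set rRem 0 0 with hσ₁
  set σ₂ := findTarget.den M F σ₁ with hσ₂
  have hden : augment.den M F σ = walk.den M F σ₂ := rfl
  have hrow : ∀ r, r ≠ rFound → r ≠ rRem → σ₁ r = σ r := fun r h h' => by
    rw [hσ₁, Store.set_row_of_ne _ _ _ _ h', Store.set_row_of_ne _ _ _ _ h]
  have hn₁ : σ₁ 0 0 = n := by rw [hrow 0 (by simp) (by simp), hn]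
  have hF₁ : σ₁ rFound 0 = 0 := by simp [hσ₁, Store.set_apply]
  have hR₁ : σ₁ rRem 0 = 0 := by simp [hσ₁, Store.set_apply]
  have hfr : Frame _ σ₁ σ₂ := findTarget_wf.frame σ₁
  have hfr' : Frame _ σ₂ (walk.den M F σ₂) := walk_wf.frame σ₂
  have hm₁ : ∀ a, σ₁ (100 + a) = σ (100 + a) := fun a => hrow _ (by omega) (by omega)
  have hhit : ∀ l (x y : Fin n), Hit σ₁ l x y ↔ x ∈ supp n (σ rTgt) ∧ Adj M B₀ y x ∧ d y = l := by
    intro l x y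
    rw [Hit, hm₁, hmat, label_ne_zero, hrow rTgt (by simp) (by simp),
      hrow rDist (by simp) (by simp), hd', mem_supp]
  rw [hden, hfr'.row 30 rfl]
  rcases findTarget_spec (M := M) (F := F) hF₁ with
    ⟨h₁, h₂, h₃⟩ | ⟨h₁, l, hl, x, hx, y, hy, h₂, h₃, h₄, h₅⟩
  · left
    rw [hR₁] at h₂
    obtain ⟨w₀, w₁⟩ := walk_of_rem_eq_zero (M := M) (F := F) (σ := σ₂) h₂
    refine ⟨h₁, ?_, ?_, fun x hx y hyx => ?_⟩
    · rw [w₀, hfr.row 9 rfl, hrow _ (by simp) (by simp)]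
    · rw [w₁, hfr.row 10 rfl, hrow _ (by simp) (by simp)]
    · by_contra hlt
      rw [hn₁] at h₃
      exact h₃ (d y) (by omega) x x.2 y y.2 ((hhit _ x y).2 ⟨hx, hyx, rfl⟩)
  · right
    rw [hn₁] at hl hx hy h₅
    lift x to Fin n using hx
    lift y to Fin n using hy
    obtain ⟨hxt, hyx, hdy⟩ := (hhit l x y).1 h₄
    have hpair : pair n (σ₂ rB₀) (σ₂ rB₁) = B₀ := by
      rw [hfr.row 9 rfl, hfr.row 10 rfl, hrow _ (by simp) (by simp), hrow _ (by simp) (by simp),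
        hB₀]
    obtain ⟨cur, hcur, hw⟩ := walk_spec (M := M) (F := F) hE (σ := σ₂) (x₀ := x) (L := l + 1)
      (by rw [hfr.ctr 0 rfl, hn₁])
      (fun u w => by
        rw [hfr.row_of_ne (by omega) (by simp [findTarget, writes]; omega), hm₁, hmat]) hd
      (fun s => by rw [hfr.row 15 rfl, hrow _ (by simp) (by simp), hd']) (by omega) (by omega) h₃ h₂
      (by
        rw [hpair]
        refine .init hB fun z hz => ?_
        by_contra hlt
        exact h₅ (d z) (by omega) x x.2 z z.2 ((hhit _ x z).2 ⟨hxt, hz, rfl⟩))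
      ⟨y, by omega, hyx⟩
    exact ⟨h₁, x, hxt, y, hyx, by omega, l + 1, by omega, cur, hcur, hw⟩

end Cmd

end Augment

/-! ### Bases with a union of maximum size -/

section Cover

open scoped Classical

variable {n : ℕ} {M : Fin 2 → Matroid (Fin n)} {F : Fin 2 → ExchangeProcedure n}

@[simp] theorem Expr.eval_not (σ : Store) (a : Expr) :
    a.not.eval σ = if a.eval σ = 0 then 1 else 0 := rfl

namespace Cmd

/-- Look for a walk from `rSrc` to `rTgt` in the exchange graph and make the exchanges along it. -/
def search : Cmd := distances ;; augment

theorem search_wf : search.WellFormed := by decide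

theorem search_spec (hE : ∀ m, (M m).E = Set.univ) {σ : Store} (hn : σ 0 0 = n)
    {B : Fin 2 → Finset (Fin n)} (hB : pair n (σ rB₀) (σ rB₁) = B)
    (hB' : ∀ m, (M m).IsBase (B m : Set (Fin n)))
    (hmat : ∀ u w : Fin n, σ (100 + u) w = label M B u w) :
    ∃ d, IsDist (Adj M B) (supp n (σ rSrc)) d ∧
      (∀ s : Fin n, search.den M F σ rDist s = d s) ∧
      ((search.den M F σ rFound 0 = 0 ∧ search.den M F σ rB₀ = σ rB₀ ∧
        search.den M F σ rB₁ = σ rB₁ ∧ ∀ x ∈ supp n (σ rTgt), ∀ y, Adj M B y x → n < d y) ∨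
      (search.den M F σ rFound 0 = 1 ∧ ∃ x ∈ supp n (σ rTgt), ∃ y, Adj M B y x ∧ d y < n ∧
        ∃ L ≠ 0, ∃ cur ∈ supp n (σ rSrc), WalkInv M B d x L
          (pair n (search.den M F σ rB₀) (search.den M F σ rB₁)) cur 0)) := by
  have hd := distances_spec (M := M) (F := F) hn
  have hadj : (fun u w : Fin n => σ (100 + u) w ≠ 0) = Adj M B := by
    funext u w
    rw [hmat, eq_iff_iff, label_ne_zero]
  rw [hadj] at hd
  set τ := distances.den M F σ with hτ
  have hfr : Frame _ σ τ := distances_wf.frame σ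
  have hfr' : Frame _ τ (augment.den M F τ) := augment_wf.frame τ
  have hden : search.den M F σ = augment.den M F τ := rfl
  have e₀ : τ rB₀ = σ rB₀ := hfr.row 9 rfl
  have e₁ : τ rB₁ = σ rB₁ := hfr.row 10 rfl
  have e₂ : τ rTgt = σ rTgt := hfr.row 14 rfl
  refine ⟨_, hd, fun s => by rw [hden, hfr'.row 15 rfl], ?_⟩
  have key := augment_spec (M := M) (F := F) hE (σ := τ) (by rw [hfr.ctr 0 rfl, hn])
    (by rw [e₀, e₁, hB]) hB'
    (fun u w => by rw [hfr.row_of_ne (by omega) (distances_writes u), hmat]) hd (fun s => rfl)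
  rw [hden, ← e₀, ← e₁, ← e₂]
  refine key.imp_left fun ⟨h₁, h₂, h₃, h₄⟩ => ⟨h₁, h₂, h₃, fun x hx y hyx => ?_⟩
  -- The search inspected the distances below n only; by `IsDist.lt` there is nothing at distance
  -- exactly n.
  by_contra h
  have := hd.lt (not_lt.1 h)
  have := h₄ x hx y hyx
  omega

/-- The sources are the elements in neither base, the targets those in both bases. -/
def markEnds : Cmd :=
  loop 1 (ite (.cell rB₀ (.ctr 1))
    (set rSrc (.ctr 1) (.const 0) ;; set rTgt (.ctr 1) (.cell rB₁ (.ctr 1)))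
    (set rSrc (.ctr 1) (.not (.cell rB₁ (.ctr 1))) ;; set rTgt (.ctr 1) (.const 0)))

theorem markEnds_wf : markEnds.WellFormed := by decide

theorem markEnds_spec {σ : Store} (hn : σ 0 0 = n) (s : Fin n) :
    (s ∈ supp n (markEnds.den M F σ rSrc) ↔ s ∉ supp n (σ rB₀) ∧ s ∉ supp n (σ rB₁)) ∧
    (s ∈ supp n (markEnds.den M F σ rTgt) ↔ s ∈ supp n (σ rB₀) ∧ s ∈ supp n (σ rB₁)) := by
  have key := loop_pointwise (M := M) (F := F) markEnds_wf (σ := σ)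
    (fun r => r = rSrc ∨ r = rTgt) (by rintro r (rfl | rfl) <;> simp)
    (fun r i => if r = rSrc then (if σ rB₀ i = 0 ∧ σ rB₁ i = 0 then 1 else 0)
      else if σ rB₀ i = 0 then 0 else σ rB₁ i) ?_
  · have h₁ := key rSrc (Or.inl rfl) s
    have h₂ := key rTgt (Or.inr rfl) s
    rw [if_pos (by rw [hn]; exact s.2)] at h₁ h₂
    simp only [mem_supp, markEnds, h₁, h₂]
    by_cases a : σ rB₀ s = 0 <;> by_cases b : σ rB₁ s = 0 <;> simp [a, b]
  · intro i hi τ hf hx _ r hr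
    have e₀ : τ rB₀ = σ rB₀ := hf.row 9 rfl
    have e₁ : τ rB₁ = σ rB₁ := hf.row 10 rfl
    rcases hr with rfl | rfl
    · by_cases a : σ rB₀ i = 0 <;> by_cases b : σ rB₁ i = 0 <;>
        simp [Store.set_row, hx, e₀, e₁, a, b]
    · by_cases a : σ rB₀ i = 0 <;> by_cases b : σ rB₁ i = 0 <;>
        simp [Store.set_row, hx, e₀, e₁, a, b]

/-- Look for bases of the two matroids with a larger union. -/
def enlarge : Cmd := exchangeGraph ;; markEnds ;; search

/-- Compute bases of the two matroids with a union of maximum size. -/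
def cover : Cmd := greedy 0 rB₀ ;; greedy 1 rB₁ ;; loop 5 enlarge

theorem cover_wf : cover.WellFormed := by decide

/-- The union of the two sets is as large as the welfare can be. -/
def Covering (M : Fin 2 → Matroid (Fin n)) (B : Fin 2 → Finset (Fin n)) : Prop :=
  ∀ X Y : Finset (Fin n), Disjoint X Y → rank (M 0) X + rank (M 1) Y ≤ (B 0 ∪ B 1).card

/-- The augmenting step of matroid union: either a shortest walk leads from an uncovered element to
one covered twice, or no such walk exists and the reachable set proves optimality. -/
theorem enlarge_spec (hE : ∀ m, (M m).E = Set.univ) {σ : Store} (hn : σ 0 0 = n)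
    {B : Fin 2 → Finset (Fin n)} (hB : pair n (σ rB₀) (σ rB₁) = B)
    (hB' : ∀ m, (M m).IsBase (B m : Set (Fin n))) {B₁ : Fin 2 → Finset (Fin n)}
    (hB₁ : pair n (enlarge.den M F σ rB₀) (enlarge.den M F σ rB₁) = B₁) :
    (∀ m, (M m).IsBase (B₁ m : Set (Fin n))) ∧
      (B₁ = B ∧ Covering M B₁ ∨ (B₁ 0 ∪ B₁ 1).card = (B 0 ∪ B 1).card + 1) := by
  have hlab := exchangeGraph_spec (M := M) (F := F) hn
  set σ₁ := exchangeGraph.den M F σ with hσ₁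
  have hfr₁ : Frame _ σ σ₁ := exchangeGraph_wf.frame σ
  have hn₁ : σ₁ 0 0 = n := by rw [hfr₁.ctr 0 rfl, hn]
  have hends := markEnds_spec (M := M) (F := F) hn₁
  set σ₂ := markEnds.den M F σ₁ with hσ₂
  have hfr₂ : Frame _ σ₁ σ₂ := markEnds_wf.frame σ₁
  have hden : enlarge.den M F σ = search.den M F σ₂ := rfl
  have e₀ : σ₁ rB₀ = σ rB₀ := hfr₁.row 9 rfl
  have e₁ : σ₁ rB₁ = σ rB₁ := hfr₁.row 10 rfl
  have hB₂ : pair n (σ₂ rB₀) (σ₂ rB₁) = B := by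
    rw [hfr₂.row 9 rfl, hfr₂.row 10 rfl, e₀, e₁, hB]
  obtain ⟨d, hd, -, h⟩ := search_spec (M := M) (F := F) hE (σ := σ₂)
    (by rw [hfr₂.ctr 0 rfl, hn₁]) hB₂ hB' (fun u w => by
      rw [hfr₂.row_of_ne (by omega) (by simp [markEnds, writes]; omega), hlab, hB])
  rw [← hden] at h
  have hsrc : ∀ s, s ∈ supp n (σ₂ rSrc) ↔ s ∉ B 0 ∧ s ∉ B 1 := fun s => by
    rw [(hends s).1, e₀, e₁, ← hB]; rfl
  have htgt : ∀ s, s ∈ supp n (σ₂ rTgt) ↔ s ∈ B 0 ∧ s ∈ B 1 := fun s => by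
    rw [(hends s).2, e₀, e₁, ← hB]; rfl
  rcases h with ⟨-, h₁, h₂, h₃⟩ | ⟨-, x, hx, y, -, -, L, -, cur, hcur, hw⟩
  · have hBB : B₁ = B := by
      rw [← hB₁, h₁, h₂, hB₂]
    subst hBB
    refine ⟨hB', Or.inl ⟨rfl, fun X Y hXY => ?_⟩⟩
    -- Here Z consists of the elements reachable from uncovered ones.
    refine rank_add_rank_le_of_closed hE hB' (Z := Finset.univ.filter fun s => d s ≤ n) ?_ ?_ ?_ hXY
    · intro m u w harc hu
      simp only [Finset.mem_filter, Finset.mem_univ, true_and] at hu ⊢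
      exact hd.step_le ⟨m, harc⟩ hu
    · intro s hs hs'
      simp [(hd.zero s).2 ((hsrc s).2 ⟨hs, hs'⟩)]
    · intro s hs hs₀ hs₁
      simp only [Finset.mem_filter, Finset.mem_univ, true_and] at hs
      rcases Nat.eq_zero_or_pos (d s) with h0 | h0
      · exact ((hsrc s).1 ((hd.zero s).1 h0)).1 hs₀
      · obtain ⟨y, hy, hys⟩ := hd.pred s (d s - 1) (by omega) (by omega)
        have := h₃ s ((htgt s).2 ⟨hs₀, hs₁⟩) y hys
        omega
  · rw [hB₁] at hw
    have hx' := (htgt x).1 hx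
    have hcur' := (hsrc cur).1 hcur
    refine ⟨hw.isBase, Or.inr (hw.card_union hx'.1 hx'.2 ?_)⟩
    simpa using hcur'

/-- Every round certifies optimality or adds an element to the union, so after n rounds the union is
optimal or has n elements; the latter is optimal too, since the welfare is at most n. -/
theorem cover_spec (hE : ∀ m, (M m).E = Set.univ) {σ : Store} (hn : σ 0 0 = n)
    (h₀ : ∀ j, σ rB₀ j = 0) (h₁ : ∀ j, σ rB₁ j = 0) {B : Fin 2 → Finset (Fin n)}
    (hB : pair n (cover.den M F σ rB₀) (cover.den M F σ rB₁) = B) :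
    (∀ m, (M m).IsBase (B m : Set (Fin n))) ∧ Covering M B := by
  have wf₁ : (greedy 0 rB₀).WellFormed := by decide
  have wf₂ : (greedy 1 rB₁).WellFormed := by decide
  have wf₃ : (loop 5 enlarge).WellFormed := by decide
  have g₀ := isBase_greedy (M := M) (F := F) (m := 0) (r := rB₀) (by simp) (by simp) hn h₀
  set σ₁ := (greedy 0 rB₀).den M F σ with hσ₁
  have hfr₁ : Frame _ σ σ₁ := wf₁.frame σ
  have hn₁ : σ₁ 0 0 = n := by rw [hfr₁.ctr 0 rfl, hn]
  have g₁ := isBase_greedy (M := M) (F := F) (m := 1) (r := rB₁) (by simp) (by simp) hn₁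
    (by rw [hfr₁.row 10 rfl]; exact h₁)
  set σ₂ := (greedy 1 rB₁).den M F σ₁ with hσ₂
  have hfr₂ : Frame _ σ₁ σ₂ := wf₂.frame σ₁
  have hn₂ : σ₂ 0 0 = n := by rw [hfr₂.ctr 0 rfl, hn₁]
  rw [← hfr₂.row 9 rfl] at g₀
  have key := loop_induction (M := M) (F := F) wf₃ (σ := σ₂) (fun i τ =>
    (∀ m, (M m).IsBase (pair n (τ rB₀) (τ rB₁) m : Set (Fin n))) ∧
    (Covering M (pair n (τ rB₀) (τ rB₁)) ∨ i ≤ (supp n (τ rB₀) ∪ supp n (τ rB₁)).card)) ?_ ?_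
  · have hden : cover.den M F σ = (loop 5 enlarge).den M F σ₂ := rfl
    rw [← hden, hn₂, hB] at key
    refine ⟨key.1, key.2.elim id fun hcard X Y hXY => ?_⟩
    have e₁ := rank_le_card (M 0) X
    have e₂ := rank_le_card (M 1) Y
    have e₃ := Finset.card_union_of_disjoint hXY
    have e₄ := Finset.card_le_univ (X ∪ Y)
    rw [Fintype.card_fin] at e₄
    rw [← hB]
    exact le_trans (by omega) hcard
  · refine ⟨fun m => ?_, Or.inr (Nat.zero_le _)⟩
    fin_cases m
    · simpa using g₀
    · simpa using g₁
  · intro i hi τ hf hx ⟨ih₁, ih₂⟩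
    simp only [Store.set_row_of_ne _ _ _ _ (show rB₀ ≠ 0 by simp),
      Store.set_row_of_ne _ _ _ _ (show rB₁ ≠ 0 by simp)]
    obtain ⟨k₁, k₂⟩ := enlarge_spec (M := M) (F := F) hE (σ := τ)
      (by rw [hf.ctr 0 rfl, hn₂]) rfl ih₁ rfl
    refine ⟨k₁, ?_⟩
    rcases k₂ with ⟨-, k₂⟩ | k₂
    · exact Or.inl k₂
    · simp only [pair_zero, pair_one] at k₂
      refine ih₂.imp (fun h X Y hXY => ?_) (fun h => by omega)
      have := h X Y hXY
      simp only [pair_zero, pair_one] at this ⊢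
      omega

end Cmd

end Cover

/-! ### Closed walks and the resulting potential -/

section Scan

open scoped Classical

variable {n : ℕ} {M : Fin 2 → Matroid (Fin n)} {F : Fin 2 → ExchangeProcedure n}

@[simp] theorem Expr.eval_eq (σ : Store) (a b : Expr) :
    (Expr.eq a b).eval σ = if a.eval σ = b.eval σ then 1 else 0 := rfl

namespace Cmd

/-- Make the vertex in counter `6` the only source and the only target. -/
def markVertex : Cmd :=
  loop 1 (set rSrc (.ctr 1) (.eq (.ctr 1) (.ctr 6)) ;; set rTgt (.ctr 1) (.eq (.ctr 1) (.ctr 6)))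

theorem markVertex_wf : markVertex.WellFormed := by decide

theorem markVertex_spec {σ : Store} (hn : σ 0 0 = n) {v : Fin n} (hv : σ 0 6 = v) :
    supp n (markVertex.den M F σ rSrc) = {v} ∧ supp n (markVertex.den M F σ rTgt) = {v} := by
  have key := loop_pointwise (M := M) (F := F) markVertex_wf (σ := σ)
    (fun r => r = rSrc ∨ r = rTgt) (by rintro r (rfl | rfl) <;> simp)
    (fun r i => if i = v then 1 else 0) ?_
  · constructor <;> ext s
    · have h := key rSrc (Or.inl rfl) s
      rw [if_pos (by rw [hn]; exact s.2)] at h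
      simp [mem_supp, markVertex, h, Fin.ext_iff]
    · have h := key rTgt (Or.inr rfl) s
      rw [if_pos (by rw [hn]; exact s.2)] at h
      simp [mem_supp, markVertex, h, Fin.ext_iff]
  · intro i hi τ hf hx _ r hr
    have e : τ 0 6 = v := by rw [hf.ctr 6 rfl, hv]
    rcases hr with rfl | rfl <;> simp [Store.set_row, hx, e]

/-- Count the vertices at finite distance. -/
def countReached : Cmd :=
  set rCount (.ctr 6) (.const 0) ;;
  loop 1 (ite (.lt (.cell rDist (.ctr 1)) (.add (.ctr 0) (.const 1)))
    (set rCount (.ctr 6) (.add (.cell rCount (.ctr 6)) (.const 1))) skip)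

theorem countReached_wf : countReached.WellFormed := by decide

theorem countReached_spec {σ : Store} (hn : σ 0 0 = n) :
    countReached.den M F σ rCount = Function.update (σ rCount) (σ 0 6)
      (Finset.univ.filter fun x : Fin n => σ rDist x ≤ n).card := by
  set τ := σ.set rCount (σ 0 6) 0 with hτ
  have hn' : τ 0 0 = n := by rw [hτ, Store.set_row_of_ne _ _ _ _ (by simp), hn]
  have hd : τ rDist = σ rDist := by rw [hτ, Store.set_row_of_ne _ _ _ _ (by simp)]
  have key := loop_induction (M := M) (F := F) countReached_wf.seq_right (σ := τ)
    (fun i ρ => ρ rCount = Function.update (σ rCount) (σ 0 6)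
      (Finset.univ.filter fun x : Fin n => (x : ℕ) < i ∧ σ rDist x ≤ n).card) ?_ ?_
  · rw [hn'] at key
    simp only [Fin.is_lt, true_and] at key
    exact key
  · simp [hτ, Store.set_row]
  · intro i hi ρ hf hx ih
    rw [hn'] at hi
    have e₁ : ρ rDist = σ rDist := by rw [hf.row 15 rfl, hd]
    have e₂ : ρ 0 0 = n := by rw [hf.ctr 0 rfl, hn']
    have e₃ : ρ 0 6 = σ 0 6 := by
      rw [hf.ctr 6 rfl, hτ, Store.set_row_of_ne _ _ _ _ (by simp)]
    rw [Store.set_row_of_ne _ _ _ _ (by simp)]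
    simp only [den_ite, den_set, den_skip, Store.ite_apply, Expr.holds_lt, Expr.eval_cell,
      Expr.eval_ctr, Expr.eval_add, Expr.eval_const, hx, e₁, e₂, e₃, Store.set_row, ih,
      Function.update_self, Function.update_idem]
    have hlt : σ rDist i < n + 1 ↔ σ rDist i ≤ n := by omega
    by_cases h : σ rDist i ≤ n
    · rw [if_pos (hlt.2 h)]
      congr 1
      rw [← Finset.card_insert_of_notMem (a := (⟨i, hi⟩ : Fin n)) (by simp)]
      congr 1
      ext x
      simp only [Finset.mem_insert, Finset.mem_filter, Finset.mem_univ, true_and, Fin.ext_iff,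
        Nat.lt_succ_iff_lt_or_eq]
      constructor
      · rintro (h' | h')
        · exact ⟨Or.inr h', by rwa [h']⟩
        · exact ⟨Or.inl h'.1, h'.2⟩
      · rintro ⟨h' | h', h''⟩
        · exact Or.inr ⟨h', h''⟩
        · exact Or.inl h'
    · rw [if_neg (fun h' => h (hlt.1 h'))]
      congr 2
      ext x
      simp only [Finset.mem_filter, Finset.mem_univ, true_and, Nat.lt_succ_iff_lt_or_eq]
      constructor
      · exact fun h' => ⟨Or.inl h'.1, h'.2⟩
      · rintro ⟨h' | h', h''⟩
        · exact ⟨h', h''⟩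
        · rw [h'] at h''
          exact absurd h'' h

/-- Search for a closed walk through the vertex in counter `6`. -/
def probe : Cmd := markVertex ;; search ;; countReached

/-- Search for a closed walk in the exchange graph and make the exchanges along it. -/
def scan : Cmd :=
  exchangeGraph ;; set rFound (.const 0) (.const 0) ;; loop 6 (ite (.not (.var rFound)) probe skip)

theorem scan_wf : scan.WellFormed := by decide

/-- The result of the exchanges along a closed walk. -/
structure Rotation (M : Fin 2 → Matroid (Fin n)) (B B' : Fin 2 → Finset (Fin n)) : Prop where
  isBase : ∀ m, (M m).IsBase (B' m : Set (Fin n))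
  mult_eq : ∀ s, mult B' s = mult B s
  moved : ∃ m x, x ∈ B m ∧ x ∉ B' m
  cyclic : ∃ v y d, IsDist (Adj M B) {v} d ∧ Adj M B y v ∧ d y < n

/-- Vertex `v` is on no closed walk, and `k` vertices can be reached from it. -/
def Acyclic (M : Fin 2 → Matroid (Fin n)) (B : Fin 2 → Finset (Fin n)) (v : Fin n) (k : ℕ) : Prop :=
  ∃ d, IsDist (Adj M B) {v} d ∧ (∀ y, Adj M B y v → n < d y) ∧
    k = (Finset.univ.filter fun x => d x ≤ n).card

/-- With v as the only source and only target, a shortest walk from source to target is a shortest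
closed walk through v. Its two ends cancel in the multiplicities. If there is none, the same
distances provide the count for v. -/
theorem probe_spec (hE : ∀ m, (M m).E = Set.univ) {σ : Store} (hn : σ 0 0 = n)
    {B : Fin 2 → Finset (Fin n)} (hB : pair n (σ rB₀) (σ rB₁) = B)
    (hB' : ∀ m, (M m).IsBase (B m : Set (Fin n)))
    (hmat : ∀ u w : Fin n, σ (100 + u) w = label M B u w) {v : Fin n} (hv : σ 0 6 = v) :
    (probe.den M F σ rFound 0 = 0 ∧ probe.den M F σ rB₀ = σ rB₀ ∧
      probe.den M F σ rB₁ = σ rB₁ ∧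
      ∃ k, Acyclic M B v k ∧ probe.den M F σ rCount = Function.update (σ rCount) v k) ∨
    (probe.den M F σ rFound 0 = 1 ∧
      Rotation M B (pair n (probe.den M F σ rB₀) (probe.den M F σ rB₁))) := by
  obtain ⟨hsrc, htgt⟩ := markVertex_spec (M := M) (F := F) hn hv
  set σ₁ := markVertex.den M F σ with hσ₁
  have hfr₁ : Frame _ σ σ₁ := markVertex_wf.frame σ
  have hn₁ : σ₁ 0 0 = n := by rw [hfr₁.ctr 0 rfl, hn]
  obtain ⟨d, hd, hd', h⟩ := search_spec (M := M) (F := F) hE (σ := σ₁) hn₁ (B := B)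
    (by rw [hfr₁.row 9 rfl, hfr₁.row 10 rfl, hB]) hB' (fun u w => by
      rw [hfr₁.row_of_ne (by omega) (by simp [markVertex, writes]; omega), hmat])
  set σ₂ := search.den M F σ₁ with hσ₂
  have hfr₂ : Frame _ σ₁ σ₂ := search_wf.frame σ₁
  have hfr₃ : Frame _ σ₂ (countReached.den M F σ₂) := countReached_wf.frame σ₂
  have hden : probe.den M F σ = countReached.den M F σ₂ := rfl
  have hcount := countReached_spec (M := M) (F := F) (σ := σ₂) (by rw [hfr₂.ctr 0 rfl, hn₁])
  rw [hfr₂.ctr 6 rfl, hfr₁.ctr 6 rfl, hv, hfr₂.row 16 rfl, hfr₁.row 16 rfl] at hcount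
  rw [hden, hfr₃.row 30 rfl, hfr₃.row 9 rfl, hfr₃.row 10 rfl, hcount]
  rw [hsrc] at hd
  simp only [hsrc, htgt, Finset.mem_singleton, forall_eq, exists_eq_left] at h
  rcases h with ⟨h₁, h₂, h₃, h₄⟩ | ⟨h₁, y, hy, hyn, L, hL, hw⟩
  · left
    refine ⟨h₁, by rw [h₂, hfr₁.row 9 rfl], by rw [h₃, hfr₁.row 10 rfl], _, ⟨d, hd, h₄, rfl⟩, ?_⟩
    simp only [hd']
  · right
    refine ⟨h₁, hw.isBase, fun s => by simpa using hw.mult_eq s, ?_, v, y, d, hd, hy, hyn⟩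
    -- The first alternative describes the start of the walk and would give L = 0.
    rcases hw.moved with ⟨h, -⟩ | ⟨m, h⟩
    · exact absurd h.symm hL
    · exact ⟨m, v, h⟩

theorem scan_spec (hE : ∀ m, (M m).E = Set.univ) {σ : Store} (hn : σ 0 0 = n)
    {B : Fin 2 → Finset (Fin n)} (hB : pair n (σ rB₀) (σ rB₁) = B)
    (hB' : ∀ m, (M m).IsBase (B m : Set (Fin n))) :
    (scan.den M F σ rFound 0 = 0 ∧ scan.den M F σ rB₀ = σ rB₀ ∧
      scan.den M F σ rB₁ = σ rB₁ ∧ ∀ v : Fin n, Acyclic M B v (scan.den M F σ rCount v)) ∨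
    (scan.den M F σ rFound 0 = 1 ∧
      Rotation M B (pair n (scan.den M F σ rB₀) (scan.den M F σ rB₁))) := by
  have hlab := exchangeGraph_spec (M := M) (F := F) hn
  set σ₁ := exchangeGraph.den M F σ with hσ₁
  have hfr₁ : Frame _ σ σ₁ := exchangeGraph_wf.frame σ
  set σ₂ := σ₁.set rFound 0 0 with hσ₂
  have hrow : ∀ r, r ≠ rFound → σ₂ r = σ₁ r := fun r h => by
    rw [hσ₂, Store.set_row_of_ne _ _ _ _ h]
  have hn₂ : σ₂ 0 0 = n := by rw [hrow 0 (by simp), hfr₁.ctr 0 rfl, hn]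
  have hf₂ : σ₂ rFound 0 = 0 := by simp [hσ₂, Store.set_apply]
  have b₀ : σ₂ rB₀ = σ rB₀ := by rw [hrow _ (by simp), hfr₁.row 9 rfl]
  have b₁ : σ₂ rB₁ = σ rB₁ := by rw [hrow _ (by simp), hfr₁.row 10 rfl]
  have key := loop_induction (M := M) (F := F) scan_wf.seq_right.seq_right (σ := σ₂) (fun i τ =>
    (τ rFound 0 = 0 ∧ τ rB₀ = σ rB₀ ∧ τ rB₁ = σ rB₁ ∧
      ∀ v : Fin n, (v : ℕ) < i → Acyclic M B v (τ rCount v)) ∨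
    (τ rFound 0 = 1 ∧ Rotation M B (pair n (τ rB₀) (τ rB₁)))) ?_ ?_
  · rw [hn₂] at key
    exact key.imp_left fun ⟨h₁, h₂, h₃, h₄⟩ => ⟨h₁, h₂, h₃, fun v => h₄ v v.2⟩
  · left
    simp [hf₂, b₀, b₁]
  · intro i hi τ hf hx ih
    rw [hn₂] at hi
    simp only [Store.set_row_of_ne _ _ _ _ (show rB₀ ≠ 0 by simp),
      Store.set_row_of_ne _ _ _ _ (show rB₁ ≠ 0 by simp),
      Store.set_row_of_ne _ _ _ _ (show rFound ≠ 0 by simp),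
      Store.set_row_of_ne _ _ _ _ (show rCount ≠ 0 by simp)]
    rcases ih with ⟨ih₁, ih₂, ih₃, ih₄⟩ | ih
    swap
    · right
      have : ¬ Expr.Holds τ (.not (.var rFound)) := by simp [ih.1]
      rw [den_ite, if_neg this, den_skip]
      exact ih
    have : Expr.Holds τ (.not (.var rFound)) := by simp [ih₁]
    rw [den_ite, if_pos this]
    refine (probe_spec (M := M) (F := F) hE (σ := τ) (by rw [hf.ctr 0 rfl, hn₂])
      (by rw [ih₂, ih₃, hB]) hB' (fun u w => ?_) (v := ⟨i, hi⟩) hx).imp_left ?_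
    · rw [hf.row_of_ne (by omega) ?_, hrow _ (by omega), hlab, hB]
      simp [probe, markVertex, search, countReached, distances, relaxLevel, relaxVertex, augment,
        findTarget, walk, findPred, exchangeArc, writes]
      omega
    · rintro ⟨h₁, h₂, h₃, k, h₄, h₅⟩
      refine ⟨h₁, by rw [h₂, ih₂], by rw [h₃, ih₃], fun v hv => ?_⟩
      rw [h₅, Function.update_apply]
      split_ifs with hvi
      · rw [show v = ⟨i, hi⟩ from Fin.ext hvi]
        exact h₄
      · refine ih₄ v ?_
        have : (v : ℕ) ≠ i := hvi
        omega

/-- The numbers decrease along the arcs of the exchange graph. -/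
structure Potential (M : Fin 2 → Matroid (Fin n)) (B : Fin 2 → Finset (Fin n))
    (k : Fin n → ℕ) : Prop where
  lt : ∀ u w, Adj M B u w → k w < k u
  pos : ∀ v, 0 < k v
  le : ∀ v, k v ≤ n

/-- Each count is at least 1, as v reaches itself, and at most n, so dividing by n + 1 gives prices
strictly between 0 and 1. -/
theorem potential_of_acyclic {B : Fin 2 → Finset (Fin n)} {k : Fin n → ℕ}
    (h : ∀ v, Acyclic M B v (k v)) : Potential M B k := by
  choose d hd hcyc hk using h
  refine ⟨fun u w huw => ?_, fun v => ?_, fun v => ?_⟩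
  · rw [hk, hk]
    exact card_reachable_lt hd hcyc huw
  · rw [hk, Finset.card_pos]
    exact ⟨v, by simp [((hd v).zero v).2 (by simp)]⟩
  · rw [hk]
    exact (Finset.card_le_univ _).trans (by simp)

/-- Ensures that the refinement stops for good once the exchange graph is acyclic. -/
theorem Potential.not_rotation {B B' : Fin 2 → Finset (Fin n)} {k : Fin n → ℕ}
    (h : Potential M B k) : ¬ Rotation M B B' := by
  intro h'
  obtain ⟨v, y, d, hd, hy, hn⟩ := h'.cyclic
  have := lt_dist_of_potential hd h.lt hy
  omega

end Cmd

end Scan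

/-! ### Two-colouring the union of two perfect matchings -/

section Colouring

variable {n : ℕ}

/-- A perfect matching of the elements of `V`. -/
def IsMatching (V : Fin n → Prop) (φ : Fin n → Fin n) : Prop :=
  ∀ x, V x → V (φ x) ∧ φ (φ x) = x ∧ φ x ≠ x

/-- In a partial colouring with the colours `1` and `2`, partners of coloured elements have the
other colour. -/
structure Colours (V : Fin n → Prop) (φ : Fin n → Fin n) (c : Fin n → ℕ) : Prop where
  one : ∀ x, V x → c x = 1 → c (φ x) = 2
  two : ∀ x, V x → c x = 2 → c (φ x) = 1

/-- The situation when an alternating cycle has been coloured from `v` to `u`. -/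
structure ColourWalk (V : Fin n → Prop) (φ γ : Fin n → Fin n) (v : Fin n) (c : Fin n → ℕ)
    (u : Fin n) : Prop where
  mem : V u
  le : ∀ x, V x → c x ≤ 2
  colours : Colours V φ c
  two : ∀ x, V x → c x = 2 → c (γ x) = 1 ∨ (γ x = u ∧ c u = 0)
  one : ∀ x, V x → c x = 1 → c (γ x) = 2 ∨ x = v
  last : c (γ u) = 2 ∨ (u = v ∧ c v = 0)
  closed : c u ≠ 0 → u = v

variable {V : Fin n → Prop} {φ γ : Fin n → Fin n} {v u : Fin n} {c : Fin n → ℕ}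

theorem ColourWalk.init (hv : V v) (h0 : c v = 0) (hle : ∀ x, V x → c x ≤ 2)
    (hφ : Colours V φ c) (hγ : Colours V γ c) : ColourWalk V φ γ v c v :=
  ⟨hv, hle, hφ, fun x hx h => Or.inl (hγ.two x hx h), fun x hx h => Or.inl (hγ.one x hx h),
    Or.inr ⟨rfl, h0⟩, fun _ => rfl⟩

/-- Give u colour 1 and its φ-partner w colour 2, then move on to the γ-partner u' of w. The crux is
that u' does not have colour 2 already. If u' is uncoloured, the walk continues; if it has colour 1,
it must be v, and the alternating cycle has closed consistently. -/
theorem ColourWalk.step (hφ : IsMatching V φ) (hγ : IsMatching V γ)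
    (h : ColourWalk V φ γ v c u) (h0 : c u = 0) :
    ColourWalk V φ γ v (Function.update (Function.update c u 1) (φ u) 2) (γ (φ u)) := by
  obtain ⟨hwV, hφw, hwu⟩ := hφ u h.mem
  set w := φ u with hw
  obtain ⟨huV', hγw, huw'⟩ := hγ w hwV
  set u' := γ w with hu'
  -- Partners under φ are coloured simultaneously.
  have hw0 : c w = 0 := by
    have h₁ := h.le w hwV
    have h₂ := h.colours.one w hwV
    have h₃ := h.colours.two w hwV
    rw [hφw] at h₂ h₃
    omega
  set c' := Function.update (Function.update c u 1) w 2 with hc'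
  have cu : c' u = 1 := by rw [hc', Function.update_of_ne hwu.symm, Function.update_self]
  have cw : c' w = 2 := by rw [hc', Function.update_self]
  have co : ∀ x, x ≠ u → x ≠ w → c' x = c x := fun x h₁ h₂ => by
    rw [hc', Function.update_of_ne h₂, Function.update_of_ne h₁]
  have co' : ∀ x, c x ≠ 0 → c' x = c x := fun x hx =>
    co x (by rintro rfl; exact hx h0) (by rintro rfl; exact hx hw0)
  -- If u' had colour 2, its γ-partner w would have colour 1 or be u, but w is uncoloured and
  -- different from u.
  have hu'2 : c u' ≠ 2 := by
    intro h₂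
    rcases h.two u' huV' h₂ with h₃ | h₃
    · rw [hγw] at h₃; omega
    · rw [hγw] at h₃; exact hwu h₃.1
  refine ⟨huV', fun x hx => ?_, ⟨fun x hx h₁ => ?_, fun x hx h₁ => ?_⟩, fun x hx h₁ => ?_,
    fun x hx h₁ => ?_, Or.inl (by rw [hγw, cw]), fun h₁ => ?_⟩
  · by_cases hxu : x = u
    · rw [hxu, cu]; omega
    by_cases hxw : x = w
    · rw [hxw, cw]
    · rw [co x hxu hxw]; exact h.le x hx
  · by_cases hxu : x = u
    · rw [hxu, ← hw, cw]
    by_cases hxw : x = w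
    · rw [hxw, cw] at h₁; omega
    · rw [co x hxu hxw] at h₁
      have h₂ := h.colours.one x hx h₁
      rw [co' _ (by omega), h₂]
  · by_cases hxu : x = u
    · rw [hxu, cu] at h₁; omega
    by_cases hxw : x = w
    · rw [hxw, hφw, cu]
    · rw [co x hxu hxw] at h₁
      have h₂ := h.colours.two x hx h₁
      rw [co' _ (by omega), h₂]
  · by_cases hxw : x = w
    · rw [hxw, ← hu']
      by_cases huu : u' = u
      · rw [huu, cu]; exact Or.inl rfl
      · rw [co u' huu huw']
        have := h.le u' huV'
        by_cases h1 : c u' = 1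
        · exact Or.inl h1
        · exact Or.inr ⟨rfl, by omega⟩
    by_cases hxu : x = u
    · rw [hxu, cu] at h₁; omega
    rw [co x hxu hxw] at h₁
    rcases h.two x hx h₁ with h₂ | h₂
    · rw [co' _ (by omega), h₂]; exact Or.inl rfl
    · rw [h₂.1, cu]; exact Or.inl rfl
  · by_cases hxu : x = u
    · rw [hxu]
      rcases h.last with h₂ | h₂
      · rw [co' _ (by omega), h₂]; exact Or.inl rfl
      · exact Or.inr h₂.1
    by_cases hxw : x = w
    · rw [hxw, cw] at h₁; omega
    rw [co x hxu hxw] at h₁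
    rcases h.one x hx h₁ with h₂ | h₂
    · rw [co' _ (by omega), h₂]; exact Or.inl rfl
    · exact Or.inr h₂
  · by_cases huu : u' = u
    · rw [huu]
      rcases h.last with h₂ | h₂
      · rw [← huu, hγw] at h₂; omega
      · exact h₂.1
    · rw [co u' huu huw'] at h₁
      have := h.le u' huV'
      rcases h.one u' huV' (by omega) with h₂ | h₂
      · rw [hγw] at h₂; omega
      · exact h₂

/-- A coloured current vertex means that the cycle is closed at v, where the exceptions permitted in
`one` and `two` disappear. -/
theorem ColourWalk.colours_of_ne_zero (h : ColourWalk V φ γ v c u)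
    (h0 : c u ≠ 0) : c v ≠ 0 ∧ Colours V γ c := by
  have huv := h.closed h0
  subst huv
  refine ⟨h0, ⟨fun x hx h₁ => ?_, fun x hx h₁ => ?_⟩⟩
  · rcases h.one x hx h₁ with h₂ | h₂
    · exact h₂
    · subst h₂
      exact h.last.resolve_right fun h₃ => h0 h₃.2
  · exact (h.two x hx h₁).resolve_right fun h₃ => h0 h₃.2

open scoped Classical

variable {M : Fin 2 → Matroid (Fin n)} {F : Fin 2 → ExchangeProcedure n}

/-- The item number `x` lies in exactly one of the sets in the rows `rB₀` and `rC₀`. -/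
def Differ (σ : Store) (x : ℕ) : Prop := ¬ (σ rB₀ x = 0 ↔ σ rC₀ x = 0)

/-- The expression that checks `Differ`. -/
def Expr.differ (e : Expr) : Expr := .not (.eq (.not (.cell rB₀ e)) (.not (.cell rC₀ e)))

@[simp] theorem Expr.holds_differ (σ : Store) (e : Expr) :
    e.differ.Holds σ ↔ Differ σ (e.eval σ) := by
  simp only [Expr.differ, Expr.holds_not, Expr.holds_eq, Expr.eval_not, Expr.eval_cell, Differ]
  by_cases a : σ rB₀ (e.eval σ) = 0 <;> by_cases b : σ rC₀ (e.eval σ) = 0 <;> simp [a, b]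

namespace Cmd

/-- Colour the current vertex and its partner, and go on. -/
def colourStep : Cmd :=
  ite (.and (.differ (.var rCur)) (.not (.cell rColour (.var rCur))))
    (set rColour (.var rCur) (.const 1) ;;
      set rColour (.cell rMate₀ (.var rCur)) (.const 2) ;;
      set rCur (.const 0) (.cell rMate₁ (.cell rMate₀ (.var rCur)))) skip

/-- Colour the alternating cycle through the vertex in counter `1`. -/
def colourCycle : Cmd := set rCur (.const 0) (.ctr 1) ;; loop 2 colourStep

/-- Colour all alternating cycles. -/
def colour : Cmd := loop 1 (set rColour (.ctr 1) (.const 0)) ;; loop 1 colourCycle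

theorem colourCycle_wf : colourCycle.WellFormed := by decide
theorem colour_wf : colour.WellFormed := by decide

theorem colourStep_of_not {σ : Store} (h : ¬ (Differ σ (σ rCur 0) ∧ σ rColour (σ rCur 0) = 0)) :
    colourStep.den M F σ = σ := by
  rw [colourStep, den_ite, if_neg, den_skip]
  simpa using h

theorem colourStep_of_pos {σ : Store} (h : Differ σ (σ rCur 0)) (h' : σ rColour (σ rCur 0) = 0) :
    colourStep.den M F σ rColour = Function.update (Function.update (σ rColour) (σ rCur 0) 1)
        (σ rMate₀ (σ rCur 0)) 2 ∧
      colourStep.den M F σ rCur 0 = σ rMate₁ (σ rMate₀ (σ rCur 0)) := by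
  rw [colourStep, den_ite, if_pos (by simp [h, h'])]
  simp [Store.set_row]

/-- The colours in row `rColour`. -/
def colours (n : ℕ) (σ : Store) (s : Fin n) : ℕ := σ rColour s

theorem update_colours (ρ : ℕ → ℕ) (s : Fin n) (k : ℕ) :
    (fun t : Fin n => Function.update ρ s k t) = Function.update (fun t : Fin n => ρ t) s k := by
  funext t
  simp [Function.update_apply, Fin.val_inj]

theorem colourCycle_spec {σ : Store} (hn : σ 0 0 = n) {v : Fin n} (hv : σ 0 1 = v)
    {φ γ : Fin n → Fin n} (hφ : IsMatching (fun s => Differ σ s) φ)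
    (hγ : IsMatching (fun s => Differ σ s) γ)
    (hφ' : ∀ s : Fin n, Differ σ s → σ rMate₀ s = φ s)
    (hγ' : ∀ s : Fin n, Differ σ s → σ rMate₁ s = γ s)
    (hle : ∀ s : Fin n, Differ σ s → colours n σ s ≤ 2)
    (hcφ : Colours (fun s => Differ σ s) φ (colours n σ))
    (hcγ : Colours (fun s => Differ σ s) γ (colours n σ))
    {c : Fin n → ℕ} (hc : colours n (colourCycle.den M F σ) = c) :
    (∀ s : Fin n, Differ σ s → c s ≤ 2) ∧ Colours (fun s => Differ σ s) φ c ∧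
      Colours (fun s => Differ σ s) γ c ∧ (∀ s, colours n σ s ≠ 0 → c s ≠ 0) ∧
      (Differ σ v → c v ≠ 0) := by
  set τ := σ.set rCur 0 v with hτ
  have hrow : ∀ r, r ≠ rCur → τ r = σ r := fun r h => by rw [hτ, Store.set_row_of_ne _ _ _ _ h]
  have hcur : τ rCur 0 = v := by simp [hτ, Store.set_apply]
  have hden : colourCycle.den M F σ = (loop 2 colourStep).den M F τ := by
    simp only [colourCycle, den_seq, den_set, Expr.eval_const, Expr.eval_ctr, hv, ← hτ]
  have hn' : τ 0 0 = n := by rw [hrow _ (by simp), hn]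
  have hwf := colourCycle_wf.seq_right
  have hdiff : ∀ ρ, Frame (loop 2 colourStep) τ ρ → ∀ x, Differ ρ x ↔ Differ σ x := by
    intro ρ hf x
    rw [Differ, Differ, hf.row 9 rfl, hf.row 11 rfl, hrow _ (by simp), hrow _ (by simp)]
  by_cases hstart : Differ σ v ∧ colours n σ v = 0
  · have key := loop_induction (M := M) (F := F) hwf (σ := τ) (fun i ρ => ∃ u : Fin n,
      ρ rCur 0 = u ∧ ColourWalk (fun s => Differ σ s) φ γ v (colours n ρ) u ∧
      (∀ s, colours n σ s ≠ 0 → colours n ρ s ≠ 0) ∧ (colours n ρ u ≠ 0 ∨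
        i ≤ (Finset.univ.filter fun s => colours n ρ s ≠ 0).card)) ?_ ?_
    · obtain ⟨u, -, h₁, h₂, h₃⟩ := key
      rw [← hden, hc] at h₁ h₂ h₃
      -- Each round before the closing colours a new element, so n such rounds would colour
      -- everything, including u.
      have hu : c u ≠ 0 := by
        refine h₃.elim id fun h₄ => ?_
        have := Finset.eq_univ_of_card (Finset.univ.filter fun s => c s ≠ 0)
          (le_antisymm (Finset.card_le_univ _) (by rw [Fintype.card_fin]; exact hn'.ge.trans h₄))
        have hu := Finset.mem_univ u
        rw [← this] at hu
        simpa using hu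
      obtain ⟨h₅, h₆⟩ := h₁.colours_of_ne_zero hu
      exact ⟨h₁.le, h₁.colours, h₆, h₂, fun _ => h₅⟩
    · have : colours n (τ.set 0 2 0) = colours n σ := by
        funext s
        simp only [colours]
        rw [Store.set_row_of_ne _ _ _ _ (by simp), hrow _ (by simp)]
      rw [this]
      refine ⟨v, ?_, .init hstart.1 hstart.2 hle hcφ hcγ, fun _ h => h, by simp⟩
      rw [Store.set_row_of_ne _ _ _ _ (by simp), hcur]
    · intro i hi ρ hf hx ⟨u, h₁, h₂, h₃, h₄⟩
      have hcol : ∀ θ : Store, colours n (θ.set 0 2 (i + 1)) = colours n θ := fun θ => by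
        funext s
        simp only [colours]
        rw [Store.set_row_of_ne _ _ _ _ (by simp)]
      simp only [hcol, Store.set_row_of_ne _ _ _ _ (show rCur ≠ 0 by simp)]
      by_cases h0 : colours n ρ u = 0
      · have hu : Differ σ u := h₂.mem
        obtain ⟨e₁, e₂⟩ := colourStep_of_pos (M := M) (F := F) (σ := ρ)
          (by rw [h₁, hdiff ρ hf]; exact hu) (by rw [h₁]; exact h0)
        have eφ : ρ rMate₀ u = φ u := by rw [hf.row 21 rfl, hrow _ (by simp), hφ' u hu]
        have eγ : ρ rMate₁ (φ u) = γ (φ u) := by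
          rw [hf.row 22 rfl, hrow _ (by simp), hγ' (φ u) (hφ u hu).1]
        rw [h₁, eφ] at e₁
        rw [h₁, eφ, eγ] at e₂
        have e₃ : colours n (colourStep.den M F ρ)
            = Function.update (Function.update (colours n ρ) u 1) (φ u) 2 := by
          unfold colours
          rw [← update_colours, ← update_colours, e₁]
        have hmono : ∀ s, colours n ρ s ≠ 0 →
            Function.update (Function.update (colours n ρ) u 1) (φ u) 2 s ≠ 0 := by
          intro s hs
          simp only [Function.update_apply]
          split_ifs <;> simp [hs]
        rw [e₃]
        refine ⟨γ (φ u), e₂, h₂.step hφ hγ h0, fun s hs => hmono s (h₃ s hs), Or.inr ?_⟩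
        have h₅ := h₄.resolve_left (not_not.2 h0)
        refine Nat.lt_of_le_of_lt h₅ (Finset.card_lt_card ?_)
        refine Finset.ssubset_iff_of_subset (fun s hs => ?_) |>.2 ⟨u, ?_, ?_⟩
        · simp only [Finset.mem_filter, Finset.mem_univ, true_and] at hs ⊢
          exact hmono s hs
        · simp only [Finset.mem_filter, Finset.mem_univ, true_and, Function.update_apply]
          split_ifs <;> simp
        · simp [h0]
      · rw [colourStep_of_not (by rw [h₁]; exact fun h => h0 h.2)]
        exact ⟨u, h₁, h₂, h₃, Or.inl h0⟩
  · have key := loop_induction (M := M) (F := F) hwf (σ := τ) (fun i ρ =>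
      ρ rCur 0 = v ∧ ρ rColour = σ rColour) ?_ ?_
    · have hcσ : c = colours n σ := by
        rw [← hc]
        funext s
        rw [hden, colours, colours, key.2]
      rw [hcσ]
      exact ⟨hle, hcφ, hcγ, fun _ h => h, fun h h' => hstart ⟨h, h'⟩⟩
    · rw [Store.set_row_of_ne _ _ _ _ (by simp), Store.set_row_of_ne _ _ _ _ (by simp), hcur,
        hrow _ (by simp)]
      exact ⟨rfl, rfl⟩
    · intro i hi ρ hf hx ⟨h₁, h₂⟩
      rw [colourStep_of_not (by rw [h₁, hdiff ρ hf, h₂]; exact hstart),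
        Store.set_row_of_ne _ _ _ _ (by simp), Store.set_row_of_ne _ _ _ _ (by simp)]
      exact ⟨h₁, h₂⟩

theorem colour_spec {σ : Store} (hn : σ 0 0 = n)
    {φ γ : Fin n → Fin n} (hφ : IsMatching (fun s => Differ σ s) φ)
    (hγ : IsMatching (fun s => Differ σ s) γ)
    (hφ' : ∀ s : Fin n, Differ σ s → σ rMate₀ s = φ s)
    (hγ' : ∀ s : Fin n, Differ σ s → σ rMate₁ s = γ s)
    {c : Fin n → ℕ} (hc : colours n (colour.den M F σ) = c) (s : Fin n) (hs : Differ σ s) :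
    (c s = 1 ∨ c s = 2) ∧ c (φ s) ≠ c s ∧ c (γ s) ≠ c s := by
  have hwf₁ := colour_wf.seq_left
  have h₁ := loop_fill (M := M) (F := F) hwf₁ (σ := σ) (r := rColour) (by simp) (fun _ => 0) (by
    intro i hi τ hf hx _
    simp [Store.set_row, hx])
  set τ := (loop 1 (set rColour (.ctr 1) (.const 0))).den M F σ with hτ
  have hfr : Frame _ σ τ := hwf₁.frame σ
  have hn' : τ 0 0 = n := by rw [hfr.ctr 0 rfl, hn]
  have hcτ : colours n τ = fun _ => 0 := by
    funext s
    exact h₁ s (by rw [hn]; exact s.2)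
  have key := loop_induction (M := M) (F := F) colour_wf.seq_right (σ := τ) (fun i ρ =>
    (∀ s : Fin n, Differ σ s → colours n ρ s ≤ 2) ∧
    Colours (fun s => Differ σ s) φ (colours n ρ) ∧
    Colours (fun s => Differ σ s) γ (colours n ρ) ∧
    (∀ s : Fin n, (s : ℕ) < i → Differ σ s → colours n ρ s ≠ 0)) ?_ ?_
  · have hden : colour.den M F σ = (loop 1 colourCycle).den M F τ := rfl
    rw [← hden, hc, hn'] at key
    obtain ⟨k₁, k₂, k₃, k₄⟩ := key
    have a₁ := k₁ s hs
    have a₂ := k₄ s s.2 hs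
    have a₃ : c s = 1 ∨ c s = 2 := by omega
    refine ⟨a₃, ?_⟩
    rcases a₃ with a₃ | a₃
    · rw [k₂.one s hs a₃, k₃.one s hs a₃, a₃]; simp
    · rw [k₂.two s hs a₃, k₃.two s hs a₃, a₃]; simp
  · have : colours n (τ.set 0 1 0) = fun _ => 0 := by
      rw [← hcτ]
      funext s
      simp only [colours]
      rw [Store.set_row_of_ne _ _ _ _ (by simp)]
    rw [this]
    exact ⟨by simp, ⟨by simp, by simp⟩, ⟨by simp, by simp⟩, by simp⟩
  · intro i hi ρ hf hx ⟨k₁, k₂, k₃, k₄⟩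
    rw [hn'] at hi
    have hcol : ∀ θ : Store, colours n (θ.set 0 1 (i + 1)) = colours n θ := fun θ => by
      funext s
      simp only [colours]
      rw [Store.set_row_of_ne _ _ _ _ (by simp)]
    rw [hcol]
    have hdiff : Differ ρ = Differ σ := by
      funext x
      rw [Differ, Differ, hf.row 9 rfl, hf.row 11 rfl, hfr.row 9 rfl, hfr.row 11 rfl]
    obtain ⟨l₁, l₂, l₃, l₄, l₅⟩ := colourCycle_spec (M := M) (F := F) (σ := ρ)
      (v := ⟨i, hi⟩) (φ := φ) (γ := γ) (by rw [hf.ctr 0 rfl, hn']) hx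
      (by rwa [hdiff]) (by rwa [hdiff])
      (fun s hs => by rw [hf.row 21 rfl, hfr.row 21 rfl]; exact hφ' s (by rwa [hdiff] at hs))
      (fun s hs => by rw [hf.row 22 rfl, hfr.row 22 rfl]; exact hγ' s (by rwa [hdiff] at hs))
      (by rwa [hdiff]) (by rwa [hdiff]) (by rwa [hdiff]) rfl
    rw [hdiff] at l₁ l₂ l₃ l₅
    refine ⟨l₁, l₂, l₃, fun s hs hs' => ?_⟩
    rcases Nat.lt_succ_iff_lt_or_eq.1 hs with h | h
    · exact l₄ s (k₄ s h hs')
    · rw [show s = ⟨i, hi⟩ from Fin.ext h]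
      refine l₅ ?_
      have := hs'
      rw [h] at this
      exact this

end Cmd

end Colouring

/-! ### Recombining bases by means of the exchange procedures -/

section Refine

open scoped Classical

variable {n : ℕ} {M : Fin 2 → Matroid (Fin n)} {F : Fin 2 → ExchangeProcedure n}

namespace Cmd

/-- Tabulate, in row `o`, the matching formed by the pairs of elements that correspond to each
other under the bijection in row `r'`, which is defined on the set in row `r`. -/
def mate (r r' o : ℕ) : Cmd :=
  loop 1 (ite (.cell r (.ctr 1))
    (set o (.ctr 1) (.cell r' (.ctr 1)) ;; set o (.cell r' (.ctr 1)) (.ctr 1)) skip)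

/-- The pairs of an element and its image are disjoint from one another, and common elements are
paired with themselves, so no round spoils the entries of another pair. -/
theorem mate_spec {r r' o : ℕ} (hr : r ≠ 0) (hr' : r' ≠ 0) (ho : o ≠ 0) (hro : r ≠ o)
    (hro' : r' ≠ o) {σ : Store} (hn : σ 0 0 = n) {f : Fin n → Fin n}
    (hσ : ∀ s : Fin n, σ r' s = f s) {N : Matroid (Fin n)} {B C : Finset (Fin n)}
    (hB : supp n (σ r) = B) (hf : IsExchangeBijection N (B : Set (Fin n)) (C : Set (Fin n)) f) :
    ∀ s ∈ B, s ∉ C → (mate r r' o).den M F σ o s = f s ∧ (mate r r' o).den M F σ o (f s) = s := by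
  have hwf : (mate r r' o).WellFormed := by
    simp [WellFormed, writes, nested, uses, mate, ho.symm]
  have key := loop_induction (M := M) (F := F) hwf (σ := σ) (fun i τ => ∀ s ∈ B, s ∉ C →
    (s : ℕ) < i → τ o s = f s ∧ τ o (f s) = s) (by simp) ?_
  · exact fun s hs hs' => key s hs hs' (by rw [hn]; exact s.2)
  intro i hi τ hfr hx ih s hs hs' hsi
  rw [hn] at hi
  have e₁ : τ r = σ r := hfr.row_of_ne hr (by simp [writes, hro])
  have e₂ : τ r' = σ r' := hfr.row_of_ne hr' (by simp [writes, hro'])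
  have hfs : f s ∈ C := hf.1.mapsTo hs
  have hfs' : f s ∉ B := hf.apply_notMem (by simpa using hs) (by simpa using hs')
  set t : Fin n := ⟨i, hi⟩ with ht
  have htB : σ r i ≠ 0 ↔ t ∈ B := by rw [← hB, mem_supp]
  have hti : σ r' i = f t := hσ t
  rw [Store.set_row_of_ne _ _ _ _ ho]
  by_cases htm : t ∈ B
  · have hden : den M F (ite (.cell r (.ctr 1)) (set o (.ctr 1) (.cell r' (.ctr 1)) ;;
        set o (.cell r' (.ctr 1)) (.ctr 1)) skip) τ o
        = Function.update (Function.update (τ o) t (f t)) (f t) t := by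
      rw [den_ite, if_pos (by rw [Expr.holds_cell, Expr.eval_ctr, hx, e₁, htB]; exact htm)]
      simp only [den_seq, den_set, Expr.eval_ctr, Expr.eval_cell,
        Store.set_row_of_ne _ _ _ _ hro', Store.set_row_of_ne _ _ _ _ ho.symm, hx, e₂, hti,
        Store.set_row]
      rfl
    rw [hden]
    by_cases hst : s = t
    · rw [hst, Function.update_self]
      have : (t : ℕ) ≠ f t := fun h => by
        rw [← hst] at h
        exact hfs' (Fin.ext h ▸ hs)
      rw [Function.update_of_ne this, Function.update_self]
      exact ⟨rfl, rfl⟩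
    · have hlt : (s : ℕ) < i := by
        have : (s : ℕ) ≠ i := fun h => hst (Fin.ext h)
        omega
      have hinj : f s ≠ f t := fun h => hst (hf.1.injOn hs htm h)
      have hft : f t ∈ C := hf.1.mapsTo htm
      have hst' : s ≠ f t := fun h => hs' (h ▸ hft)
      have hfst : f s ≠ t := fun h => hfs' (h ▸ htm)
      rw [Function.update_of_ne (by rwa [Ne, Fin.val_inj]),
        Function.update_of_ne (by rwa [Ne, Fin.val_inj]),
        Function.update_of_ne (by rwa [Ne, Fin.val_inj]),
        Function.update_of_ne (by rwa [Ne, Fin.val_inj])]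
      exact ih s hs hs' hlt
  · rw [den_ite, if_neg (by rw [Expr.holds_cell, Expr.eval_ctr, hx, e₁, htB]; exact htm), den_skip]
    have hlt : (s : ℕ) < i := by
      have : (s : ℕ) ≠ i := fun h => htm (by rwa [← show s = t from Fin.ext h])
      omega
    exact ih s hs hs' hlt

/-- Translates the table into a fixed-point-free involution on the symmetric difference, the form
required by the colouring. Elsewhere φ is not constrained. -/
theorem exists_matching {N : Matroid (Fin n)} {B C : Finset (Fin n)} {f : Fin n → Fin n}
    (hf : IsExchangeBijection N (B : Set (Fin n)) (C : Set (Fin n)) f) {ρ : ℕ → ℕ}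
    (hρ : ∀ s ∈ B, s ∉ C → ρ s = f s ∧ ρ (f s) = s) :
    ∃ φ : Fin n → Fin n, IsMatching (fun s => ¬ (s ∈ B ↔ s ∈ C)) φ ∧
      (∀ s, ¬ (s ∈ B ↔ s ∈ C) → ρ s = φ s) ∧ ∀ s ∈ B, s ∉ C → φ s = f s := by
  have hex : ∀ s, ∃ w : Fin n, (¬ (s ∈ B ↔ s ∈ C) →
      ρ s = w ∧ ¬ (w ∈ B ↔ w ∈ C) ∧ ρ w = s ∧ w ≠ s) ∧ (s ∈ B → s ∉ C → w = f s) := by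
    intro s
    by_cases hs : s ∈ B <;> by_cases hs' : s ∈ C
    · exact ⟨s, fun h => absurd (by simp [hs, hs']) h, fun _ h => absurd hs' h⟩
    · obtain ⟨h₁, h₂⟩ := hρ s hs hs'
      have h₃ : f s ∈ C := hf.1.mapsTo hs
      have h₄ : f s ∉ B := hf.apply_notMem (by simpa using hs) (by simpa using hs')
      exact ⟨f s, fun _ => ⟨h₁, by tauto, h₂, fun h => h₄ (by rwa [h])⟩, fun _ _ => rfl⟩
    · obtain ⟨t, ht, rfl⟩ := hf.1.surjOn (show s ∈ (C : Set (Fin n)) from hs')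
      have ht' : t ∉ C := fun h => hs (by
        rw [hf.apply_eq_self (by simpa using ht) (by simpa using h)]
        exact ht)
      obtain ⟨h₁, h₂⟩ := hρ t ht ht'
      have ht : t ∈ B := ht
      exact ⟨t, fun _ => ⟨h₂, by tauto, h₁, fun h => ht' (by rwa [h])⟩, fun h => absurd h hs⟩
    · exact ⟨s, fun h => absurd (by simp [hs, hs']) h, fun h => absurd h hs⟩
  choose φ h₁ h₂ using hex
  refine ⟨φ, fun x hx => ?_, fun s hs => (h₁ s hs).1, h₂⟩
  obtain ⟨a₁, a₂, a₃, a₄⟩ := h₁ x hx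
  refine ⟨a₂, Fin.ext ?_, a₄⟩
  rw [← (h₁ _ a₂).1, a₃]

/-- Recombine the two pairs of bases along the colouring. -/
def recombine : Cmd :=
  loop 1 (ite (.differ (.ctr 1))
    (set rB₀ (.ctr 1) (.eq (.cell rColour (.ctr 1)) (.const 1)) ;;
      set rB₁ (.ctr 1) (.eq (.cell rColour (.ctr 1)) (.const 1)) ;;
      set rC₀ (.ctr 1) (.eq (.cell rColour (.ctr 1)) (.const 2)) ;;
      set rC₁ (.ctr 1) (.eq (.cell rColour (.ctr 1)) (.const 2))) skip)

theorem recombine_wf : recombine.WellFormed := by decide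

theorem recombine_spec {σ : Store} (hn : σ 0 0 = n) {r k : ℕ}
    (hr : (r = rB₀ ∨ r = rB₁) ∧ k = 1 ∨ (r = rC₀ ∨ r = rC₁) ∧ k = 2) (s : Fin n) :
    s ∈ supp n (recombine.den M F σ r) ↔
      if Differ σ s then σ rColour s = k else s ∈ supp n (σ r) := by
  have key := loop_pointwise (M := M) (F := F) recombine_wf (σ := σ)
    (fun r => (r = rB₀ ∨ r = rB₁) ∨ (r = rC₀ ∨ r = rC₁))
    (by rintro r ((rfl | rfl) | (rfl | rfl)) <;> simp)
    (fun r i => if Differ σ i then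
      (if σ rColour i = (if r = rB₀ ∨ r = rB₁ then 1 else 2) then 1 else 0) else σ r i) ?_ r
      (by tauto) s
  · rw [if_pos (by rw [hn]; exact s.2)] at key
    rw [mem_supp, recombine, key]
    have hk : (if r = rB₀ ∨ r = rB₁ then 1 else 2) = k := by
      rcases hr with ⟨rfl | rfl, rfl⟩ | ⟨rfl | rfl, rfl⟩ <;> simp
    rw [hk]
    split_ifs <;> simp_all
  · intro i hi τ hf hx hτ r hr
    have e : τ rColour = σ rColour := hf.row 23 rfl
    -- The rows entering the test are being overwritten, but column i is still untouched in round i.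
    have hd : Differ τ i ↔ Differ σ i := by
      rw [Differ, Differ, hτ rB₀ (by simp) i le_rfl, hτ rC₀ (by simp) i le_rfl]
    by_cases h : Differ σ i
    · rw [den_ite, if_pos (by rw [Expr.holds_differ, Expr.eval_ctr, hx, hd]; exact h)]
      rcases hr with (rfl | rfl) | (rfl | rfl) <;> simp [Store.set_row, hx, e, h]
    · rw [den_ite, if_neg (by rw [Expr.holds_differ, Expr.eval_ctr, hx, hd]; exact h), den_skip,
        if_neg h, ← hτ r hr i le_rfl, Function.update_eq_self]

/-- Use the exchange procedures to turn four bases into two pairs with the same multiplicities. -/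
def improve : Cmd :=
  exch 0 rB₀ rC₀ rMap₀ ;; exch 1 rB₁ rC₁ rMap₁ ;; mate rB₀ rMap₀ rMate₀ ;;
    mate rB₁ rMap₁ rMate₁ ;; colour ;; recombine

theorem den_exch (m : Fin 2) (r r' o : ℕ) (σ : Store) : (exch m r r' o).den M F σ
    = σ.setRow o ((F m).map (supp n (σ r)) (supp n (σ r'))) := rfl

theorem setRow_of_ne (σ : Store) {r o : ℕ} (h : r ≠ o) (f : Fin n → Fin n) :
    σ.setRow o f r = σ r := by
  funext b
  simp [Store.setRow, h]

theorem setRow_self (σ : Store) (o : ℕ) (f : Fin n → Fin n) (s : Fin n) :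
    σ.setRow o f o s = f s := by
  simp [Store.setRow]

/-- By `PairState.mem_iff` both matchings live on the same set, so one colouring serves both
matroids. The last conjunct, that the set of differences is preserved, carries the progress measure
over from B' to the new bases. -/
theorem improve_spec
    (hF : ∀ m, ∀ B B' : Finset (Fin n), (M m).IsBase (B : Set (Fin n)) →
      (M m).IsBase (B' : Set (Fin n)) →
      IsExchangeBijection (M m) (B : Set (Fin n)) (B' : Set (Fin n)) ((F m).map B B'))
    {σ : Store} (hn : σ 0 0 = n) {μ : Fin n → ℕ} {B B' C : Fin 2 → Finset (Fin n)}
    (hB' : pair n (σ rB₀) (σ rB₁) = B') (hC : pair n (σ rC₀) (σ rC₁) = C)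
    (h : PairState M μ B C) (hb : ∀ m, (M m).IsBase (B' m : Set (Fin n)))
    (hm : ∀ s, mult B' s = mult B s) :
    improve.Safe M F σ ∧
      PairState M μ (pair n (improve.den M F σ rB₀) (improve.den M F σ rB₁))
        (pair n (improve.den M F σ rC₀) (improve.den M F σ rC₁)) ∧
      ∀ s, (s ∈ supp n (improve.den M F σ rB₀) ↔ s ∈ supp n (improve.den M F σ rC₀)) ↔
        (s ∈ B' 0 ↔ s ∈ C 0) := by
  have b₀ : supp n (σ rB₀) = B' 0 := by rw [← hB']; rfl
  have b₁ : supp n (σ rB₁) = B' 1 := by rw [← hB']; rfl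
  have c₀ : supp n (σ rC₀) = C 0 := by rw [← hC]; rfl
  have c₁ : supp n (σ rC₁) = C 1 := by rw [← hC]; rfl
  set f : Fin 2 → Fin n → Fin n := fun m => (F m).map (B' m) (C m) with hf
  have hfx : ∀ m, IsExchangeBijection (M m) (B' m : Set (Fin n)) (C m : Set (Fin n)) (f m) :=
    fun m => hF m _ _ (hb m) (h.isBase' m)
  set σ₁ := σ.setRow rMap₀ (f 0) with hσ₁
  set σ₂ := σ₁.setRow rMap₁ (f 1) with hσ₂
  have hrow : ∀ r, r ≠ rMap₀ → r ≠ rMap₁ → σ₂ r = σ r := fun r h h' => by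
    rw [hσ₂, setRow_of_ne _ h', hσ₁, setRow_of_ne _ h]
  have hden₁ : (exch 0 rB₀ rC₀ rMap₀).den M F σ = σ₁ := by rw [den_exch, b₀, c₀]
  have hden₂ : (exch 1 rB₁ rC₁ rMap₁).den M F σ₁ = σ₂ := by
    rw [den_exch, show σ₁ rB₁ = σ rB₁ from setRow_of_ne _ (by simp) _,
      show σ₁ rC₁ = σ rC₁ from setRow_of_ne _ (by simp) _, b₁, c₁]
  have hn₂ : σ₂ 0 0 = n := by rw [hrow _ (by simp) (by simp), hn]
  have hmap₀ : ∀ s : Fin n, σ₂ rMap₀ s = f 0 s := fun s => by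
    rw [hσ₂, setRow_of_ne _ (by simp), hσ₁, setRow_self]
  have hmap₁ : ∀ s : Fin n, σ₂ rMap₁ s = f 1 s := fun s => by rw [hσ₂, setRow_self]
  have wf₃ : (mate rB₀ rMap₀ rMate₀).WellFormed := by decide
  have wf₄ : (mate rB₁ rMap₁ rMate₁).WellFormed := by decide
  have hmate₀ := mate_spec (M := M) (F := F) (r := rB₀) (r' := rMap₀) (o := rMate₀) (by simp)
    (by simp) (by simp) (by simp) (by simp) hn₂ hmap₀
    (by rw [hrow _ (by simp) (by simp), b₀]) (hfx 0)
  set σ₃ := (mate rB₀ rMap₀ rMate₀).den M F σ₂ with hσ₃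
  have fr₃ : Frame _ σ₂ σ₃ := wf₃.frame σ₂
  have hn₃ : σ₃ 0 0 = n := by rw [fr₃.ctr 0 rfl, hn₂]
  have hmate₁ := mate_spec (M := M) (F := F) (r := rB₁) (r' := rMap₁) (o := rMate₁) (by simp)
    (by simp) (by simp) (by simp) (by simp) hn₃ (f := f 1) (fun s => by rw [fr₃.row 20 rfl, hmap₁])
    (by rw [fr₃.row 10 rfl, hrow _ (by simp) (by simp), b₁]) (hfx 1)
  set σ₄ := (mate rB₁ rMap₁ rMate₁).den M F σ₃ with hσ₄
  have fr₄ : Frame _ σ₃ σ₄ := wf₄.frame σ₃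
  have hn₄ : σ₄ 0 0 = n := by rw [fr₄.ctr 0 rfl, hn₃]
  set σ₅ := colour.den M F σ₄ with hσ₅
  have fr₅ : Frame _ σ₄ σ₅ := colour_wf.frame σ₄
  have hn₅ : σ₅ 0 0 = n := by rw [fr₅.ctr 0 rfl, hn₄]
  have hden : improve.den M F σ = recombine.den M F σ₅ := by
    simp only [improve, den_seq, hden₁, hden₂, ← hσ₃, ← hσ₄, ← hσ₅]
  have d₄ : ∀ s : Fin n, Differ σ₄ s ↔ ¬ (s ∈ B' 0 ↔ s ∈ C 0) := by
    intro s
    rw [Differ, fr₄.row 9 rfl, fr₃.row 9 rfl, fr₄.row 11 rfl, fr₃.row 11 rfl,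
      hrow _ (by simp) (by simp), hrow _ (by simp) (by simp), ← b₀, ← c₀, mem_supp, mem_supp,
      not_iff_not (a := σ rB₀ s = 0)]
  have d₅ : ∀ s : Fin n, Differ σ₅ s ↔ ¬ (s ∈ B' 0 ↔ s ∈ C 0) := by
    intro s
    rw [← d₄, Differ, Differ, fr₅.row 9 rfl, fr₅.row 11 rfl]
  obtain ⟨φ, p₁, p₂, p₃⟩ := exists_matching (hfx 0) hmate₀
  obtain ⟨γ, q₁, q₂, q₃⟩ := exists_matching (hfx 1) hmate₁
  have hV : ∀ s, ¬ (s ∈ B' 1 ↔ s ∈ C 1) ↔ ¬ (s ∈ B' 0 ↔ s ∈ C 0) := fun s =>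
    not_congr (h.mem_iff hm s).symm
  simp only [hV, ← d₄] at p₁ p₂ q₁ q₂
  have hcol := colour_spec (M := M) (F := F) hn₄ p₁ q₁
    (fun s hs => by rw [fr₄.row 21 rfl]; exact p₂ s hs) q₂ rfl
  rw [← hσ₅] at hcol
  simp only [d₄] at hcol
  have m₁ : ∀ m s, s ∈ pair n (improve.den M F σ rB₀) (improve.den M F σ rB₁) m ↔
      if s ∈ B' 0 ↔ s ∈ C 0 then s ∈ B' m else colours n σ₅ s = 1 := by
    intro m s
    have : s ∈ pair n (improve.den M F σ rB₀) (improve.den M F σ rB₁) m ↔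
        if ¬ (s ∈ B' 0 ↔ s ∈ C 0) then colours n σ₅ s = 1 else s ∈ B' m := by
      rw [hden]
      fin_cases m
      · have := recombine_spec (M := M) (F := F) hn₅ (r := rB₀) (k := 1) (by simp) s
        rwa [fr₅.row 9 rfl, fr₄.row 9 rfl, fr₃.row 9 rfl, hrow _ (by simp) (by simp), b₀,
          if_congr (d₅ s) rfl rfl] at this
      · have := recombine_spec (M := M) (F := F) hn₅ (r := rB₁) (k := 1) (by simp) s
        rwa [fr₅.row 10 rfl, fr₄.row 10 rfl, fr₃.row 10 rfl, hrow _ (by simp) (by simp), b₁,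
          if_congr (d₅ s) rfl rfl] at this
    rw [this, ite_not]
  have m₂ : ∀ m s, s ∈ pair n (improve.den M F σ rC₀) (improve.den M F σ rC₁) m ↔
      if s ∈ B' 0 ↔ s ∈ C 0 then s ∈ C m else colours n σ₅ s = 2 := by
    intro m s
    have : s ∈ pair n (improve.den M F σ rC₀) (improve.den M F σ rC₁) m ↔
        if ¬ (s ∈ B' 0 ↔ s ∈ C 0) then colours n σ₅ s = 2 else s ∈ C m := by
      rw [hden]
      fin_cases m
      · have := recombine_spec (M := M) (F := F) hn₅ (r := rC₀) (k := 2) (by simp) s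
        rwa [fr₅.row 11 rfl, fr₄.row 11 rfl, fr₃.row 11 rfl, hrow _ (by simp) (by simp), c₀,
          if_congr (d₅ s) rfl rfl] at this
      · have := recombine_spec (M := M) (F := F) hn₅ (r := rC₁) (k := 2) (by simp) s
        rwa [fr₅.row 12 rfl, fr₄.row 12 rfl, fr₃.row 12 rfl, hrow _ (by simp) (by simp), c₁,
          if_congr (d₅ s) rfl rfl] at this
    rw [this, ite_not]
  refine ⟨⟨?_, ?_, safe_of_noExch M F _ (by decide) _⟩,
    h.recolour hm hfx (fun s hs => (hcol s hs).1) (fun m s hs hs' => ?_) m₁ m₂, fun s => ?_⟩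
  · exact ⟨by rw [rowSet_eq_supp, b₀]; exact hb 0, by rw [rowSet_eq_supp, c₀]; exact h.isBase' 0⟩
  · rw [hden₁]
    refine ⟨?_, ?_⟩
    · rw [rowSet_eq_supp, hσ₁, setRow_of_ne _ (by simp), b₁]
      exact hb 1
    · rw [rowSet_eq_supp, hσ₁, setRow_of_ne _ (by simp), c₁]
      exact h.isBase' 1
  · fin_cases m
    · have := (hcol s (by simp only [Fin.zero_eta] at hs hs'; tauto)).2.1
      rwa [p₃ s hs hs'] at this
    · have := (hcol s ((hV s).1 (by simp only [Fin.mk_one] at hs hs'; tauto))).2.2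
      rwa [q₃ s hs hs'] at this
  · have h₁ := m₁ 0 s
    have h₂ := m₂ 0 s
    rw [pair_zero] at h₁ h₂
    rw [h₁, h₂]
    by_cases hs : s ∈ B' 0 ↔ s ∈ C 0
    · simp only [hs, if_true]
    · have := (hcol s hs).1
      simp only [hs, if_false, iff_false]
      omega

end Cmd

end Refine

/-! ### The complete algorithm and its correctness -/

section Program

open scoped Classical

variable {n : ℕ} {M : Fin 2 → Matroid (Fin n)} {F : Fin 2 → ExchangeProcedure n}

namespace Cmd

/-- The number of elements in which the first bases of the two pairs differ. -/
def diff (B C : Fin 2 → Finset (Fin n)) : ℕ :=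
  (Finset.univ.filter fun s => ¬ (s ∈ B 0 ↔ s ∈ C 0)).card

/-- Get rid of a closed walk in the exchange graph, if there is one. -/
def refineStep : Cmd := scan ;; ite (.var rFound) improve skip

/-- In the second alternative, excluding a potential for the old B shows that progress occurs only
while the graph has a closed walk. -/
theorem refineStep_spec (hE : ∀ m, (M m).E = Set.univ)
    (hF : ∀ m, ∀ B B' : Finset (Fin n), (M m).IsBase (B : Set (Fin n)) →
      (M m).IsBase (B' : Set (Fin n)) →
      IsExchangeBijection (M m) (B : Set (Fin n)) (B' : Set (Fin n)) ((F m).map B B'))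
    {σ : Store} (hn : σ 0 0 = n) {μ : Fin n → ℕ} {B C B₁ C₁ : Fin 2 → Finset (Fin n)}
    (hB : pair n (σ rB₀) (σ rB₁) = B) (hC : pair n (σ rC₀) (σ rC₁) = C) (h : PairState M μ B C)
    (hB₁ : pair n (refineStep.den M F σ rB₀) (refineStep.den M F σ rB₁) = B₁)
    (hC₁ : pair n (refineStep.den M F σ rC₀) (refineStep.den M F σ rC₁) = C₁) :
    refineStep.Safe M F σ ∧ PairState M μ B₁ C₁ ∧
      (Potential M B₁ (fun v => refineStep.den M F σ rCount v) ∨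
        diff B C < diff B₁ C₁ ∧ ∀ k, ¬ Potential M B k) := by
  have hscan := scan_spec (M := M) (F := F) hE hn hB h.isBase
  have hsafe : scan.Safe M F σ := safe_of_noExch M F _ (by decide) _
  set τ := scan.den M F σ with hτ
  have hfr : Frame _ σ τ := scan_wf.frame σ
  have hCτ : pair n (τ rC₀) (τ rC₁) = C := by rw [hfr.row 11 rfl, hfr.row 12 rfl, hC]
  have hden : refineStep.den M F σ = if τ rFound 0 ≠ 0 then improve.den M F τ else τ := by
    simp only [refineStep, den_seq, den_ite, den_skip, Expr.holds_var, ← hτ]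
  have hs : (τ rFound 0 ≠ 0 → improve.Safe M F τ) → refineStep.Safe M F σ := fun h' =>
    ⟨hsafe, h', fun _ => trivial⟩
  rcases hscan with ⟨h₁, h₂, h₃, h₄⟩ | ⟨h₁, h₂⟩
  · rw [if_neg (by simp [h₁])] at hden
    rw [hden] at hB₁ hC₁ ⊢
    rw [h₂, h₃, hB] at hB₁
    rw [hCτ] at hC₁
    subst hB₁ hC₁
    exact ⟨hs (fun h' => absurd h₁ h'), h, Or.inl (potential_of_acyclic h₄)⟩
  · rw [if_pos (by simp [h₁])] at hden
    rw [hden] at hB₁ hC₁ ⊢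
    obtain ⟨h₃, h₄, h₅⟩ := improve_spec (M := M) (F := F) hF (σ := τ)
      (by rw [hfr.ctr 0 rfl, hn]) rfl hCτ h h₂.isBase h₂.mult_eq
    rw [hB₁, hC₁] at h₄
    refine ⟨hs fun _ => h₃, h₄, Or.inr ⟨?_, fun k hk => hk.not_rotation h₂⟩⟩
    obtain ⟨m, x, hx, hx'⟩ := h₂.moved
    refine (h.card_symmDiff_lt h₂.mult_eq hx hx').trans_eq ?_
    rw [diff, ← hB₁, ← hC₁]
    congr 1
    ext s
    simp only [Finset.mem_filter, Finset.mem_univ, true_and]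
    exact (not_congr (h₅ s)).symm

/-- Get rid of all closed walks in the exchange graph. -/
def refineAll : Cmd := loop 7 refineStep ;; refineStep

theorem refineAll_wf : refineAll.WellFormed := by decide

/-- The difference grows in every unfinished round and never exceeds n, so a further step after n
rounds cannot make progress. That step also leaves the vertex counts belonging to the final bases.
-/
theorem refineAll_spec (hE : ∀ m, (M m).E = Set.univ)
    (hF : ∀ m, ∀ B B' : Finset (Fin n), (M m).IsBase (B : Set (Fin n)) →
      (M m).IsBase (B' : Set (Fin n)) →
      IsExchangeBijection (M m) (B : Set (Fin n)) (B' : Set (Fin n)) ((F m).map B B'))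
    {σ : Store} (hn : σ 0 0 = n) {μ : Fin n → ℕ}
    (h : PairState M μ (pair n (σ rB₀) (σ rB₁)) (pair n (σ rC₀) (σ rC₁)))
    {B C : Fin 2 → Finset (Fin n)}
    (hB : pair n (refineAll.den M F σ rB₀) (refineAll.den M F σ rB₁) = B)
    (hC : pair n (refineAll.den M F σ rC₀) (refineAll.den M F σ rC₁) = C) :
    refineAll.Safe M F σ ∧ PairState M μ B C ∧
      Potential M B (fun v => refineAll.den M F σ rCount v) := by
  have key := loop_induction_safe (M := M) (F := F) refineAll_wf.seq_left (σ := σ) (fun i τ =>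
    PairState M μ (pair n (τ rB₀) (τ rB₁)) (pair n (τ rC₀) (τ rC₁)) ∧
    ((∃ k, Potential M (pair n (τ rB₀) (τ rB₁)) k) ∨
      i ≤ diff (pair n (τ rB₀) (τ rB₁)) (pair n (τ rC₀) (τ rC₁)))) ?_ ?_
  · obtain ⟨k₁, k₂, k₃⟩ := key
    set τ := (loop 7 refineStep).den M F σ with hτ
    have hfr : Frame _ σ τ := refineAll_wf.seq_left.frame σ
    have hden : refineAll.den M F σ = refineStep.den M F τ := rfl
    rw [hden] at hB hC ⊢
    obtain ⟨l₁, l₂, l₃⟩ := refineStep_spec (M := M) (F := F) hE hF (σ := τ)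
      (by rw [hfr.ctr 0 rfl, hn]) rfl rfl k₂ hB hC
    refine ⟨⟨k₁, l₁⟩, l₂, l₃.resolve_right fun ⟨l₄, l₅⟩ => ?_⟩
    rcases k₃ with ⟨k, hk⟩ | k₃
    · exact l₅ k hk
    · have : diff B C ≤ n := (Finset.card_le_univ _).trans (by simp)
      omega
  · exact ⟨h, Or.inr (Nat.zero_le _)⟩
  · intro i hi τ hf hx ⟨k₁, k₂⟩
    simp only [Store.set_row_of_ne _ _ _ _ (show rB₀ ≠ 0 by simp),
      Store.set_row_of_ne _ _ _ _ (show rB₁ ≠ 0 by simp),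
      Store.set_row_of_ne _ _ _ _ (show rC₀ ≠ 0 by simp),
      Store.set_row_of_ne _ _ _ _ (show rC₁ ≠ 0 by simp)]
    obtain ⟨l₁, l₂, l₃⟩ := refineStep_spec (M := M) (F := F) hE hF (σ := τ)
      (by rw [hf.ctr 0 rfl, hn]) rfl rfl k₁ rfl rfl
    refine ⟨l₁, l₂, ?_⟩
    rcases l₃ with l₃ | ⟨l₄, l₅⟩
    · exact Or.inl ⟨_, l₃⟩
    · right
      rcases k₂ with ⟨k, hk⟩ | k₂
      · exact absurd hk (l₅ k)
      · omega

/-- Duplicate the two bases and mark the elements outside of them. -/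
def duplicate : Cmd :=
  loop 1 (set rC₀ (.ctr 1) (.cell rB₀ (.ctr 1)) ;; set rC₁ (.ctr 1) (.cell rB₁ (.ctr 1)) ;;
    set rUncov (.ctr 1) (.not (.add (.cell rB₀ (.ctr 1)) (.cell rB₁ (.ctr 1)))))

theorem duplicate_wf : duplicate.WellFormed := by decide

theorem duplicate_spec {σ : Store} (hn : σ 0 0 = n) :
    supp n (duplicate.den M F σ rC₀) = supp n (σ rB₀) ∧
    supp n (duplicate.den M F σ rC₁) = supp n (σ rB₁) ∧
    ∀ s : Fin n, duplicate.den M F σ rUncov s = 0 ↔ s ∈ supp n (σ rB₀) ∪ supp n (σ rB₁) := by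
  have key := loop_pointwise (M := M) (F := F) duplicate_wf (σ := σ)
    (fun r => r = rC₀ ∨ r = rC₁ ∨ r = rUncov) (by rintro r (rfl | rfl | rfl) <;> simp)
    (fun r i => if r = rC₀ then σ rB₀ i else if r = rC₁ then σ rB₁ i else
      if σ rB₀ i + σ rB₁ i = 0 then 1 else 0) ?_
  · refine ⟨supp_congr fun j hj => ?_, supp_congr fun j hj => ?_, fun s => ?_⟩
    · have := key rC₀ (by simp) j
      rwa [if_pos (by rwa [hn])] at this
    · have := key rC₁ (by simp) j
      rwa [if_pos (by rwa [hn])] at this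
    · have := key rUncov (by simp) s
      rw [if_pos (by rw [hn]; exact s.2)] at this
      rw [duplicate, this, Finset.mem_union, mem_supp, mem_supp]
      by_cases a : σ rB₀ s = 0 <;> by_cases b : σ rB₁ s = 0 <;> simp [a, b]
  · intro i hi τ hf hx _ r hr
    have e₀ : τ rB₀ = σ rB₀ := hf.row 9 rfl
    have e₁ : τ rB₁ = σ rB₁ := hf.row 10 rfl
    rcases hr with rfl | rfl | rfl <;> simp [Store.set_row, hx, e₀, e₁]

/-- Write the prices: `2` outside of the two bases, and less than `1` on them. -/
def output : Cmd :=
  loop 1 (ite (.cell rUncov (.ctr 1))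
    (set 1 (.ctr 1) (.add (.add (.ctr 0) (.const 1)) (.add (.ctr 0) (.const 1))))
    (set 1 (.ctr 1) (.cell rCount (.ctr 1))) ;; set 2 (.ctr 1) (.add (.ctr 0) (.const 1)))

theorem output_wf : output.WellFormed := by decide

theorem output_spec {σ : Store} (hn : σ 0 0 = n) (s : Fin n) :
    output.den M F σ 1 s = (if σ rUncov s = 0 then σ rCount s else (n + 1) + (n + 1)) ∧
    output.den M F σ 2 s = n + 1 := by
  have key := loop_pointwise (M := M) (F := F) output_wf (σ := σ)
    (fun r => r = 1 ∨ r = 2) (by rintro r (rfl | rfl) <;> simp)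
    (fun r i => if r = 1 then (if σ rUncov i = 0 then σ rCount i else (n + 1) + (n + 1))
      else n + 1) ?_
  · have h₁ := key 1 (by simp) s
    have h₂ := key 2 (by simp) s
    rw [if_pos (by rw [hn]; exact s.2)] at h₁ h₂
    exact ⟨h₁, h₂⟩
  · intro i hi τ hf hx _ r hr
    have e₀ : τ rUncov = σ rUncov := hf.row 18 rfl
    have e₁ : τ rCount = σ rCount := hf.row 16 rfl
    have e₂ : τ 0 0 = n := by rw [hf.ctr 0 rfl, hn]
    by_cases a : σ rUncov i = 0
    · rcases hr with rfl | rfl <;> simp [Store.set_row, hx, e₀, e₁, e₂, a]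
    · rcases hr with rfl | rfl <;> simp [Store.set_row, hx, e₀, e₂, a]

/-- Compute the prices. -/
def pricing : Cmd := cover ;; duplicate ;; refineAll ;; output

theorem pricing_wf : pricing.WellFormed := by decide

theorem pricing_spec (hE : ∀ m, (M m).E = Set.univ)
    (hF : ∀ m, ∀ B B' : Finset (Fin n), (M m).IsBase (B : Set (Fin n)) →
      (M m).IsBase (B' : Set (Fin n)) →
      IsExchangeBijection (M m) (B : Set (Fin n)) (B' : Set (Fin n)) ((F m).map B B')) :
    pricing.Safe M F (Store.init n) ∧
      (∀ s : Fin n, pricing.den M F (Store.init n) 2 s ≠ 0) ∧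
      ∃ U, Nonempty (Certificate M U ((pricing.den M F (Store.init n)).outputPrice n)) := by
  set σ := Store.init n with hσ
  have hn : σ 0 0 = n := by simp [hσ, Store.init]
  have hz : ∀ r, r ≠ 0 → ∀ j, σ r j = 0 := fun r hr j => by simp [hσ, Store.init, hr]
  obtain ⟨hb, hcov⟩ := cover_spec (M := M) (F := F) hE hn (hz _ (by simp)) (hz _ (by simp)) rfl
  have s₁ : cover.Safe M F σ := safe_of_noExch M F _ (by decide) _
  set σ₁ := cover.den M F σ with hσ₁
  have fr₁ : Frame _ σ σ₁ := cover_wf.frame σ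
  have hn₁ : σ₁ 0 0 = n := by rw [fr₁.ctr 0 rfl, hn]
  obtain ⟨c₀, c₁, hun⟩ := duplicate_spec (M := M) (F := F) hn₁
  have s₂ : duplicate.Safe M F σ₁ := safe_of_noExch M F _ (by decide) _
  set σ₂ := duplicate.den M F σ₁ with hσ₂
  have fr₂ : Frame _ σ₁ σ₂ := duplicate_wf.frame σ₁
  have hn₂ : σ₂ 0 0 = n := by rw [fr₂.ctr 0 rfl, hn₁]
  set A := pair n (σ₁ rB₀) (σ₁ rB₁) with hA
  have hB₂ : pair n (σ₂ rB₀) (σ₂ rB₁) = A := by rw [fr₂.row 9 rfl, fr₂.row 10 rfl]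
  have hC₂ : pair n (σ₂ rC₀) (σ₂ rC₁) = A := by rw [hA, pair, pair, c₀, c₁]
  -- The refinement starts from two copies of the optimal pair. U is fixed here, since only the
  -- multiplicities survive the later recombinations.
  have hps : PairState M (mult A) A A := ⟨hb, hb, fun s => rfl, fun s => rfl⟩
  obtain ⟨s₃, hst, hpot⟩ := refineAll_spec (M := M) (F := F) hE hF (σ := σ₂) hn₂ (μ := mult A)
    (by rw [hB₂, hC₂]; exact hps) rfl rfl
  set σ₃ := refineAll.den M F σ₂ with hσ₃
  have fr₃ : Frame _ σ₂ σ₃ := refineAll_wf.frame σ₂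
  have hn₃ : σ₃ 0 0 = n := by rw [fr₃.ctr 0 rfl, hn₂]
  have hout := output_spec (M := M) (F := F) hn₃
  have s₄ : output.Safe M F σ₃ := safe_of_noExch M F _ (by decide) _
  have hden : pricing.den M F σ = output.den M F σ₃ := rfl
  set B := pair n (σ₃ rB₀) (σ₃ rB₁) with hB
  set C := pair n (σ₃ rC₀) (σ₃ rC₁) with hC
  set U := A 0 ∪ A 1 with hU
  have hU' : ∀ s : Fin n, σ₃ rUncov s = 0 ↔ s ∈ U := fun s => by
    rw [fr₃.row 18 rfl, hun]; rfl
  have hpos : (0 : ℝ) < n + 1 := by positivity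
  have hp : ∀ s ∈ U, (pricing.den M F σ).outputPrice n s = (σ₃ rCount s : ℝ) / (n + 1) := by
    intro s hs
    rw [Store.outputPrice, hden, (hout s).1, (hout s).2, if_pos ((hU' s).2 hs)]
    push_cast
    rfl
  have hp' : ∀ s ∉ U, (pricing.den M F σ).outputPrice n s = 2 := by
    intro s hs
    rw [Store.outputPrice, hden, (hout s).1, (hout s).2, if_neg (fun h => hs ((hU' s).1 h))]
    push_cast
    field_simp
    ring
  have m₀ : ∀ s, s ∈ U ↔ s ∈ B 0 ∨ s ∈ C 1 := fun s => by
    rw [hU, ← mult_ne_zero, ← hst.eq₀ s]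
    by_cases a : s ∈ B 0 <;> by_cases b : s ∈ C 1 <;> simp [a, b]
  have m₁ : ∀ s, s ∈ U ↔ s ∈ C 0 ∨ s ∈ B 1 := fun s => by
    rw [hU, ← mult_ne_zero, ← hst.eq₁ s]
    by_cases a : s ∈ C 0 <;> by_cases b : s ∈ B 1 <;> simp [a, b]
  refine ⟨⟨s₁, s₂, s₃, s₄⟩, fun s => ?_, U, ⟨⟨B, C, hst.isBase, hst.isBase', m₀, m₁, hcov,
    fun s hs => ?_, fun s hs => ?_, fun s hs => ?_, fun m u hu w harc => ?_⟩⟩⟩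
  · rw [hden, (hout s).2]; omega
  · rw [hp s hs]
    have : 0 < σ₃ rCount s := hpot.pos s
    positivity
  · rw [hp s hs, div_lt_one hpos]
    have : (σ₃ rCount s : ℝ) ≤ n := by exact_mod_cast hpot.le s
    linarith
  · rw [hp' s hs]; norm_num
  · have hw : w ∈ U := by
      have := harc.2.1
      fin_cases m
      · exact (m₀ w).2 (Or.inl this)
      · exact (m₁ w).2 (Or.inr this)
    rw [hp u hu, hp w hw]
    have : (σ₃ rCount w : ℝ) < σ₃ rCount u := by exact_mod_cast hpot.lt u w ⟨m, harc⟩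
    exact div_lt_div_of_pos_right this hpos

end Cmd

/-- A single program serves (A) and (B); the precondition enters only when its certificate is
interpreted. -/
theorem polyTimePricing_of_certificate
    {Pre : ∀ n : ℕ, Matroid (Fin n) → Matroid (Fin n) → Prop}
    {Good : ∀ n : ℕ, Matroid (Fin n) → Matroid (Fin n) → (Fin n → ℝ) → Prop}
    (h : ∀ (n : ℕ) (M : Fin 2 → Matroid (Fin n)), (∀ m, (M m).E = Set.univ) →
      (∀ m, StronglyBaseOrderable (M m)) → Pre n (M 0) (M 1) →
      ∀ U p, Certificate M U p → Good n (M 0) (M 1) p) : PolyTimePricing Pre Good := by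
  refine ⟨Cmd.pricing.compile, fun q => ⟨Cmd.pricing.timeBound q, ?_⟩⟩
  intro n M F hE hM hF hpre
  obtain ⟨h₁, h₂, U, ⟨h₃⟩⟩ := Cmd.pricing_spec (M := M) (F := F) hE
    (fun m B B' hB hB' => (hF m B B' hB hB').1)
  obtain ⟨t, h₄, h₅⟩ := Cmd.exec_compile Cmd.pricing_wf hF (by simp [Store.init]) h₁
  exact ⟨t, _, h₄, h₅, h₂, h n M hE hM hpre U _ h₃⟩

theorem polyTimePricing_base : PolyTimePricing (fun _ M₁ M₂ => ComplementaryBases M₁ M₂)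
    (fun _ M₁ M₂ p => IsBasePricing M₁ M₂ p) :=
  polyTimePricing_of_certificate fun _ _ hE hM hpre _ _ h => h.isBasePricing hE hM hpre

theorem polyTimePricing_rank : PolyTimePricing (fun _ _ _ => True)
    (fun _ M₁ M₂ p => IsRankPricing M₁ M₂ p) :=
  polyTimePricing_of_certificate fun _ _ hE hM _ _ _ h => h.isRankPricing hE hM

end Program

/-! ### From labelled items to arbitrary finite ground sets -/

section Transport

variable {α : Type*} {n : ℕ} {f : Fin n → α} {M : Matroid α}

theorem isBase_comap_iff (hf : f.Injective) (hE : Set.range f = M.E) {B : Set (Fin n)} :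
    (M.comap f).IsBase B ↔ M.IsBase (f '' B) := by
  rw [Matroid.comap_isBase_iff, ← hE, Set.preimage_range, Set.image_univ, hE,
    Matroid.isBasis_ground_iff]
  simp [hf.injOn]

theorem StronglyBaseOrderable.comap (hM : StronglyBaseOrderable M) (hf : f.Injective)
    (hE : Set.range f = M.E) : StronglyBaseOrderable (M.comap f) := by
  intro B B' hB hB'
  rw [isBase_comap_iff hf hE] at hB hB'
  obtain ⟨g, hg, hg'⟩ := hM _ _ hB hB'
  have hex : ∀ i, ∃ j, i ∈ B → f j = g (f i) := by
    intro i
    by_cases hi : i ∈ B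
    · obtain ⟨j, -, hj⟩ := hg.mapsTo (Set.mem_image_of_mem f hi)
      exact ⟨j, fun _ => hj⟩
    · exact ⟨i, fun h => absurd h hi⟩
  choose h hh using hex
  refine ⟨h, ⟨fun i hi => ?_, fun i hi j hj hij => ?_, fun j hj => ?_⟩, fun X hX => ?_⟩
  · have := hg.mapsTo (Set.mem_image_of_mem f hi)
    rw [← hh i hi] at this
    exact (hf.mem_set_image).1 this
  · refine hf (hg.injOn (Set.mem_image_of_mem f hi) (Set.mem_image_of_mem f hj) ?_)
    rw [← hh i hi, ← hh j hj, hij]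
  · obtain ⟨-, ⟨i, hi, rfl⟩, hij⟩ := hg.surjOn (Set.mem_image_of_mem f hj)
    refine ⟨i, hi, hf ?_⟩
    rw [hh i hi, hij]
  · rw [isBase_comap_iff hf hE, Set.image_union, Set.image_sdiff hf]
    convert hg' (f '' X) (Set.image_mono hX) using 2
    rw [Set.image_image, Set.image_image]
    exact Set.image_congr fun i hi => hh i (hX hi)

variable (e : Fin n ↪ α)

theorem exists_map_eq {E : Set α} (hE : Set.range e = E) {X : Finset α} (hX : (X : Set α) ⊆ E) :
    ∃ Y : Finset (Fin n), Y.map e = X := by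
  classical
  refine ⟨X.preimage e e.injective.injOn, ?_⟩
  ext a
  simp only [Finset.mem_map, Finset.mem_preimage]
  constructor
  · rintro ⟨i, hi, rfl⟩
    exact hi
  · intro ha
    obtain ⟨i, rfl⟩ : a ∈ Set.range e := hE ▸ hX ha
    exact ⟨i, ha, rfl⟩

theorem rank_comap (X : Finset (Fin n)) : rank (M.comap e) X = rank M (X.map e) := by
  rw [rank, rank, Matroid.eRk_comap, Finset.coe_map]

/-- Prices of the labels, regarded as prices of the items. -/
noncomputable def extendPrice (q : Fin n → ℝ) : α → ℝ := Function.extend e q 0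

theorem price_map (q : Fin n → ℝ) (X : Finset (Fin n)) :
    price (extendPrice e q) (X.map e) = price q X := by
  rw [price, price, Finset.sum_map]
  exact Finset.sum_congr rfl fun i _ => e.injective.extend_apply _ _ _

variable {e} {q : Fin n → ℝ}

theorem IsCheapestBase.comap (hE : Set.range e = M.E) {X : Finset (Fin n)}
    (h : IsCheapestBase M (extendPrice e q) (X.map e)) : IsCheapestBase (M.comap e) q X := by
  refine ⟨?_, fun Y hY => ?_⟩
  · rw [isBase_comap_iff e.injective hE, ← Finset.coe_map]
    exact h.1
  · rw [isBase_comap_iff e.injective hE, ← Finset.coe_map] at hY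
    have := h.2 _ hY
    rwa [price_map, price_map] at this

theorem IsBestBundle.comap {T : Set α} {X : Finset (Fin n)}
    (h : IsBestBundle M (extendPrice e q) T (X.map e)) :
    IsBestBundle (M.comap e) q (e ⁻¹' T) X := by
  refine ⟨?_, fun Y hY => ?_⟩
  · have := h.1
    rwa [Finset.coe_map, Set.image_subset_iff] at this
  · have := h.2 (Y.map e) (by rwa [Finset.coe_map, Set.image_subset_iff])
    rwa [price_map, price_map, ← rank_comap, ← rank_comap] at this

variable {M₁ M₂ : Matroid α}

theorem isBasePricing_of_comap (h₁ : Set.range e = M₁.E) (h₂ : Set.range e = M₂.E)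
    (h : IsBasePricing (M₁.comap e) (M₂.comap e) q) :
    IsBasePricing M₁ M₂ (extendPrice e q) := by
  have himage : ∀ X : Finset (Fin n),
      e '' ((M₁.comap e).E \ (X : Set (Fin n))) = M₁.E \ (X.map e : Set α) := by
    intro X
    rw [Matroid.comap_ground_eq, Set.image_sdiff e.injective, ← h₁, Set.preimage_range,
      Set.image_univ, Finset.coe_map]
  constructor
  · intro B hB
    obtain ⟨X, rfl⟩ := exists_map_eq e h₁ hB.1.subset_ground
    have := h.1 X (hB.comap h₁)
    rwa [isBase_comap_iff e.injective h₂, himage] at this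
  · intro B hB
    obtain ⟨X, rfl⟩ := exists_map_eq e h₂ hB.1.subset_ground
    have := h.2 X (hB.comap h₂)
    rwa [isBase_comap_iff e.injective h₁, himage] at this

theorem isWelfareOptimal_of_comap (h₁ : Set.range e = M₁.E) {X Y : Finset (Fin n)}
    (h : IsWelfareOptimal (M₁.comap e) (M₂.comap e) X Y) :
    IsWelfareOptimal M₁ M₂ (X.map e) (Y.map e) := by
  have hsub : ∀ Z : Finset (Fin n), (Z.map e : Set α) ⊆ M₁.E := fun Z => by
    rw [← h₁, Finset.coe_map]
    exact Set.image_subset_range _ _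
  obtain ⟨⟨X', Y', -, -, hd, hw⟩, hmax⟩ := h
  rw [IsWelfareOptimal, ← rank_comap, ← rank_comap]
  refine ⟨⟨X'.map e, Y'.map e, hsub _, hsub _, ?_, ?_⟩, ?_⟩
  · rwa [Finset.disjoint_map]
  · rw [hw, rank_comap, rank_comap]
  · rintro w ⟨Z, W, hZ, hW, hZW, rfl⟩
    obtain ⟨Z, rfl⟩ := exists_map_eq e h₁ hZ
    obtain ⟨W, rfl⟩ := exists_map_eq e h₁ hW
    rw [← rank_comap, ← rank_comap]
    have hE : (M₁.comap e).E = Set.univ := by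
      rw [Matroid.comap_ground_eq, ← h₁, Set.preimage_range]
    exact hmax ⟨Z, W, hE ▸ Set.subset_univ _, hE ▸ Set.subset_univ _,
      (Finset.disjoint_map e).1 hZW, rfl⟩

theorem isRankPricing_of_comap (h₁ : Set.range e = M₁.E)
    (h : IsRankPricing (M₁.comap e) (M₂.comap e) q) :
    IsRankPricing M₁ M₂ (extendPrice e q) := by
  have hpre : ∀ X : Finset (Fin n),
      e ⁻¹' (M₁.E \ (X.map e : Set α)) = (M₁.comap e).E \ (X : Set (Fin n)) := by
    intro X
    rw [Set.preimage_sdiff, Finset.coe_map, Set.preimage_image_eq _ e.injective]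
    rfl
  constructor
  · intro B hB B' hB'
    obtain ⟨X, rfl⟩ := exists_map_eq e h₁ hB.1
    obtain ⟨Y, rfl⟩ := exists_map_eq e h₁ (hB'.1.trans Set.sdiff_subset)
    refine isWelfareOptimal_of_comap h₁ (h.1 X hB.comap Y ?_)
    rw [← hpre]
    exact hB'.comap
  · intro B hB B' hB'
    obtain ⟨X, rfl⟩ := exists_map_eq e h₁ hB.1
    obtain ⟨Y, rfl⟩ := exists_map_eq e h₁ (hB'.1.trans Set.sdiff_subset)
    refine isWelfareOptimal_of_comap h₁ (h.2 X hB.comap Y ?_)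
    rw [← hpre]
    exact hB'.comap

theorem ComplementaryBases.comap (h₁ : Set.range e = M₁.E) (h₂ : Set.range e = M₂.E)
    (h : ComplementaryBases M₁ M₂) : ComplementaryBases (M₁.comap e) (M₂.comap e) := by
  obtain ⟨B₁, B₂, hB₁, hB₂, hd, hu⟩ := h
  refine ⟨e ⁻¹' B₁, e ⁻¹' B₂, ?_, ?_, hd.preimage e, ?_⟩
  · rw [isBase_comap_iff e.injective h₁, Set.image_preimage_eq_of_subset]
    · exact hB₁
    · rw [h₁]; exact hB₁.subset_ground
  · rw [isBase_comap_iff e.injective h₂, Set.image_preimage_eq_of_subset]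
    · exact hB₂
    · rw [h₂]; exact hB₂.subset_ground
  · rw [← Set.preimage_union, hu]
    rfl

/-- Price vectors that can be computed exist. -/
theorem PolyTimePricing.exists
    {Pre : ∀ n : ℕ, Matroid (Fin n) → Matroid (Fin n) → Prop}
    {Good : ∀ n : ℕ, Matroid (Fin n) → Matroid (Fin n) → (Fin n → ℝ) → Prop}
    (h : PolyTimePricing Pre Good) {N₁ N₂ : Matroid (Fin n)} (h₁ : N₁.E = Set.univ)
    (h₂ : N₂.E = Set.univ) (hN₁ : StronglyBaseOrderable N₁) (hN₂ : StronglyBaseOrderable N₂)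
    (hpre : Pre n N₁ N₂) : ∃ q, Good n N₁ N₂ q := by
  classical
  obtain ⟨c, hc⟩ := h
  -- The time bound 0 is admissible: the procedures below are tables of chosen exchange bijections,
  -- declared to take no time.
  obtain ⟨r, hr⟩ := hc 0
  have hN : ∀ m : Fin 2, StronglyBaseOrderable (![N₁, N₂] m) := by
    intro m; fin_cases m <;> assumption
  have hE : ∀ m : Fin 2, (![N₁, N₂] m).E = Set.univ := by
    intro m; fin_cases m <;> assumption
  have hex : ∀ (m : Fin 2) (B B' : Finset (Fin n)), ∃ f : Fin n → Fin n,
      (![N₁, N₂] m).IsBase (B : Set (Fin n)) → (![N₁, N₂] m).IsBase (B' : Set (Fin n)) →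
      IsExchangeBijection (![N₁, N₂] m) (B : Set (Fin n)) (B' : Set (Fin n)) f := by
    intro m B B'
    by_cases hB : (![N₁, N₂] m).IsBase (B : Set (Fin n)) ∧
        (![N₁, N₂] m).IsBase (B' : Set (Fin n))
    · obtain ⟨f, hf⟩ := hN m _ _ hB.1 hB.2
      exact ⟨f, fun _ _ => hf⟩
    · exact ⟨id, fun h h' => absurd ⟨h, h'⟩ hB⟩
  choose f hf using hex
  obtain ⟨-, σ, -, -, -, hσ⟩ := hr n ![N₁, N₂] (fun m => ⟨f m, fun _ _ => 0⟩) hE hN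
    (fun m B B' hB hB' => ⟨hf m B B' hB hB', Nat.zero_le _⟩) hpre
  exact ⟨_, hσ⟩

end Transport

end MatroidPricing

open MatroidPricing in
theorem theorem2 :
    (∀ (α : Type*) (M₁ M₂ : Matroid α), M₁.Finite → M₂.Finite → M₁.E = M₂.E →
      StronglyBaseOrderable M₁ → StronglyBaseOrderable M₂ →
        (ComplementaryBases M₁ M₂ → ∃ p : α → ℝ, IsBasePricing M₁ M₂ p) ∧
        (∃ p : α → ℝ, IsRankPricing M₁ M₂ p)) ∧
    PolyTimePricing (fun _ M₁ M₂ => ComplementaryBases M₁ M₂)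
      (fun _ M₁ M₂ p => IsBasePricing M₁ M₂ p) ∧
    PolyTimePricing (fun _ _ _ => True)
      (fun _ M₁ M₂ p => IsRankPricing M₁ M₂ p) := by
  refine ⟨fun α M₁ M₂ hfin _ hE hM₁ hM₂ => ?_, polyTimePricing_base, polyTimePricing_rank⟩
  -- Existence is derived from the algorithm on the labelled copies of the matroids; items outside
  -- the ground set get price 0, which plays no role.
  obtain ⟨n, e, h₁⟩ := hfin.ground_finite.fin_embedding
  have h₂ : Set.range e = M₂.E := h₁.trans hE
  have e₁ : (M₁.comap e).E = Set.univ := by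
    rw [Matroid.comap_ground_eq, ← h₁, Set.preimage_range]
  have e₂ : (M₂.comap e).E = Set.univ := by
    rw [Matroid.comap_ground_eq, ← h₂, Set.preimage_range]
  have s₁ := hM₁.comap e.injective h₁
  have s₂ := hM₂.comap e.injective h₂
  constructor
  · intro hc
    obtain ⟨q, hq⟩ := polyTimePricing_base.exists e₁ e₂ s₁ s₂ (hc.comap h₁ h₂)
    exact ⟨_, isBasePricing_of_comap h₁ h₂ hq⟩
  · obtain ⟨q, hq⟩ := polyTimePricing_rank.exists e₁ e₂ s₁ s₂ trivial
    exact ⟨_, isRankPricing_of_comap h₁ hq⟩
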